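/- Let $n,N\ge 1$ be integers, $\lambda\vdash n$ a partition with parts $\lambda_1\ge\dots\ge\lambda_\ell>0$, $\theta$ a permutation of $\langle n\rangle=\{1,\dots,n\}$ whose cycle type (fixed points counted as parts $1$) is $\lambda$, and $\Theta$ the partition of $\langle n\rangle$ into $\theta$-orbits. Let $\Xi_N$ be a standard $N\times N$ GUE matrix, i.e. a random Hermitian matrix whose diagonal entries and whose real and imaginary parts of entries above the diagonal are independent centered Gaussians, of variance $1$ on the diagonal and variance $\frac12$ for the real and imaginary parts. Put $$\mathfrak M_{\lambda,N}=\kappa\left(\operatorname{tr}\Xi_N^{\lambda_1},\dots,\operatorname{tr}\Xi_N^{\lambda_\ell}\right),$$ where $\kappa(X_1,\dots,X_\ell)=\sum_{\Pi}(-1)^{|\Pi|-1}(|\Pi|-1)!\prod_{A\in\Pi}\mathbf E\prod_{i\in A}X_i$ (sum over the set partitions $\Pi$ of $\{1,\dots,\ell\}$) is the joint cumulant. Notation. (a) A bond is a two-element subset of $\langle n\rangle$. For a set $\Gamma$ of bonds, $\Gamma\vee\Theta$ is the finest partition coarser than or equal to $\Theta$ such that every $e\in\Gamma$ lies in one block;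 $\mathrm{Tree}_n(\Theta)$ is the set of all $\Gamma$ such that $\Gamma\vee\Theta$ has only one block and $|\Gamma|+1=|\Theta|$. (b) For a partition $\Pi$ of $\langle n\rangle$ let $[\Pi]$ be the $n\times n$ matrix with $(i,j)$ entry $1$ if $i,j$ are in the same block and $0$ otherwise. For $\Gamma\in\mathrm{Tree}_n(\Theta)$ with $m=|\Gamma|$, $\mathbb P^\Theta_\Gamma$ is the probability measure on the set of positive semidefinite $n\times n$ matrices with entries in $[0,1]$ and unit diagonal given by $$\int F\,d\mathbb P_\Gamma^\Theta=\sum_{(e_1,\dots,e_m)}\ \int_{1>t_1>\dots>t_m>0}F\left([\Theta]+\sum_{\alpha=1}^{m}t_\alpha\big([\{e_1,\dots,e_\alpha\}\vee\Theta]-[\{e_1,\dots,e_{\alpha-1}\}\vee\Theta]\big)\right)dt_1\cdots dt_m,$$ the sum being over all orderings $(e_1,\dots,e_m)$ of $\Gamma$. (c) On $\mathbb R[z]$, $z=\{z_{ij}\}_{1\le i\le n,\,0\le j\le 2N}$, put $D_{\{i,i'\}}=\sum_{j=0}^{2N}\frac{\partial^2}{\partial z_{ij}\partial z_{i'j}}$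 and $D^\Gamma=\prod_{e\in\Gamma}D_e$. (d) $\mathrm{Motz}_n^N(\theta)$ is the set of $h:\langle n\rangle\to\{1,\dots,N\}$ with $|h(\theta(i))-h(i)|\le1$ for all $i$ (families of closed Motzkin paths indexed by the $\theta$-orbits). Put $J_h(\epsilon)=\{i\mid h(\theta(i))=h(i)+\epsilon\}$ and $$f^h=\prod_{i\in J_h(0)}z_{i0}\cdot\prod_{i\in J_h(1)}\ \sum_{j=1}^{2h(i)}\frac{z_{ij}^2}{2}.$$ (e) Let $\{\xi_{kj}\}_{k\ge 1,\,j\ge 0}$ be i.i.d. standard normal and $\zeta^h_{ij}=\xi_{h(i),j}$ for $1\le i\le n$, $0\le j\le 2N$. For a positive semidefinite $Q$ with entries in $[0,1]$ and unit diagonal, $\zeta^h\star Q$ is a centered Gaussian family with $\mathbf E(\zeta^h\star Q)_{ij}(\zeta^h\star Q)_{i'j'}=Q(i,i')\,\mathbf E\zeta^h_{ij}\zeta^h_{i'j'}$. Then $$\mathfrak M_{\lambda,N}=\sum_{(\Gamma,h)\in \mathrm{Tree}_n(\Theta)\times\mathrm{Motz}_n^N(\theta)}\left(\prod_{\{i_1,i_2\}\in\Gamma}\delta_{h(i_1),h(i_2)}\right)\int\mathbf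 E\left[(D^\Gamma f^h)(\zeta^h\star Q)\right]\,\mathbb P^\Theta_\Gamma(dQ).$$ Furthermore, the summand indexed by $(\Gamma,h)$ vanishes unless all four of the following conditions hold: 1. $h$ is constant on each $e\in\Gamma$; 2. for each $e\in\Gamma$, $e\subset J_h(0)$ or $e\subset J_h(1)$; 3. for each $i\in J_h(0)$ there is at most one $e\in\Gamma$ with $i\in e$; 4. for each $i\in\langle n\rangle$ there are at most two $e\in\Gamma$ with $i\in e$. -/

import Mathlib

namespace GUECumulant

open MeasureTheory ProbabilityTheory
open scoped Nat

noncomputable section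

/-! ### Joint cumulants and standard GUE matrices -/

/-- The joint cumulant of a nonempty finite family of real random variables, as a sum over the set
partitions `π` of the index set with weights `(-1)^(|π|-1) (|π|-1)!`. -/
def jointCumulant {Ω : Type*} [MeasurableSpace Ω] (P : Measure Ω)
    {ι : Type*} [Fintype ι] [DecidableEq ι] (X : ι → Ω → ℝ) : ℝ :=
  ∑ π : Finpartition (Finset.univ : Finset ι),
    (-1 : ℝ) ^ (π.parts.card - 1) * ((π.parts.card - 1)! : ℝ) *
      ∏ A ∈ π.parts, ∫ ω, ∏ i ∈ A, X i ω ∂P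

/-- The real coordinates of a Hermitian matrix: for `i ≤ j` the real part of the entry `(i, j)` is
stored at `(i, j)`, and for `i < j` the imaginary part of the entry `(i, j)` is stored
at `(j, i)`. -/
def hermitianCoord {N : ℕ} (H : Matrix (Fin N) (Fin N) ℂ) (p : Fin N × Fin N) : ℝ :=
  if p.1 ≤ p.2 then (H p.1 p.2).re else (H p.2 p.1).im

/-- A standard GUE matrix: a random Hermitian matrix whose diagonal entries and whose real and
imaginary parts of entries above the diagonal are independent centered Gaussians, the former of
variance `1` and the latter of variance `1 / 2`. -/
structure IsStandardGUE {Ω : Type*} [MeasurableSpace Ω] {N : ℕ}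
    (Ξ : Ω → Matrix (Fin N) (Fin N) ℂ) (P : Measure Ω) : Prop where
  isHermitian : ∀ᵐ ω ∂P, (Ξ ω).IsHermitian
  indep : iIndepFun (fun (p : Fin N × Fin N) (ω : Ω) => hermitianCoord (Ξ ω) p) P
  hasLaw : ∀ p : Fin N × Fin N, HasLaw (fun ω => hermitianCoord (Ξ ω) p)
    (gaussianReal 0 (if p.1 = p.2 then 1 else 1 / 2)) P

/-- The joint cumulant of `tr Ξ ^ lam_1, …, tr Ξ ^ lam_ℓ`, where `lam_1 ≥ … ≥ lam_ℓ` are the parts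
of `lam`. (Traces of powers of Hermitian matrices are real.) -/
def traceCumulant {Ω : Type*} [MeasurableSpace Ω] (P : Measure Ω) {N : ℕ}
    (Ξ : Ω → Matrix (Fin N) (Fin N) ℂ) {n : ℕ} (lam : n.Partition) : ℝ :=
  jointCumulant P fun (i : Fin (lam.parts.sort (· ≥ ·)).length) ω =>
    (Matrix.trace (Ξ ω ^ (lam.parts.sort (· ≥ ·)).get i)).re

/-! ### Bonds, trees and interpolation measures

Set partitions of `{1, …, n}` are represented by equivalence relations on `Fin n`, ordered by
refinement; bonds are the non-diagonal elements of `Sym2 (Fin n)`. -/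

/-- The partition `Γ ∨ Θ`: the finest coarsening of `Θ` such that every bond in `Γ` lies in
a single block. -/
def bondJoin {n : ℕ} (Γ : Finset (Sym2 (Fin n))) (Θ : Setoid (Fin n)) : Setoid (Fin n) :=
  sInf {Ψ | Θ ≤ Ψ ∧ ∀ e ∈ Γ, ∀ i ∈ e, ∀ j ∈ e, Ψ i j}

open Classical in
/-- The sets `Γ` of bonds which make the blocks of `Θ` into the vertices of a tree: `Γ ∨ Θ` has
just one block and `|Γ| + 1 = |Θ|`. -/
def trees {n : ℕ} (Θ : Setoid (Fin n)) : Finset (Finset (Sym2 (Fin n))) :=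
  {Γ | (∀ e ∈ Γ, ¬ e.IsDiag) ∧ bondJoin Γ Θ = ⊤ ∧ Γ.card + 1 = Nat.card (Quotient Θ)}

open Classical in
/-- The zero-one matrix `[Ψ]` representing a set partition `Ψ`. -/
def partitionMatrix {n : ℕ} (Ψ : Setoid (Fin n)) : Fin n → Fin n → ℝ :=
  fun i j => if Ψ i j then 1 else 0

/-- For an enumeration `e_1, …, e_m` of `Γ`, the matrix
`[Θ] + ∑ α, t_α ([{e_1, …, e_α} ∨ Θ] - [{e_1, …, e_{α-1}} ∨ Θ])`. -/
def interpolationMatrix {n : ℕ} (Θ : Setoid (Fin n)) (Γ : Finset (Sym2 (Fin n)))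
    (e : Fin Γ.card ≃ Γ) (t : Fin Γ.card → ℝ) : Fin n → Fin n → ℝ :=
  partitionMatrix Θ + ∑ α, t α •
    (partitionMatrix (bondJoin ((Finset.Iic α).image fun β => (e β : Sym2 (Fin n))) Θ) -
      partitionMatrix (bondJoin ((Finset.Iio α).image fun β => (e β : Sym2 (Fin n))) Θ))

/-- The simplex `1 > t_1 > ⋯ > t_m > 0`. -/
def orderedSimplex (m : ℕ) : Set (Fin m → ℝ) :=
  {t | StrictAnti t ∧ ∀ α, 0 < t α ∧ t α < 1}

/-- The probability measure attached to a partition `Θ` and a tree `Γ`: the sum over all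
enumerations of `Γ` of the image of Lebesgue measure on the simplex `1 > t_1 > ⋯ > t_m > 0` under
`interpolationMatrix`. It is carried by convex combinations of the matrices `[Ψ]`, hence by positive
semidefinite matrices with entries in `[0, 1]` and unit diagonal. -/
def treeMeasure {n : ℕ} (Θ : Setoid (Fin n)) (Γ : Finset (Sym2 (Fin n))) :
    Measure (Fin n → Fin n → ℝ) :=
  ∑ e : Fin Γ.card ≃ Γ,
    (volume.restrict (orderedSimplex Γ.card)).map (interpolationMatrix Θ Γ e)

/-! ### Differential operators on polynomials in the variables `z_{ij}`, `0 ≤ j ≤ 2 N` -/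

/-- The indices of the variables `z_{ij}`. -/
abbrev Var (n N : ℕ) : Type := Fin n × Fin (2 * N + 1)

/-- `∂² / ∂z_a ∂z_b`. -/
def secondDeriv {n N : ℕ} (a b : Var n N) : Module.End ℝ (MvPolynomial (Var n N) ℝ) :=
  (MvPolynomial.pderiv a).toLinearMap * (MvPolynomial.pderiv b).toLinearMap

theorem pderiv_commute {σ : Type*} (a b : σ) :
    Commute ((MvPolynomial.pderiv (R := ℝ) a).toLinearMap : Module.End ℝ (MvPolynomial σ ℝ))
      ((MvPolynomial.pderiv (R := ℝ) b).toLinearMap : Module.End ℝ (MvPolynomial σ ℝ)) := by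
  classical
  have h : ⁅MvPolynomial.pderiv (R := ℝ) a, MvPolynomial.pderiv (R := ℝ) b⁆ = 0 := by
    apply MvPolynomial.derivation_ext
    intro i
    rw [Derivation.commutator_apply]
    simp [MvPolynomial.pderiv_X, Pi.single_apply, apply_ite]
  apply LinearMap.ext
  intro p
  have h2 := congrArg (fun D : Derivation ℝ (MvPolynomial σ ℝ) (MvPolynomial σ ℝ) => D p) h
  simp only [Derivation.commutator_apply, Derivation.zero_apply] at h2
  exact sub_eq_zero.mp h2

theorem secondDeriv_commute {n N : ℕ} (a b c d : Var n N) :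
    Commute (secondDeriv a b) (secondDeriv c d) :=
  ((pderiv_commute a c).mul_right (pderiv_commute a d)).mul_left
    ((pderiv_commute b c).mul_right (pderiv_commute b d))

/-- For a bond `e = {i, i'}`, the operator `D_e = ∑ j, ∂² / ∂z_{ij} ∂z_{i'j}`. -/
def bondOperator {n : ℕ} (N : ℕ) (e : Sym2 (Fin n)) :
    Module.End ℝ (MvPolynomial (Var n N) ℝ) :=
  Sym2.lift ⟨fun i i' => ∑ j : Fin (2 * N + 1), secondDeriv (i, j) (i', j), fun _ _ =>
    Finset.sum_congr rfl fun _ _ => pderiv_commute _ _⟩ e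

theorem bondOperator_commute {n : ℕ} (N : ℕ) (e e' : Sym2 (Fin n)) :
    Commute (bondOperator N e) (bondOperator N e') := by
  induction e using Sym2.ind
  induction e' using Sym2.ind
  simp only [bondOperator, Sym2.lift_mk]
  exact Commute.sum_right _ _ _ fun _ _ => Commute.sum_left _ _ _ fun _ _ =>
    secondDeriv_commute _ _ _ _

/-- The operator `D^Γ = ∏ e ∈ Γ, D_e`. -/
def treeOperator {n : ℕ} (N : ℕ) (Γ : Finset (Sym2 (Fin n))) :
    Module.End ℝ (MvPolynomial (Var n N) ℝ) :=
  Γ.noncommProd (bondOperator N) fun e _ e' _ _ => bondOperator_commute N e e'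

/-! ### Closed Motzkin paths and the terms of the expansion -/

/-- The functions `h : {1, …, n} → {1, …, N}` such that `|h (θ i) - h i| ≤ 1` for all `i`. -/
def motzkin {n : ℕ} (N : ℕ) (θ : Equiv.Perm (Fin n)) : Finset (Fin n → ℕ) :=
  {h ∈ Fintype.piFinset fun _ => Finset.Icc 1 N | ∀ i, |(h (θ i) : ℤ) - h i| ≤ 1}

/-- `J_h(ε) = {i | h (θ i) = h i + ε}`. -/
def stepSet {n : ℕ} (θ : Equiv.Perm (Fin n)) (h : Fin n → ℕ) (ε : ℤ) : Finset (Fin n) :=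
  {i | (h (θ i) : ℤ) = h i + ε}

/-- The polynomial `f^h = ∏_{i ∈ J_h(0)} z_{i0} ∏_{i ∈ J_h(1)} ∑_{j=1}^{2 h(i)} z_{ij}^2 / 2`. -/
def pathPolynomial {n : ℕ} (N : ℕ) (θ : Equiv.Perm (Fin n)) (h : Fin n → ℕ) :
    MvPolynomial (Var n N) ℝ :=
  (∏ i ∈ stepSet θ h 0, MvPolynomial.X (i, 0)) *
    ∏ i ∈ stepSet θ h 1, ∑ j : Fin (2 * N + 1) with 1 ≤ j.val ∧ j.val ≤ 2 * h i,
      MvPolynomial.C (1 / 2 : ℝ) * MvPolynomial.X (i, j) ^ 2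

/-- The law of a family `ξ_{kj}` of independent standard normal random variables. -/
def normalFamily : Measure (ℕ × ℕ → ℝ) := Measure.infinitePi fun _ => gaussianReal 0 1

/-- The Gaussian family `ζ^h_{ij} = ξ_{h(i), j}`. -/
def pathGaussian {n : ℕ} (N : ℕ) (h : Fin n → ℕ) (p : Var n N) (ξ : ℕ × ℕ → ℝ) : ℝ :=
  ξ (h p.1, p.2)

/-- The law of the `Q`-recoupling `ζ ⋆ Q` of a family `ζ`: the centered Gaussian law whose
covariances are `Q(i, i') E[ζ_{ij} ζ_{i'j'}]`. -/
def recoupledLaw {Ω : Type*} [MeasurableSpace Ω] (P : Measure Ω) {n N : ℕ}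
    (ζ : Var n N → Ω → ℝ) (Q : Fin n → Fin n → ℝ) : Measure (EuclideanSpace ℝ (Var n N)) :=
  multivariateGaussian 0 (Matrix.of fun p q => Q p.1 q.1 * ∫ ω, ζ p ω * ζ q ω ∂P)

/-- The partition of `{1, …, n}` into the orbits of `θ`. -/
def orbitPartition {n : ℕ} (θ : Equiv.Perm (Fin n)) : Setoid (Fin n) :=
  Equiv.Perm.SameCycle.setoid θ

open Classical in
/-- The term
`(∏_{{i, i'} ∈ Γ} δ_{h(i), h(i')}) ∫ E[(D^Γ f^h)(ζ^h ⋆ Q)] dP_Γ^Θ(Q)`, where `Θ` is the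
partition into the orbits of `θ`. -/
def expansionTerm {n : ℕ} (N : ℕ) (θ : Equiv.Perm (Fin n)) (Γ : Finset (Sym2 (Fin n)))
    (h : Fin n → ℕ) : ℝ :=
  (∏ e ∈ Γ, if ∀ i ∈ e, ∀ i' ∈ e, h i = h i' then (1 : ℝ) else 0) *
    ∫ Q, (∫ x, MvPolynomial.eval (fun p => x p) (treeOperator N Γ (pathPolynomial N θ h))
        ∂(recoupledLaw normalFamily (pathGaussian N h) Q))
      ∂(treeMeasure (orbitPartition θ) Γ)

end

end GUECumulant

open GUECumulant MeasureTheory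

/-!
# Cumulants of traces of powers of a GUE matrix as sums over trees and Motzkin paths

Rotating the last column of a GUE matrix onto the last coordinate axis leaves the remaining block a
GUE matrix, by unitary invariance; iterating, `(tr Ξ ^ k)_k` gets the joint moments of the traces of
the powers of a tridiagonal matrix with independent entries: normal variables `ξ_{k0}` on the
diagonal, half the sum of `2k` squares of normal variables above it, and ones below it. Expanding
these traces turns them into sums over closed Motzkin paths, one path for each orbit of `θ`.

By Möbius inversion the cumulant is a sum over the coarsenings `Ψ` of `Θ`, where the blocks of `Ψ`
are made independent of each other. For a given family `h` of paths, the `Ψ`-summand is the Gaussian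
expectation of `f^h` with the rows coupled by the matrix `[Ψ]`. This expectation is the value at
`[Ψ]` of a smooth function `W` of the coupling matrix, and its derivative along `[Ψ] - [Θ]` is a sum
over the bonds `e` which lie in a block of `Ψ` but not in a block of `Θ`, of expectations of
`D_e f^h`. Integrating along the segment from `[Θ]` to `[Ψ]` produces a bond `e`, after which `Θ`
is replaced by `{e} ∨ Θ`. Since the Möbius weights of the coarsenings of `Θ ≠ ⊤` sum to zero, only
sequences of bonds connecting all blocks survive in the end, and these enumerate the trees.

Gaussian expectations enter only through integration by parts, which determines a linear functional
on polynomials: `E[z_a p] = ∑ b, R a b E[∂_b p]`.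
-/

namespace GUECumulant

open MeasureTheory ProbabilityTheory
open scoped Nat

/-! ### Wick functionals on polynomial rings -/

section LowWeight

open MvPolynomial

variable {σ K : Type*} [CommSemiring K] {w : σ → ℕ} {d d' : ℕ} {p q : MvPolynomial σ K}

/-- The polynomials all of whose monomials have `w`-weight less than `d`. The strict bound makes the
truncated subtraction in `pderiv_mem_lowWeight` harmless, as `lowWeight w 0` is zero. -/
noncomputable def lowWeight (w : σ → ℕ) (d : ℕ) : Submodule K (MvPolynomial σ K) :=
  restrictSupport K {m | Finsupp.weight w m < d}

theorem mem_lowWeight : p ∈ lowWeight w d ↔ ∀ m, coeff m p ≠ 0 → Finsupp.weight w m < d := by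
  simp only [lowWeight, mem_restrictSupport_iff, Set.subset_def, Finset.mem_coe, mem_support_iff,
    Set.mem_ofPred_eq]

theorem lowWeight_mono (h : d ≤ d') : lowWeight (K := K) w d ≤ lowWeight w d' :=
  restrictSupport_mono K fun _ hm => lt_of_lt_of_le hm h

theorem eq_zero_of_mem_lowWeight_zero (h : p ∈ lowWeight w 0) : p = 0 := by
  ext m
  by_contra hm
  exact Nat.not_lt_zero _ (mem_lowWeight.mp h m hm)

theorem exists_mem_lowWeight (w : σ → ℕ) (p : MvPolynomial σ K) : ∃ d, p ∈ lowWeight w d :=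
  ⟨p.support.sup (Finsupp.weight w) + 1, mem_lowWeight.mpr fun _ hm =>
    Nat.lt_succ_of_le (Finset.le_sup (f := Finsupp.weight w) (mem_support_iff.mpr hm))⟩

theorem pderiv_mem_lowWeight (hp : p ∈ lowWeight w d) (a : σ) :
    pderiv a p ∈ lowWeight w (d - w a) := by
  refine mem_lowWeight.mpr fun m hm => ?_
  rw [coeff_pderiv] at hm
  have hlt := mem_lowWeight.mp hp _ (left_ne_zero_of_mul hm)
  rw [map_add, Finsupp.weight_single, one_smul] at hlt
  omega

theorem monomial_mem_lowWeight (m : σ →₀ ℕ) (c : K) :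
    monomial m c ∈ lowWeight w (Finsupp.weight w m + 1) :=
  (monomial_mem_restrictSupport K).mpr (Or.inl (Nat.lt_succ_self _))

theorem X_mem_lowWeight (a : σ) : (X a : MvPolynomial σ K) ∈ lowWeight w (w a + 1) := by
  simpa [X, Finsupp.weight_single] using
    monomial_mem_lowWeight (w := w) (Finsupp.single a 1) (1 : K)

theorem one_mem_lowWeight : (1 : MvPolynomial σ K) ∈ lowWeight w 1 := by
  simpa using monomial_mem_lowWeight (w := w) 0 (1 : K)

theorem mul_mem_lowWeight (hp : p ∈ lowWeight w (d + 1)) (hq : q ∈ lowWeight w (d' + 1)) :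
    p * q ∈ lowWeight w (d + d' + 1) := by
  classical
  refine mem_lowWeight.mpr fun m hm => ?_
  obtain ⟨⟨u, v⟩, huv, hne⟩ := Finset.exists_ne_zero_of_sum_ne_zero (coeff_mul p q m ▸ hm)
  have hu := mem_lowWeight.mp hp u (left_ne_zero_of_mul hne)
  have hv := mem_lowWeight.mp hq v (right_ne_zero_of_mul hne)
  rw [← Finset.HasAntidiagonal.mem_antidiagonal.mp huv, map_add]
  exact Nat.lt_succ_of_le (add_le_add (Nat.le_of_lt_succ hu) (Nat.le_of_lt_succ hv))

theorem prod_mem_lowWeight {ι : Type*} {s : Finset ι} {b : ι → ℕ} {p : ι → MvPolynomial σ K}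
    (hp : ∀ i ∈ s, p i ∈ lowWeight w (b i + 1)) :
    ∏ i ∈ s, p i ∈ lowWeight w (∑ i ∈ s, b i + 1) := by
  classical
  induction s using Finset.induction_on with
  | empty => simpa using one_mem_lowWeight
  | insert i s hi ih =>
    rw [Finset.prod_insert hi, Finset.sum_insert hi]
    exact mul_mem_lowWeight (hp i (Finset.mem_insert_self i s))
      (ih fun j hj => hp j (Finset.mem_insert_of_mem hj))

end LowWeight

section LinearSubst

open MvPolynomial

variable {σ τ K : Type*} [CommSemiring K] [Fintype τ]

/-- The linear change of variables `X a ↦ ∑ s, A a s • X s` on polynomials. -/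
noncomputable def linearSubst (A : σ → τ → K) : MvPolynomial σ K →ₐ[K] MvPolynomial τ K :=
  aeval fun a => ∑ s, A a s • X s

theorem linearSubst_X (A : σ → τ → K) (a : σ) : linearSubst A (X a) = ∑ s, A a s • X s :=
  aeval_X _ _

theorem eval_linearSubst (A : σ → τ → K) (x : τ → K) (p : MvPolynomial σ K) :
    eval x (linearSubst A p) = eval (fun a => ∑ s, A a s * x s) p := by
  induction p using MvPolynomial.induction_on with
  | C c => simp [← algebraMap_eq]
  | add p q hp hq => simp only [map_add, hp, hq]
  | mul_X p b hp => simp only [map_mul, hp, linearSubst_X, map_sum, smul_eval, eval_X]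

theorem pderiv_linearSubst [Fintype σ] (A : σ → τ → K) (t : τ) (p : MvPolynomial σ K) :
    pderiv t (linearSubst A p) = ∑ a, A a t • linearSubst A (pderiv a p) := by
  classical
  induction p using MvPolynomial.induction_on with
  | C c => simp [← algebraMap_eq]
  | add p q hp hq => simp only [map_add, hp, hq, smul_add, Finset.sum_add_distrib]
  | mul_X p b hp =>
    have hX : pderiv t (linearSubst A (X b)) = C (A b t) := by
      simp [linearSubst_X, pderiv_X, Pi.single_apply, smul_eq_C_mul]
    simp only [map_mul, pderiv_mul, map_add, smul_add, Finset.sum_add_distrib, hp, hX,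
      Finset.sum_mul, smul_mul_assoc]
    congr 1
    simp [pderiv_X, Pi.single_apply, apply_ite, mul_comm, smul_eq_C_mul]

end LinearSubst

section IsWick

open MvPolynomial

variable {σ τ K : Type*} [CommSemiring K]

theorem linearMap_eq_of_forall_X_mul {M : Type*} [AddCommMonoid M] [Module K M]
    {f g : MvPolynomial σ K →ₗ[K] M} (h1 : f 1 = g 1)
    (hX : ∀ a p, (∀ b, f (pderiv b p) = g (pderiv b p)) → f (X a * p) = g (X a * p)) : f = g := by
  classical
  refine linearMap_ext fun m => LinearMap.ext fun c => ?_
  simp only [LinearMap.comp_apply]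
  induction hd : m.degree using Nat.strong_induction_on generalizing m c with
  | _ d ih =>
    rcases eq_or_ne m 0 with rfl | hm
    · have hc : monomial 0 c = c • (1 : MvPolynomial σ K) := by
        rw [smul_eq_C_mul, mul_one]; rfl
      rw [hc, map_smul, map_smul, h1]
    · obtain ⟨a, ha⟩ := Finsupp.ne_iff.mp hm
      obtain ⟨m', rfl⟩ : ∃ m', m = Finsupp.single a 1 + m' :=
        ⟨m - Finsupp.single a 1, (add_tsub_cancel_of_le
          (Finsupp.single_le_iff.mpr (Nat.one_le_iff_ne_zero.mpr ha))).symm⟩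
      rw [monomial_single_add, pow_one]
      refine hX a _ fun b => ?_
      rw [pderiv_monomial]
      refine ih _ ?_ _ _ rfl
      have hle : (m' - Finsupp.single b 1).degree ≤ m'.degree := Finsupp.degree_mono tsub_le_self
      rw [← hd, map_add, Finsupp.degree_single]
      omega

variable [Fintype σ]

/-- A normalized linear functional satisfying the Gaussian integration by parts formula with
covariance matrix `R`; as there may be no underlying random variables, `R` can be arbitrary. -/
structure IsWick (R : σ → σ → K) (L : MvPolynomial σ K →ₗ[K] K) : Prop where
  one : L 1 = 1
  X_mul : ∀ a p, L (X a * p) = ∑ b, R a b * L (pderiv b p)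

namespace IsWick

variable {R R' : σ → σ → K} {L L' : MvPolynomial σ K →ₗ[K] K}

theorem unique (h : IsWick R L) (h' : IsWick R L') : L = L' :=
  linearMap_eq_of_forall_X_mul (h.one.trans h'.one.symm) fun a p hp => by
    simp only [h.X_mul, h'.X_mul, hp]

theorem comp_linearSubst [Fintype τ] {D : τ → τ → K} {M : MvPolynomial τ K →ₗ[K] K}
    (h : IsWick D M) (A : σ → τ → K) :
    IsWick (fun a b => ∑ s, ∑ t, A a s * D s t * A b t)
      (M ∘ₗ (linearSubst A).toLinearMap) where
  one := by simp [h.one]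
  X_mul a p := by
    simp only [LinearMap.comp_apply, AlgHom.toLinearMap_apply, map_mul, linearSubst_X,
      Finset.sum_mul, map_sum, map_smul, smul_mul_assoc, h.X_mul, smul_eq_mul,
      pderiv_linearSubst, Finset.mul_sum]
    rw [eq_comm, Finset.sum_comm]
    refine Finset.sum_congr rfl fun _ _ => ?_
    rw [Finset.sum_comm]
    exact Finset.sum_congr rfl fun _ _ => Finset.sum_congr rfl fun _ _ => by ring

theorem map_rename_mul (h : IsWick R L) (h' : IsWick R' L') {f : τ → σ}
    (hf : Function.Injective f) (hR : ∀ a b, R (f a) (f b) = R' (f a) (f b))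
    {q : MvPolynomial σ K} (hq : ∀ a, ∀ b ∈ q.vars, R (f a) b = 0) (p : MvPolynomial τ K) :
    L (rename f p * q) = L' (rename f p) * L q := by
  suffices (L ∘ₗ LinearMap.mulRight K q) ∘ₗ (rename f).toLinearMap =
      (LinearMap.mulRight K (L q) ∘ₗ L') ∘ₗ (rename f).toLinearMap from LinearMap.congr_fun this p
  refine linearMap_eq_of_forall_X_mul (by simp [h'.one]) fun a p ih => ?_
  simp only [LinearMap.comp_apply, AlgHom.toLinearMap_apply, LinearMap.mulRight_apply] at ih ⊢
  rw [map_mul (rename f), rename_X, mul_assoc, h.X_mul, h'.X_mul, Finset.sum_mul]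
  refine Finset.sum_congr rfl fun b _ => ?_
  have hright : R (f a) b * L (rename f p * pderiv b q) = 0 := by
    by_cases hbq : b ∈ q.vars
    · rw [hq a b hbq, zero_mul]
    · rw [pderiv_eq_zero_of_notMem_vars hbq, mul_zero, map_zero, mul_zero]
  rw [pderiv_mul, map_add, mul_add, hright, add_zero]
  by_cases hb : b ∈ Set.range f
  · obtain ⟨b, rfl⟩ := hb
    rw [pderiv_rename hf, ih, hR, mul_assoc]
  · classical
    have hzero : pderiv b (rename f p) = 0 := pderiv_eq_zero_of_notMem_vars fun hmem => by
      obtain ⟨c, -, rfl⟩ := Finset.mem_image.mp (vars_rename f p hmem)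
      exact hb ⟨c, rfl⟩
    simp only [hzero, zero_mul, map_zero, mul_zero]

theorem map_mul_of_uncorrelated (h : IsWick R L) (h' : IsWick R' L') {s : Set σ}
    {p q : MvPolynomial σ K} (hp : (p.vars : Set σ) ⊆ s)
    (hR : ∀ a ∈ s, ∀ b ∈ s, R a b = R' a b) (hq : ∀ a ∈ s, ∀ b ∈ q.vars, R a b = 0) :
    L (p * q) = L' p * L q := by
  obtain ⟨p, rfl⟩ := exists_rename_eq_of_vars_subset_range p ((↑) : s → σ) Subtype.val_injective
    (by simpa using hp)
  exact h.map_rename_mul h' Subtype.val_injective (fun a b => hR a a.2 b b.2)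
    (fun a => hq a a.2) p

theorem map_prod_of_blocks {β : Type*} [DecidableEq β] (h : IsWick R L) (h' : IsWick R' L')
    {block : σ → β} (hR : ∀ a b, R a b = if block a = block b then R' a b else 0) {S : Finset β}
    {p : β → MvPolynomial σ K} (hp : ∀ A ∈ S, ∀ a ∈ (p A).vars, block a = A) :
    L (∏ A ∈ S, p A) = ∏ A ∈ S, L' (p A) := by
  classical
  induction S using Finset.induction_on with
  | empty => simp [h.one]
  | insert A S hA ih =>
    have hpS : ∀ B ∈ S, ∀ a ∈ (p B).vars, block a = B :=
      fun B hB => hp B (Finset.mem_insert_of_mem hB)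
    rw [Finset.prod_insert hA, Finset.prod_insert hA, ← ih hpS]
    refine h.map_mul_of_uncorrelated h' (s := {a | block a = A}) (hp A (Finset.mem_insert_self _ _))
      (fun a ha b hb => ?_) fun a ha b hb => ?_
    · rw [hR, if_pos (Eq.trans ha (Eq.symm hb))]
    · obtain ⟨B, hB, hb⟩ := Finset.mem_biUnion.mp (vars_prod p hb)
      rw [hR, if_neg fun hab => hA ?_]
      rwa [← hpS B hB b hb, ← hab, show block a = A from ha] at hB

end IsWick

end IsWick

section Laplacian

open MvPolynomial

theorem pderiv_pderiv_comm {σ K : Type*} [CommSemiring K] (a b : σ) (p : MvPolynomial σ K) :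
    pderiv a (pderiv b p) = pderiv b (pderiv a p) := by
  classical
  rcases eq_or_ne a b with rfl | hab
  · rfl
  · ext m
    simp only [coeff_pderiv, Finsupp.add_apply, Finsupp.single_eq_of_ne hab,
      Finsupp.single_eq_of_ne hab.symm, add_zero, add_right_comm m, mul_right_comm]

variable {σ K : Type*} [Fintype σ] [Field K] {d : ℕ} {p : MvPolynomial σ K}

/-- The generator `½ ∑ a b, R a b ∂_a ∂_b` of the heat semigroup with covariance matrix `R`. -/
noncomputable def laplacian (R : σ → σ → K) : Module.End K (MvPolynomial σ K) :=
  ∑ a, ∑ b, (R a b / 2) • ((pderiv a).toLinearMap * (pderiv b).toLinearMap)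

theorem laplacian_apply (R : σ → σ → K) (p : MvPolynomial σ K) :
    laplacian R p = ∑ a, ∑ b, (R a b / 2) • pderiv a (pderiv b p) := by
  simp [laplacian]

theorem commute_pderiv_laplacian (R : σ → σ → K) (c : σ) :
    Commute ((pderiv c).toLinearMap : Module.End K (MvPolynomial σ K)) (laplacian R) := by
  refine LinearMap.ext fun p => ?_
  change pderiv c (laplacian R p) = laplacian R (pderiv c p)
  simp only [laplacian_apply, map_sum, Derivation.map_smul]
  exact Finset.sum_congr rfl fun a _ => Finset.sum_congr rfl fun b _ => by
    rw [pderiv_pderiv_comm c a, pderiv_pderiv_comm c b]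

theorem commute_laplacian (R R' : σ → σ → K) : Commute (laplacian R) (laplacian R') :=
  Commute.sum_right _ _ _ fun a _ => Commute.sum_right _ _ _ fun b _ =>
    ((commute_pderiv_laplacian R a).symm.mul_right
      (commute_pderiv_laplacian R b).symm).smul_right _

theorem laplacian_add_smul (R R' : σ → σ → K) (t : K) :
    laplacian (R + t • R') = laplacian R + t • laplacian R' := by
  simp only [laplacian, Pi.add_apply, Pi.smul_apply, smul_eq_mul, add_div, add_smul,
    mul_div_assoc, mul_smul, Finset.sum_add_distrib, Finset.smul_sum]

theorem laplacian_mem_lowWeight (R : σ → σ → K) (hp : p ∈ lowWeight 1 (d + 1)) :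
    laplacian R p ∈ lowWeight 1 d := by
  rw [laplacian_apply]
  exact Submodule.sum_mem _ fun a _ => Submodule.sum_mem _ fun b _ => Submodule.smul_mem _ _
    (lowWeight_mono (Nat.sub_le _ _) (pderiv_mem_lowWeight (pderiv_mem_lowWeight hp b) a))

theorem laplacian_pow_eq_zero (R : σ → σ → K) (hp : p ∈ lowWeight 1 d) {k : ℕ} (hk : d ≤ k) :
    (laplacian R ^ k) p = 0 := by
  induction k generalizing d p with
  | zero =>
    obtain rfl := Nat.le_zero.mp hk
    simpa using eq_zero_of_mem_lowWeight_zero hp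
  | succ k ih =>
    rw [pow_succ, Module.End.mul_apply]
    exact ih (laplacian_mem_lowWeight R (lowWeight_mono hk hp)) le_rfl

theorem laplacian_X_mul [CharZero K] {R : σ → σ → K} (hR : ∀ a b, R a b = R b a) (c : σ)
    (p : MvPolynomial σ K) :
    laplacian R (X c * p) = X c * laplacian R p + ∑ b, R c b • pderiv b p := by
  classical
  have leibniz : ∀ a b, pderiv a (pderiv b (X c * p)) = X c * pderiv a (pderiv b p) +
      ((if a = c then pderiv b p else 0) + if b = c then pderiv a p else 0) := by
    intro a b
    simp only [pderiv_mul, map_add, pderiv_X, Pi.single_apply, eq_comm (a := c)]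
    split_ifs <;> simp <;> ring
  have half (b : σ) : (R c b / 2) • pderiv b p + (R b c / 2) • pderiv b p = R c b • pderiv b p := by
    rw [hR b c, ← add_smul, add_halves]
  simp only [laplacian_apply, leibniz, smul_add, Finset.sum_add_distrib, Finset.mul_sum,
    mul_smul_comm, smul_ite, smul_zero, Finset.sum_ite_eq', Finset.mem_univ, if_true, ← half]
  rw [Finset.sum_comm (f := fun a b => if a = c then (R a b / 2) • pderiv b p else 0)]
  simp only [Finset.sum_ite_eq', Finset.mem_univ, if_true]

theorem laplacian_pow_succ_X_mul [CharZero K] {R : σ → σ → K} (hR : ∀ a b, R a b = R b a) (c : σ)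
    (p : MvPolynomial σ K) (k : ℕ) :
    (laplacian R ^ (k + 1)) (X c * p) = X c * (laplacian R ^ (k + 1)) p +
      (k + 1 : K) • ∑ b, R c b • (laplacian R ^ k) (pderiv b p) := by
  induction k with
  | zero => simp [laplacian_X_mul hR]
  | succ k ih =>
    have hcomm (b : σ) :
        pderiv b ((laplacian R ^ (k + 1)) p) = (laplacian R ^ (k + 1)) (pderiv b p) :=
      LinearMap.congr_fun ((commute_pderiv_laplacian R b).pow_right (k + 1)) p
    rw [pow_succ', Module.End.mul_apply, ih, map_add, laplacian_X_mul hR, map_smul, map_sum,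
      ← Module.End.mul_apply, ← pow_succ', add_assoc]
    simp only [hcomm, map_smul, ← Module.End.mul_apply, ← pow_succ']
    push_cast
    module

end Laplacian

section WickFunctional

open MvPolynomial

variable {σ K : Type*} [Fintype σ] [Field K] {d : ℕ} {p : MvPolynomial σ K}

theorem support_heatTerm_subset (R : σ → σ → K) (hp : p ∈ lowWeight 1 d) :
    (Function.support fun k : ℕ => (k ! : K)⁻¹ * constantCoeff ((laplacian R ^ k) p)) ⊆
      Finset.range d := by
  refine Function.support_subset_iff'.mpr fun k hk => ?_
  rw [laplacian_pow_eq_zero R hp (by simpa using hk), map_zero, mul_zero]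

/-- The Gaussian expectation `p ↦ ∑ k, (½ ∑ a b, R a b ∂_a ∂_b)^k p (0) / k!` with covariance matrix
`R`, which makes sense without any positivity; only finitely many terms are nonzero. -/
noncomputable def wick (R : σ → σ → K) : MvPolynomial σ K →ₗ[K] K where
  toFun p := ∑ᶠ k : ℕ, (k ! : K)⁻¹ * constantCoeff ((laplacian R ^ k) p)
  map_add' p q := by
    obtain ⟨d, hd⟩ := exists_mem_lowWeight 1 p
    obtain ⟨e, he⟩ := exists_mem_lowWeight 1 q
    rw [← finsum_add_distrib ((Finset.finite_toSet _).subset (support_heatTerm_subset R hd))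
      ((Finset.finite_toSet _).subset (support_heatTerm_subset R he))]
    simp only [map_add, mul_add]
  map_smul' c p := by
    rw [RingHom.id_apply, smul_eq_mul, mul_finsum]
    exact finsum_congr fun k => by rw [map_smul, constantCoeff_smul, smul_eq_mul, mul_left_comm]

theorem wick_eq_sum (R : σ → σ → K) (hp : p ∈ lowWeight 1 d) :
    wick R p = ∑ k ∈ Finset.range d, (k ! : K)⁻¹ * constantCoeff ((laplacian R ^ k) p) :=
  finsum_eq_sum_of_support_subset _ (support_heatTerm_subset R hp)

theorem inv_factorial_succ_mul [CharZero K] (k : ℕ) (x : K) :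
    (((k + 1)! : ℕ) : K)⁻¹ * ((k + 1) * x) = (k ! : K)⁻¹ * x := by
  have hk : (k + 1 : K) ≠ 0 := Nat.cast_add_one_ne_zero k
  rw [Nat.factorial_succ]
  push_cast
  field_simp

theorem isWick_wick [CharZero K] {R : σ → σ → K} (hR : ∀ a b, R a b = R b a) :
    IsWick R (wick R) where
  one := by simp [wick_eq_sum R one_mem_lowWeight]
  X_mul c p := by
    obtain ⟨d, hd⟩ := exists_mem_lowWeight 1 p
    have hXp : X c * p ∈ lowWeight 1 (d + 1 + 1) := by
      have := mul_mem_lowWeight (X_mem_lowWeight c) (lowWeight_mono (Nat.le_succ d) hd)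
      rwa [Pi.one_apply, add_comm 1 d] at this
    have hpderiv (b : σ) : pderiv b p ∈ lowWeight 1 (d + 1) :=
      lowWeight_mono ((Nat.sub_le _ _).trans (Nat.le_succ d)) (pderiv_mem_lowWeight hd b)
    simp only [wick_eq_sum R hXp, wick_eq_sum R (hpderiv _), Finset.mul_sum]
    rw [Finset.sum_range_succ', Finset.sum_comm]
    simp only [laplacian_pow_succ_X_mul hR, pow_zero, Module.End.one_apply, map_add, map_mul,
      map_sum, constantCoeff_X, constantCoeff_smul, smul_eq_mul, zero_mul, zero_add, mul_zero,
      add_zero, inv_factorial_succ_mul]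
    simp only [Finset.mul_sum, mul_left_comm]

end WickFunctional

section WickCalculus

open MvPolynomial

variable {σ : Type*} [Fintype σ]

theorem continuous_laplacian_pow (ℓ : MvPolynomial σ ℝ →ₗ[ℝ] ℝ) (k : ℕ) (p : MvPolynomial σ ℝ) :
    Continuous fun R : σ → σ → ℝ => ℓ ((laplacian R ^ k) p) := by
  induction k generalizing p with
  | zero => simpa using continuous_const
  | succ k ih =>
    simp only [pow_succ, Module.End.mul_apply, laplacian_apply, map_sum, map_smul, smul_eq_mul]
    refine continuous_finsetSum _ fun a _ => continuous_finsetSum _ fun b _ => ?_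
    exact (by fun_prop : Continuous fun R : σ → σ → ℝ => R a b / 2).mul (ih _)

theorem continuous_wick (p : MvPolynomial σ ℝ) : Continuous fun R : σ → σ → ℝ => wick R p := by
  obtain ⟨d, hd⟩ := exists_mem_lowWeight 1 p
  simp only [fun R => wick_eq_sum R hd]
  exact continuous_finsetSum _ fun k _ => continuous_const.mul
    (continuous_laplacian_pow (lcoeff ℝ 0) k p)

theorem hasDerivAt_laplacian_pow (ℓ : MvPolynomial σ ℝ →ₗ[ℝ] ℝ) (k : ℕ) (p : MvPolynomial σ ℝ)
    (A B : σ → σ → ℝ) (t : ℝ) :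
    HasDerivAt (fun t : ℝ => ℓ ((laplacian (A + t • B) ^ (k + 1)) p))
      ((k + 1) * ℓ ((laplacian (A + t • B) ^ k) (laplacian B p))) t := by
  have split (j : ℕ) (q : MvPolynomial σ ℝ) (t : ℝ) :
      ℓ ((laplacian (A + t • B) ^ (j + 1)) q) = ℓ ((laplacian (A + t • B) ^ j) (laplacian A q)) +
        t * ℓ ((laplacian (A + t • B) ^ j) (laplacian B q)) := by
    rw [pow_succ, Module.End.mul_apply, laplacian_add_smul A B t, LinearMap.add_apply,
      LinearMap.smul_apply, map_add, map_smul, map_add, map_smul, smul_eq_mul]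
  induction k generalizing p with
  | zero =>
    simp only [split, pow_zero, Module.End.one_apply, Nat.cast_zero, zero_add]
    exact ((hasDerivAt_id t).mul_const _).const_add _
  | succ k ih =>
    simp only [split (k + 1) p]
    refine ((ih (laplacian A p)).add ((hasDerivAt_id t).mul (ih (laplacian B p)))).congr_deriv ?_
    have hcomm : laplacian B (laplacian A p) = laplacian A (laplacian B p) :=
      LinearMap.congr_fun (commute_laplacian B A) p
    rw [hcomm, id_eq, Nat.cast_add_one, split k (laplacian B p) t]
    ring

theorem hasDerivAt_wick (p : MvPolynomial σ ℝ) (A B : σ → σ → ℝ) (t : ℝ) :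
    HasDerivAt (fun t : ℝ => wick (A + t • B) p) (wick (A + t • B) (laplacian B p)) t := by
  obtain ⟨d, hd⟩ := exists_mem_lowWeight 1 p
  have hd' := lowWeight_mono (Nat.le_succ d) hd
  simp only [fun R => wick_eq_sum R hd', wick_eq_sum _ (laplacian_mem_lowWeight B hd'),
    Finset.sum_range_succ' _ d, pow_zero, Module.End.one_apply]
  refine (HasDerivAt.add_const _ (HasDerivAt.fun_sum fun k _ =>
    (hasDerivAt_laplacian_pow (lcoeff ℝ 0) k p A B t).const_mul _)).congr_deriv ?_
  exact Finset.sum_congr rfl fun k _ => inv_factorial_succ_mul k _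

end WickCalculus

section Moments

open MvPolynomial

variable {σ Ω 𝕜 : Type*} [RCLike 𝕜] {mΩ : MeasurableSpace Ω} {P : Measure Ω}

theorem memLp_linear {τ : Type*} [Fintype σ] {x : σ → Ω → 𝕜}
    (hx : ∀ a (k : ℕ), MemLp (x a) k P) (A : τ → σ → 𝕜) (b : τ) (k : ℕ) :
    MemLp (fun ω => ∑ a, A b a * x a ω) k P :=
  memLp_finsetSum _ fun a _ => (hx a k).const_mul _

variable [IsFiniteMeasure P]

theorem memLp_eval {x : σ → Ω → 𝕜} (hx : ∀ a (k : ℕ), MemLp (x a) k P)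
    (p : MvPolynomial σ 𝕜) (k : ℕ) : MemLp (fun ω => eval (fun a => x a ω) p) k P := by
  induction p using MvPolynomial.induction_on generalizing k with
  | C c => simpa using memLp_const c
  | add p q hp hq =>
    simp only [map_add]
    exact (hp k).add (hq k)
  | mul_X p a hp =>
    simp only [map_mul, eval_X]
    have holder : ENNReal.HolderTriple (2 * k : ℕ) (2 * k : ℕ) k := by
      constructor
      push_cast
      rw [ENNReal.mul_inv (by simp) (by simp), ← add_mul, ENNReal.inv_two_add_inv_two, one_mul]
    exact (hx a (2 * k)).mul' (hp (2 * k)) (hpqr := holder)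

theorem integrable_eval {x : σ → Ω → 𝕜} (hx : ∀ a (k : ℕ), MemLp (x a) k P)
    (p : MvPolynomial σ 𝕜) : Integrable (fun ω => eval (fun a => x a ω) p) P :=
  memLp_one_iff_integrable.mp (by simpa using memLp_eval hx p 1)

/-- The expectation of a polynomial in random variables with moments of all orders. -/
noncomputable def expectation {x : σ → Ω → 𝕜} (hx : ∀ a (k : ℕ), MemLp (x a) k P) :
    MvPolynomial σ 𝕜 →ₗ[𝕜] 𝕜 where
  toFun p := ∫ ω, eval (fun a => x a ω) p ∂P
  map_add' p q := by
    simp only [map_add]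
    exact integral_add (integrable_eval hx p) (integrable_eval hx q)
  map_smul' c p := by
    simp only [smul_eval, RingHom.id_apply, smul_eq_mul]
    exact integral_const_mul c _

theorem expectation_apply {x : σ → Ω → 𝕜} (hx : ∀ a (k : ℕ), MemLp (x a) k P)
    (p : MvPolynomial σ 𝕜) : expectation hx p = ∫ ω, eval (fun a => x a ω) p ∂P := rfl

theorem IsWick.expectation_linear {τ : Type*} [Fintype σ] [Fintype τ] {x : σ → Ω → 𝕜}
    {hx : ∀ a (k : ℕ), MemLp (x a) k P} {R : σ → σ → 𝕜} (h : IsWick R (expectation hx))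
    (A : τ → σ → 𝕜) {y : τ → Ω → 𝕜} (hy : ∀ b (k : ℕ), MemLp (y b) k P)
    (hxy : ∀ b, y b =ᵐ[P] fun ω => ∑ a, A b a * x a ω) :
    IsWick (fun a b => ∑ s, ∑ t, A a s * R s t * A b t) (expectation hy) := by
  convert h.comp_linearSubst A using 1
  refine LinearMap.ext fun p => ?_
  simp only [LinearMap.comp_apply, AlgHom.toLinearMap_apply, expectation_apply, eval_linearSubst]
  refine integral_congr_ae ?_
  filter_upwards [ae_all_iff.mpr hxy] with ω hω
  simp only [hω]

end Moments

section Gaussian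

open MvPolynomial

variable {σ Ω 𝕜 : Type*} [RCLike 𝕜] {mΩ : MeasurableSpace Ω} {P : Measure Ω}

theorem integral_pow_gaussianReal (v : NNReal) (k : ℕ) :
    ∫ x, x ^ k ∂gaussianReal 0 v =
      iteratedDeriv k (fun t : ℝ => Real.exp (v * t ^ 2 / 2)) 0 := by
  have := iteratedDeriv_mgf_zero (X := id) (μ := gaussianReal 0 v) (by simp) k
  rw [mgf_id_gaussianReal] at this
  simpa using this.symm

theorem iteratedDeriv_id_mul_zero {k : ℕ} {g : ℝ → ℝ} (hg : ContDiffAt ℝ k g 0) :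
    iteratedDeriv k (fun t => t * g t) 0 = k * iteratedDeriv (k - 1) g 0 := by
  rw [iteratedDeriv_fun_mul (f := fun t => t) contDiffAt_id hg]
  rcases k with _ | k
  · simp
  · rw [Finset.sum_eq_single 1 (fun i _ hi => by simp [iteratedDeriv_fun_id_zero, hi]) (by simp)]
    simp [iteratedDeriv_fun_id_zero]

theorem integral_pow_succ_gaussianReal (v : NNReal) (k : ℕ) :
    ∫ x, x ^ (k + 1) ∂gaussianReal 0 v = v * (k * ∫ x, x ^ (k - 1) ∂gaussianReal 0 v) := by
  have hderiv : deriv (fun t : ℝ => Real.exp (v * t ^ 2 / 2)) =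
      fun t => v * (t * Real.exp (v * t ^ 2 / 2)) := by
    funext t
    have h := (((hasDerivAt_pow 2 t).const_mul (v : ℝ)).div_const 2).exp.deriv
    rw [h]
    push_cast
    ring
  rw [integral_pow_gaussianReal, integral_pow_gaussianReal, iteratedDeriv_succ', hderiv,
    iteratedDeriv_const_mul_field, iteratedDeriv_id_mul_zero (by fun_prop)]

theorem prod_integral_pow_single_add [Fintype σ] (v : σ → NNReal) (a : σ) (m : σ →₀ ℕ) :
    ∏ b, ∫ y, y ^ (Finsupp.single a 1 + m : σ →₀ ℕ) b ∂gaussianReal 0 (v b) =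
      v a * (m a * ∏ b, ∫ y, y ^ (m - Finsupp.single a 1 : σ →₀ ℕ) b ∂gaussianReal 0 (v b)) := by
  classical
  rw [← Finset.mul_prod_erase _ _ (Finset.mem_univ a),
    ← Finset.mul_prod_erase _
      (fun b => ∫ y, y ^ (m - Finsupp.single a 1 : σ →₀ ℕ) b ∂gaussianReal 0 (v b))
      (Finset.mem_univ a)]
  have off_diagonal : ∀ b ∈ Finset.univ.erase a,
      ∫ y, y ^ (Finsupp.single a 1 + m : σ →₀ ℕ) b ∂gaussianReal 0 (v b) =
        ∫ y, y ^ (m - Finsupp.single a 1 : σ →₀ ℕ) b ∂gaussianReal 0 (v b) := fun b hb => by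
    simp [Finsupp.single_eq_of_ne (Finset.ne_of_mem_erase hb)]
  rw [Finset.prod_congr rfl off_diagonal]
  simp only [Finsupp.add_apply, Finsupp.single_eq_same,
    Finsupp.tsub_apply, add_comm 1 (m a), integral_pow_succ_gaussianReal, mul_assoc]

section Independent

variable [Fintype σ] [IsProbabilityMeasure P] {x : σ → Ω → ℝ} {v : σ → NNReal}

theorem expectation_monomial_of_iIndepFun (hx : iIndepFun x P)
    (hlaw : ∀ a, HasLaw (x a) (gaussianReal 0 (v a)) P)
    (hmom : ∀ a (k : ℕ), MemLp (fun ω => (x a ω : 𝕜)) k P) (m : σ →₀ ℕ) :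
    expectation hmom (monomial m 1) =
      ((∏ a, ∫ y, y ^ m a ∂gaussianReal 0 (v a) : ℝ) : 𝕜) := by
  have heval (ω : Ω) :
      eval (fun a => (x a ω : 𝕜)) (monomial m 1) = ((∏ a, x a ω ^ m a : ℝ) : 𝕜) := by
    rw [eval_monomial, one_mul, Finsupp.prod_fintype _ _ (by simp)]
    push_cast
    rfl
  simp only [expectation_apply, heval]
  rw [integral_ofReal, hx.integral_fun_prod_comp (f := fun a y => y ^ m a)
    (fun a => (hlaw a).aemeasurable) (fun a => by fun_prop)]
  congr 1
  refine Finset.prod_congr rfl fun a _ => ?_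
  rw [← (hlaw a).map_eq, integral_map (hlaw a).aemeasurable (by fun_prop)]

theorem isWick_expectation_of_iIndepFun [DecidableEq σ] (hx : iIndepFun x P)
    (hlaw : ∀ a, HasLaw (x a) (gaussianReal 0 (v a)) P)
    (hmom : ∀ a (k : ℕ), MemLp (fun ω => (x a ω : 𝕜)) k P) :
    IsWick (fun a b => if a = b then ((v a : ℝ) : 𝕜) else 0) (expectation hmom) where
  one := by simpa using expectation_monomial_of_iIndepFun hx hlaw hmom 0
  X_mul a p := by
    simp only [ite_mul, zero_mul, Finset.sum_ite_eq, Finset.mem_univ, if_true]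
    induction p using MvPolynomial.induction_on' with
    | monomial m c =>
      have hsmul (m : σ →₀ ℕ) (c : 𝕜) : monomial m c = c • monomial m (1 : 𝕜) := by
        rw [smul_monomial, smul_eq_mul, mul_one]
      rw [pderiv_monomial, hsmul m, hsmul _ (c * _), mul_smul_comm, map_smul, map_smul, X,
        monomial_mul, one_mul]
      simp only [expectation_monomial_of_iIndepFun hx hlaw, prod_integral_pow_single_add,
        smul_eq_mul]
      push_cast
      ring
    | add p q hp hq => simp only [mul_add, map_add, hp, hq]

end Independent

theorem memLp_ofReal_of_hasLaw_gaussianReal {x : Ω → ℝ} {v : NNReal}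
    (h : HasLaw x (gaussianReal 0 v) P) (k : ℕ) : MemLp (fun ω => (x ω : 𝕜)) k P := by
  have hid : MemLp id k (P.map x) := h.map_eq ▸ memLp_id_gaussianReal' k (by simp)
  exact ((memLp_map_measure_iff (by fun_prop) h.aemeasurable).mp hid).ofReal

open scoped MatrixOrder in
theorem exists_multivariateGaussian_eq_map_pi [Fintype σ] [DecidableEq σ] {S : Matrix σ σ ℝ}
    (hS : S.PosSemidef) : ∃ A : Matrix σ σ ℝ, A * A.transpose = S ∧
      multivariateGaussian 0 S = (Measure.pi fun _ : σ => gaussianReal 0 1).map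
        (fun x => WithLp.toLp 2 (A.mulVec x)) := by
  refine ⟨CFC.sqrt S, ?_, ?_⟩
  · have hsymm := (CFC.sqrt_nonneg S).isSelfAdjoint.star_eq
    rw [Matrix.star_eq_conjTranspose, Matrix.conjTranspose_eq_transpose_of_trivial] at hsymm
    rw [hsymm, CFC.sqrt_mul_sqrt_self S hS.nonneg]
  · rw [multivariateGaussian, ← map_pi_eq_stdGaussian, Measure.map_map (by fun_prop) (by fun_prop)]
    congr 1
    funext x
    simp [Matrix.toEuclideanCLM_toLp]

theorem integral_eval_multivariateGaussian [Fintype σ] [DecidableEq σ] {S : Matrix σ σ ℝ}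
    (hS : S.PosSemidef) (p : MvPolynomial σ ℝ) :
    ∫ x, eval (fun a => x a) p ∂(multivariateGaussian 0 S) = wick S p := by
  obtain ⟨A, hAA, hA⟩ := exists_multivariateGaussian_eq_map_pi hS
  set G : Measure (σ → ℝ) := Measure.pi fun _ => gaussianReal 0 1
  have hlaw (a : σ) : HasLaw (fun x : σ → ℝ => x a) (gaussianReal 0 1) G :=
    ⟨(measurable_pi_apply a).aemeasurable, (measurePreserving_eval _ a).map_eq⟩
  have hind : iIndepFun (fun (a : σ) (x : σ → ℝ) => x a) G :=
    iIndepFun_pi (X := fun _ x => x) fun _ => aemeasurable_id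
  have hmom (a : σ) (k : ℕ) : MemLp (fun x : σ → ℝ => x a) k G :=
    memLp_ofReal_of_hasLaw_gaussianReal (𝕜 := ℝ) (hlaw a) k
  have hwick := (isWick_expectation_of_iIndepFun (𝕜 := ℝ) hind hlaw hmom).expectation_linear A
    (memLp_linear hmom A) fun _ => Filter.EventuallyEq.rfl
  have hcov : (fun a b => ∑ s, ∑ t, A a s *
      (if s = t then (((1 : NNReal) : ℝ) : ℝ) else 0) * A b t) = S := by
    funext a b
    simp [← hAA, Matrix.mul_apply]
  have hsymm (a b : σ) : S a b = S b a := by simpa using (hS.isHermitian.apply a b).symm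
  have hmeas : AEStronglyMeasurable (fun x : EuclideanSpace ℝ σ => eval (fun a => x a) p)
      (G.map fun x => WithLp.toLp 2 (A.mulVec x)) :=
    ((MvPolynomial.continuous_eval p).comp (by fun_prop)).aestronglyMeasurable
  have hunique := (hcov ▸ hwick).unique (isWick_wick hsymm)
  rw [← hunique, expectation_apply, hA,
    integral_map (by fun_prop) hmeas]
  simp [Matrix.mulVec, dotProduct]

end Gaussian

section Covariance

open MvPolynomial

variable {ι : Type*} [DecidableEq ι]

/-- The covariances `E[H p H q]` of the entries of a standard GUE matrix `H`. -/
def gueCov (p q : ι × ι) : ℂ := if q = p.swap then 1 else 0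

theorem sum_conj_gueCov [Fintype ι] {U : Matrix ι ι ℂ} (hU : U.conjTranspose * U = 1) :
    (fun a b : ι × ι => ∑ s : ι × ι, ∑ t : ι × ι,
      (star (U s.1 a.1) * U s.2 a.2) * gueCov s t * (star (U t.1 b.1) * U t.2 b.2)) = gueCov := by
  have horth (i j : ι) : ∑ k, star (U k i) * U k j = if i = j then 1 else 0 := by
    simpa [Matrix.mul_apply, Matrix.one_apply] using congrFun (congrFun hU i) j
  funext a b
  calc ∑ s : ι × ι, ∑ t : ι × ι,
        (star (U s.1 a.1) * U s.2 a.2) * gueCov s t * (star (U t.1 b.1) * U t.2 b.2)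
      = ∑ s : ι × ι, (star (U s.1 a.1) * U s.1 b.2) * (star (U s.2 b.1) * U s.2 a.2) := by
        refine Finset.sum_congr rfl fun s _ => ?_
        simp only [gueCov, mul_ite, ite_mul, mul_one, mul_zero, zero_mul, Finset.sum_ite_eq',
          Finset.mem_univ, if_true, Prod.fst_swap, Prod.snd_swap]
        ring
    _ = (if a.1 = b.2 then 1 else 0) * (if b.1 = a.2 then 1 else 0) := by
        simp only [Fintype.sum_prod_type, ← Finset.mul_sum, ← Finset.sum_mul, horth]
    _ = gueCov a b := by
        simp only [gueCov, Prod.ext_iff, Prod.fst_swap, Prod.snd_swap, eq_comm (a := b.2),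
          mul_ite, mul_one, mul_zero, ← ite_and]

end Covariance

section GUE

open MvPolynomial

variable {Ω : Type*} {mΩ : MeasurableSpace Ω} {P : Measure Ω} {N : ℕ}

/-- The coefficient of `hermitianCoord H p` in the entry `H p`. -/
noncomputable def directCoeff (p : Fin N × Fin N) : ℂ := if p.1 ≤ p.2 then 1 else -Complex.I

/-- The coefficient of `hermitianCoord H p.swap` in the entry `H p`. -/
noncomputable def swapCoeff (p : Fin N × Fin N) : ℂ :=
  if p.1 = p.2 then 0 else if p.1 < p.2 then Complex.I else 1

theorem entry_eq_directCoeff_add_swapCoeff {H : Matrix (Fin N) (Fin N) ℂ} (hH : H.IsHermitian)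
    (p : Fin N × Fin N) :
    H p.1 p.2 = directCoeff p * hermitianCoord H p + swapCoeff p * hermitianCoord H p.swap := by
  obtain ⟨i, j⟩ := p
  have hij : (starRingEnd ℂ) (H j i) = H i j := hH.apply i j
  rcases lt_trichotomy i j with h | rfl | h
  · apply Complex.ext <;> simp [directCoeff, swapCoeff, hermitianCoord, h, h.le, h.ne, h.not_ge]
  · simpa [directCoeff, swapCoeff, hermitianCoord, eq_comm] using Complex.conj_eq_iff_re.mp hij
  · rw [← hij]
    apply Complex.ext <;>
      simp [directCoeff, swapCoeff, hermitianCoord, h.le, h.ne', h.not_ge, h.not_gt]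

/-- The coefficients of the entries of a Hermitian matrix in terms of its real coordinates. -/
noncomputable def hermitianCoeff (p q : Fin N × Fin N) : ℂ :=
  (if q = p then directCoeff p else 0) + (if q = p.swap then swapCoeff p else 0)

theorem sum_hermitianCoeff_mul (p : Fin N × Fin N) (f : Fin N × Fin N → ℂ) :
    ∑ q, hermitianCoeff p q * f q = directCoeff p * f p + swapCoeff p * f p.swap := by
  simp [hermitianCoeff, add_mul, Finset.sum_add_distrib]

theorem entry_eq_sum_hermitianCoeff {H : Matrix (Fin N) (Fin N) ℂ} (hH : H.IsHermitian)
    (p : Fin N × Fin N) : H p.1 p.2 = ∑ q, hermitianCoeff p q * (hermitianCoord H q : ℂ) := by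
  rw [sum_hermitianCoeff_mul, entry_eq_directCoeff_add_swapCoeff hH]

/-- The variances of the real coordinates of a standard GUE matrix. -/
noncomputable def coordVariance (p : Fin N × Fin N) : NNReal := if p.1 = p.2 then 1 else 1 / 2

theorem sum_hermitianCoeff_mul_coordVariance (p q : Fin N × Fin N) :
    ∑ s, ∑ t, hermitianCoeff p s * (if s = t then ((coordVariance s : ℝ) : ℂ) else 0) *
      hermitianCoeff q t = gueCov p q := by
  have hvar : coordVariance p.swap = coordVariance p := by simp [coordVariance, eq_comm]
  simp only [mul_ite, ite_mul, mul_zero, zero_mul, Finset.sum_ite_eq, Finset.mem_univ, if_true,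
    mul_assoc, sum_hermitianCoeff_mul, hvar]
  obtain ⟨i, j⟩ := p
  by_cases hq : q = (i, j)
  · subst hq
    rcases lt_trichotomy i j with h | rfl | h
    · simp only [hermitianCoeff, directCoeff, swapCoeff, gueCov, Prod.swap_prod_mk, Prod.mk.injEq,
        h, h.le, h.ne, ↓reduceIte, false_and, and_false, add_zero, zero_add, mul_one, one_mul]
      linear_combination (coordVariance (i, j) : ℂ) * Complex.I_mul_I
    · simp [hermitianCoeff, directCoeff, swapCoeff, gueCov, coordVariance]
    · simp only [hermitianCoeff, directCoeff, swapCoeff, gueCov, Prod.swap_prod_mk, Prod.mk.injEq,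
        h.not_gt, h.not_ge, h.ne', ↓reduceIte, false_and, and_false, add_zero, zero_add, mul_one,
        one_mul, mul_neg, neg_mul, neg_neg]
      linear_combination (coordVariance (i, j) : ℂ) * Complex.I_mul_I
  by_cases hq' : q = (j, i)
  · subst hq'
    rcases lt_trichotomy i j with h | rfl | h
    · simp only [hermitianCoeff, directCoeff, swapCoeff, gueCov, coordVariance, Prod.swap_prod_mk,
        Prod.mk.injEq, h, h.le, h.ne, h.ne', h.not_gt, h.not_ge, ↓reduceIte, and_self, add_zero,
        zero_add, mul_one, one_mul, mul_neg, one_div, NNReal.coe_inv, NNReal.coe_ofNat,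
        Complex.ofReal_inv, Complex.ofReal_ofNat]
      linear_combination (-1 / 2 : ℂ) * Complex.I_mul_I
    · exact absurd rfl hq
    · simp only [hermitianCoeff, directCoeff, swapCoeff, gueCov, coordVariance, Prod.swap_prod_mk,
        Prod.mk.injEq, h, h.le, h.ne, h.ne', h.not_gt, h.not_ge, ↓reduceIte, and_self, add_zero,
        zero_add, mul_one, one_mul, neg_mul, one_div, NNReal.coe_inv, NNReal.coe_ofNat,
        Complex.ofReal_inv, Complex.ofReal_ofNat]
      linear_combination (-1 / 2 : ℂ) * Complex.I_mul_I
  · have hswap : ((i, j) : Fin N × Fin N) ≠ q.swap := fun h => hq' (by rw [← q.swap_swap, ← h]; rfl)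
    have hswap' : ((j, i) : Fin N × Fin N) ≠ q.swap := fun h => hq (by rw [← q.swap_swap, ← h]; rfl)
    simp [hermitianCoeff, gueCov, Ne.symm hq, Ne.symm hq', hq', hswap, hswap']

variable {Ξ : Ω → Matrix (Fin N) (Fin N) ℂ}

namespace IsStandardGUE

theorem memLp_coord (hΞ : IsStandardGUE Ξ P) (p : Fin N × Fin N) (k : ℕ) :
    MemLp (fun ω => (hermitianCoord (Ξ ω) p : ℂ)) k P :=
  memLp_ofReal_of_hasLaw_gaussianReal (hΞ.hasLaw p) k

theorem ae_entry_eq (hΞ : IsStandardGUE Ξ P) (p : Fin N × Fin N) :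
    (fun ω => Ξ ω p.1 p.2) =ᵐ[P]
      fun ω => ∑ q, hermitianCoeff p q * (hermitianCoord (Ξ ω) q : ℂ) := by
  filter_upwards [hΞ.isHermitian] with ω hω using entry_eq_sum_hermitianCoeff hω p

theorem memLp (hΞ : IsStandardGUE Ξ P) (p : Fin N × Fin N) (k : ℕ) :
    MemLp (fun ω => Ξ ω p.1 p.2) k P :=
  (memLp_linear hΞ.memLp_coord hermitianCoeff p k).ae_eq (hΞ.ae_entry_eq p).symm

variable [IsProbabilityMeasure P]

theorem isWick (hΞ : IsStandardGUE Ξ P) : IsWick gueCov (expectation hΞ.memLp) := by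
  have hcov : (fun p q : Fin N × Fin N => ∑ s, ∑ t, hermitianCoeff p s *
      (if s = t then ((coordVariance s : ℝ) : ℂ) else 0) * hermitianCoeff q t) = gueCov :=
    funext₂ sum_hermitianCoeff_mul_coordVariance
  exact hcov ▸ (isWick_expectation_of_iIndepFun (v := coordVariance) hΞ.indep hΞ.hasLaw
    hΞ.memLp_coord).expectation_linear hermitianCoeff hΞ.memLp hΞ.ae_entry_eq

theorem integral_eval_conj (hΞ : IsStandardGUE Ξ P) {U : Matrix (Fin N) (Fin N) ℂ}
    (hU : U.conjTranspose * U = 1) (p : MvPolynomial (Fin N × Fin N) ℂ) :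
    ∫ ω, eval (fun q => (U.conjTranspose * Ξ ω * U) q.1 q.2) p ∂P =
      ∫ ω, eval (fun q => Ξ ω q.1 q.2) p ∂P := by
  let A : Fin N × Fin N → Fin N × Fin N → ℂ := fun p q => star (U q.1 p.1) * U q.2 p.2
  have hentry (q : Fin N × Fin N) : (fun ω => (U.conjTranspose * Ξ ω * U) q.1 q.2) =
      fun ω => ∑ s, A q s * Ξ ω s.1 s.2 := by
    funext ω
    simp only [Matrix.mul_apply, Finset.sum_mul, Matrix.conjTranspose_apply, A]
    rw [Finset.sum_comm, Fintype.sum_prod_type]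
    exact Finset.sum_congr rfl fun _ _ => Finset.sum_congr rfl fun _ _ => by ring
  have hmem (q : Fin N × Fin N) (k : ℕ) :
      MemLp (fun ω => (U.conjTranspose * Ξ ω * U) q.1 q.2) k P :=
    hentry q ▸ memLp_linear hΞ.memLp A q k
  have hwick : IsWick gueCov (expectation hmem) := sum_conj_gueCov hU ▸
    hΞ.isWick.expectation_linear A hmem fun q => Filter.EventuallyEq.of_eq (hentry q)
  exact LinearMap.congr_fun (hwick.unique hΞ.isWick) p

theorem integral_eval_eq (hΞ : IsStandardGUE Ξ P) {Ω' : Type*} {_ : MeasurableSpace Ω'}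
    {P' : Measure Ω'} [IsProbabilityMeasure P'] {Ξ' : Ω' → Matrix (Fin N) (Fin N) ℂ}
    (hΞ' : IsStandardGUE Ξ' P') (p : MvPolynomial (Fin N × Fin N) ℂ) :
    ∫ ω, eval (fun q => Ξ ω q.1 q.2) p ∂P = ∫ ω, eval (fun q => Ξ' ω q.1 q.2) p ∂P' :=
  LinearMap.congr_fun (hΞ.isWick.unique hΞ'.isWick) p

end IsStandardGUE

end GUE

/-! ### Bordered matrices -/

section TraceStats

open MvPolynomial Matrix

variable {R S ι : Type*} [CommRing R] [CommRing S] [Fintype ι] [DecidableEq ι]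

/-- The family `tr M ^ k`, `w · M ^ k v`, for `k ∈ ℕ`. -/
def traceStats (M : Matrix ι ι R) (w v : ι → R) : ℕ ⊕ ℕ → R :=
  Sum.elim (fun k => trace (M ^ k)) fun k => w ⬝ᵥ (M ^ k) *ᵥ v

theorem map_traceStats (f : R →+* S) (M : Matrix ι ι R) (w v : ι → R) (i : ℕ ⊕ ℕ) :
    f (traceStats M w v i) = traceStats (M.map f) (f ∘ w) (f ∘ v) i := by
  have hpow (k : ℕ) : (M.map f) ^ k = (M ^ k).map f := (map_pow f.mapMatrix M k).symm
  rcases i with k | k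
  · simp only [traceStats, Sum.elim_inl, hpow]
    exact AddMonoidHom.map_trace f.toAddMonoidHom _
  · simp only [traceStats, Sum.elim_inr, hpow, RingHom.map_dotProduct]
    exact congrArg _ (funext fun j => RingHom.map_mulVec f _ _ _)

theorem eval_bind₁ {σ τ : Type*} (f : τ → R) (r : σ → MvPolynomial τ R) (p : MvPolynomial σ R) :
    eval f (bind₁ r p) = eval (fun i => eval f (r i)) p :=
  eval₂Hom_bind₁ (RingHom.id R) f r p

theorem exists_eval_traceStats (w v : ι → R) (p : MvPolynomial (ℕ ⊕ ℕ) R) :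
    ∃ q : MvPolynomial (ι × ι) R, ∀ M : Matrix ι ι R,
      eval (traceStats M w v) p = eval (fun r => M r.1 r.2) q := by
  refine ⟨bind₁ (traceStats (mvPolynomialX ι ι R) (C ∘ w) (C ∘ v)) p, fun M => ?_⟩
  rw [eval_bind₁]
  congr 2
  funext i
  rw [map_traceStats]
  congr 1
  · ext j l; simp
  · funext j; simp
  · funext j; simp

theorem traceStats_conj {U V : Matrix ι ι R} (hUV : U * V = 1) (M : Matrix ι ι R) (w v : ι → R) :
    traceStats (V * M * U) w v = traceStats M (w ᵥ* V) (U *ᵥ v) := by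
  have hpow (k : ℕ) : (V * M * U) ^ k = V * M ^ k * U :=
    Units.conj_pow ⟨V, U, mul_eq_one_comm.mp hUV, hUV⟩ M k
  funext i
  rcases i with k | k
  · simp only [traceStats, Sum.elim_inl, hpow, trace_mul_comm (V * M ^ k), ← mul_assoc, hUV,
      one_mul]
  · simp only [traceStats, Sum.elim_inr, hpow, ← mulVec_mulVec, dotProduct_mulVec w]

theorem traceStats_smul_smul (M : Matrix ι ι R) (w v : ι → R) (a b : R) :
    traceStats M (a • w) (b • v) = traceStats M w ((a * b) • v) := by
  funext i
  rcases i with k | k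
  · rfl
  · simp only [traceStats, Sum.elim_inr, mulVec_smul, smul_dotProduct, dotProduct_smul, smul_smul,
      mul_comm b]

theorem exists_eval_traceStats_smul (c : R) (p : MvPolynomial (ℕ ⊕ ℕ) R) :
    ∃ q : MvPolynomial (ℕ ⊕ ℕ) R, ∀ (M : Matrix ι ι R) (w v : ι → R),
      eval (traceStats M w (c • v)) p = eval (traceStats M w v) q := by
  refine ⟨bind₁ (Sum.elim (fun k => X (Sum.inl k)) fun k => C c * X (Sum.inr k)) p,
    fun M w v => ?_⟩
  rw [eval_bind₁]
  congr 2
  funext i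
  rcases i with k | k <;> simp [traceStats, mulVec_smul]

end TraceStats

section Bordered

open MvPolynomial Matrix

variable {R : Type*} [CommRing R] {n : ℕ}

/-- The matrix obtained by deleting the last row and the last column. -/
def leading (M : Matrix (Fin (n + 1)) (Fin (n + 1)) R) : Matrix (Fin n) (Fin n) R :=
  M.submatrix Fin.castSucc Fin.castSucc

/-- The last row, without its last entry. -/
def lastRow (M : Matrix (Fin (n + 1)) (Fin (n + 1)) R) : Fin n → R :=
  fun j => M (Fin.last n) j.castSucc

/-- The last column, without its last entry. -/
def lastCol (M : Matrix (Fin (n + 1)) (Fin (n + 1)) R) : Fin n → R :=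
  fun j => M j.castSucc (Fin.last n)

section Mul

variable (M M' : Matrix (Fin (n + 1)) (Fin (n + 1)) R)

theorem mul_last_last : (M * M') (Fin.last n) (Fin.last n) =
    lastRow M ⬝ᵥ lastCol M' + M (Fin.last n) (Fin.last n) * M' (Fin.last n) (Fin.last n) := by
  simp only [Matrix.mul_apply, Fin.sum_univ_castSucc, dotProduct, lastRow, lastCol]

theorem lastRow_mul :
    lastRow (M * M') = lastRow M ᵥ* leading M' + M (Fin.last n) (Fin.last n) • lastRow M' := by
  funext i
  simp only [lastRow, Matrix.mul_apply, Fin.sum_univ_castSucc, Pi.add_apply, vecMul, dotProduct,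
    leading, submatrix_apply, Pi.smul_apply, smul_eq_mul]

theorem lastCol_mul :
    lastCol (M * M') = leading M *ᵥ lastCol M' + M' (Fin.last n) (Fin.last n) • lastCol M := by
  funext i
  simp only [lastCol, Matrix.mul_apply, Fin.sum_univ_castSucc, Pi.add_apply, mulVec, dotProduct,
    leading, submatrix_apply, Pi.smul_apply, smul_eq_mul, mul_comm]

theorem leading_mul :
    leading (M * M') = leading M * leading M' + vecMulVec (lastCol M) (lastRow M') := by
  ext i j
  simp only [leading, submatrix_apply, Matrix.mul_apply, Fin.sum_univ_castSucc, Matrix.add_apply,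
    vecMulVec_apply, lastCol, lastRow]

theorem trace_eq_trace_leading_add :
    trace M = trace (leading M) + M (Fin.last n) (Fin.last n) := by
  simp only [trace, diag, Fin.sum_univ_castSucc, leading, submatrix_apply]

theorem leading_one : leading (1 : Matrix (Fin (n + 1)) (Fin (n + 1)) R) = 1 :=
  submatrix_one _ (Fin.castSucc_injective n)

theorem lastRow_one : lastRow (1 : Matrix (Fin (n + 1)) (Fin (n + 1)) R) = 0 :=
  funext fun i => one_apply_ne (Fin.castSucc_lt_last i).ne'

theorem lastCol_one : lastCol (1 : Matrix (Fin (n + 1)) (Fin (n + 1)) R) = 0 :=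
  funext fun i => one_apply_ne (Fin.castSucc_lt_last i).ne

end Mul

-- The induction on `k` closes up only if all four blocks of `M ^ k` are treated at once.
theorem blocks_pow_mem {X : Type*} (M : X → Matrix (Fin (n + 1)) (Fin (n + 1)) R)
    (𝒮 : Subalgebra R (X → R)) (hcorner : (fun x => M x (Fin.last n) (Fin.last n)) ∈ 𝒮)
    (hstats : ∀ i,
      (fun x => traceStats (leading (M x)) (lastRow (M x)) (lastCol (M x)) i) ∈ 𝒮) (k : ℕ) :
    (fun x => (M x ^ k) (Fin.last n) (Fin.last n)) ∈ 𝒮 ∧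
    (∀ j, (fun x => lastRow (M x ^ k) ⬝ᵥ leading (M x) ^ j *ᵥ lastCol (M x)) ∈ 𝒮) ∧
    (∀ j, (fun x => lastRow (M x) ⬝ᵥ leading (M x) ^ j *ᵥ lastCol (M x ^ k)) ∈ 𝒮) ∧
    ∀ j, (fun x => trace (leading (M x ^ k) * leading (M x) ^ j)) ∈ 𝒮 := by
  induction k with
  | zero =>
    refine ⟨?_, fun j => ?_, fun j => ?_, fun j => ?_⟩
    · simp only [pow_zero, one_apply_eq]
      exact 𝒮.one_mem
    · simp only [pow_zero, lastRow_one, zero_dotProduct]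
      exact 𝒮.zero_mem
    · simp only [pow_zero, lastCol_one, mulVec_zero, dotProduct_zero]
      exact 𝒮.zero_mem
    · simpa only [pow_zero, leading_one, one_mul, traceStats, Sum.elim_inl] using hstats (Sum.inl j)
  | succ k ih =>
    obtain ⟨hlast, hrow, hcol, htrace⟩ := ih
    refine ⟨?_, fun j => ?_, fun j => ?_, fun j => ?_⟩
    · convert 𝒮.add_mem (hrow 0) (𝒮.mul_mem hlast hcorner) using 2 with x
      simp only [pow_succ (M x), mul_last_last, pow_zero, one_mulVec, Pi.add_apply, Pi.mul_apply]
    · convert 𝒮.add_mem (hrow (j + 1)) (𝒮.mul_mem hlast (hstats (Sum.inr j))) using 2 with x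
      simp only [pow_succ (M x), lastRow_mul, add_dotProduct, smul_dotProduct, ← dotProduct_mulVec,
        mulVec_mulVec, pow_succ', smul_eq_mul, Pi.add_apply, Pi.mul_apply, traceStats, Sum.elim_inr]
    · convert 𝒮.add_mem (hcol (j + 1)) (𝒮.mul_mem hlast (hstats (Sum.inr j))) using 2 with x
      simp only [pow_succ' (M x), lastCol_mul, mulVec_add, mulVec_smul, dotProduct_add,
        dotProduct_smul, mulVec_mulVec, pow_succ, smul_eq_mul, Pi.add_apply, Pi.mul_apply,
        traceStats, Sum.elim_inr]
    · convert 𝒮.add_mem (htrace (j + 1)) (hcol j) using 2 with x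
      simp only [pow_succ (M x), leading_mul, add_mul, trace_add, mul_assoc, ← pow_succ',
        vecMulVec_mul, trace_vecMulVec, Pi.add_apply, dotProduct_mulVec]
      rw [dotProduct_comm]

theorem exists_eval_traceStats_leading (a : R) (p : MvPolynomial (ℕ ⊕ ℕ) R) :
    ∃ q : MvPolynomial (ℕ ⊕ ℕ) R,
    ∀ M : Matrix (Fin (n + 1)) (Fin (n + 1)) R, M (Fin.last n) (Fin.last n) = a →
      eval (traceStats M (Pi.single (Fin.last n) 1) (Pi.single (Fin.last n) 1)) p =
        eval (traceStats (leading M) (lastRow M) (lastCol M)) q := by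
  let X := {M : Matrix (Fin (n + 1)) (Fin (n + 1)) R // M (Fin.last n) (Fin.last n) = a}
  let s (i : ℕ ⊕ ℕ) (x : X) : R := traceStats (leading x.1) (lastRow x.1) (lastCol x.1) i
  have hcorner : (fun x : X => x.1 (Fin.last n) (Fin.last n)) ∈ (aeval (R := R) s).range :=
    (funext fun x => x.2 : _ = algebraMap R (X → R) a) ▸ Subalgebra.algebraMap_mem _ a
  have hstats (i : ℕ ⊕ ℕ) : s i ∈ (aeval (R := R) s).range := ⟨MvPolynomial.X i, aeval_X s i⟩
  have hblocks := blocks_pow_mem (fun x : X => x.1) _ hcorner hstats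
  have hmem (i : ℕ ⊕ ℕ) : (fun x : X => traceStats x.1 (Pi.single (Fin.last n) 1)
      (Pi.single (Fin.last n) 1) i) ∈ (aeval (R := R) s).range := by
    rcases i with k | k
    · convert add_mem ((hblocks k).2.2.2 0) (hblocks k).1 using 2 with x
      simp only [traceStats, Sum.elim_inl, trace_eq_trace_leading_add, pow_zero, mul_one,
        Pi.add_apply]
    · simpa only [traceStats, Sum.elim_inr, mulVec_single_one, single_one_dotProduct, col_apply]
        using (hblocks k).1
  choose r hr using hmem
  refine ⟨bind₁ r p, fun M hM => ?_⟩
  rw [eval_bind₁]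
  congr 2
  funext i
  calc _ = aeval (R := R) s (r i) ⟨M, hM⟩ := (congrFun (hr i) ⟨M, hM⟩).symm
    _ = eval (fun j => s j ⟨M, hM⟩) (r i) :=
      comp_aeval_apply s (Pi.evalAlgHom R (fun _ : X => R) ⟨M, hM⟩) (r i)

end Bordered

section UnitaryInvariance

open MvPolynomial Matrix

theorem exists_unitary_mulVec_single {ι : Type*} [Fintype ι] [DecidableEq ι] (i₀ : ι)
    (v : ι → ℂ) : ∃ (U : Matrix ι ι ℂ) (c : ℂ), U.conjTranspose * U = 1 ∧
      v = c • (U *ᵥ Pi.single i₀ 1) := by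
  let x : EuclideanSpace ℂ ι := WithLp.toLp 2 v
  by_cases hx : x = 0
  · refine ⟨1, 0, by simp, ?_⟩
    rw [zero_smul]
    exact congrArg WithLp.ofLp hx
  have hnorm : (‖x‖ : ℂ) ≠ 0 := by exact_mod_cast norm_ne_zero_iff.mpr hx
  have horth : Orthonormal ℂ (({i₀} : Set ι).domRestrict fun _ => (‖x‖ : ℂ)⁻¹ • x) :=
    ⟨fun i => by simp [norm_smul, norm_ne_zero_iff.mpr hx],
      fun i j hij => absurd (Subsingleton.elim i j) hij⟩
  obtain ⟨b, hb⟩ := horth.exists_orthonormalBasis_extension_of_card_eq (by simp)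
  refine ⟨Matrix.of fun i j => b j i, (‖x‖ : ℂ), ?_, ?_⟩
  · ext i j
    rw [Matrix.mul_apply, Matrix.one_apply, ← orthonormal_iff_ite.mp b.orthonormal i j,
      PiLp.inner_apply]
    simp [mul_comm]
  · funext i
    simp [hb i₀ rfl, hnorm, x]

theorem IsStandardGUE.integral_eval_traceStats {Ω : Type*} {mΩ : MeasurableSpace Ω} {P : Measure Ω}
    [IsProbabilityMeasure P] {N : ℕ} {Ξ : Ω → Matrix (Fin N) (Fin N) ℂ}
    (hΞ : IsStandardGUE Ξ P) (i₀ : Fin N) (v : Fin N → ℂ) (p : MvPolynomial (ℕ ⊕ ℕ) ℂ) :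
    ∫ ω, eval (traceStats (Ξ ω) (star v) v) p ∂P =
      ∫ ω, eval (traceStats (Ξ ω) (Pi.single i₀ 1) ((star v ⬝ᵥ v) • Pi.single i₀ 1)) p ∂P := by
  obtain ⟨U, c, hU, hv⟩ := exists_unitary_mulVec_single i₀ v
  set e : Fin N → ℂ := Pi.single i₀ 1
  have hnorm : star v ⬝ᵥ v = star c * c := by
    rw [hv, star_smul, smul_dotProduct, dotProduct_smul, star_mulVec, ← dotProduct_mulVec,
      mulVec_mulVec, hU, one_mulVec]
    simp [e]
  have hrow : e ᵥ* U.conjTranspose = star (U *ᵥ e) := by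
    rw [star_mulVec, Pi.star_single, star_one]
  have hconj (M : Matrix (Fin N) (Fin N) ℂ) : traceStats M (star v) v =
      traceStats (U.conjTranspose * M * U) e ((star v ⬝ᵥ v) • e) := by
    rw [traceStats_conj (mul_eq_one_comm.mp hU), hnorm, mulVec_smul, ← traceStats_smul_smul, hrow,
      ← star_smul, ← hv]
  obtain ⟨q, hq⟩ := exists_eval_traceStats e ((star v ⬝ᵥ v) • e) p
  simp only [hconj, hq]
  exact hΞ.integral_eval_conj hU q

end UnitaryInvariance

/-! ### The tridiagonal model -/

section Piecewise

variable {α : Type*} {X : α → Type*} (s : Set α)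

open Classical in
theorem preimage_piecewise_prod_pi (I : Finset α) (t : ∀ a, Set (X a)) :
    (fun x : (∀ a, X a) × (∀ a, X a) => s.piecewise x.1 x.2) ⁻¹' (Set.pi I t) =
      (Set.pi (I.filter (· ∈ s)) t) ×ˢ (Set.pi (I.filter (· ∉ s)) t) := by
  ext x
  simp only [Set.mem_preimage, Set.mem_pi, Set.mem_prod, Finset.coe_filter, Set.mem_ofPred_eq,
    Finset.mem_coe, and_imp, Set.piecewise, ← forall₂_and]
  exact forall₂_congr fun a _ => by by_cases ha : a ∈ s <;> simp [ha]

variable [∀ a, MeasurableSpace (X a)] (μ : ∀ a, Measure (X a)) [∀ a, IsProbabilityMeasure (μ a)]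

open Classical in
theorem measurable_piecewise_prod :
    Measurable fun x : (∀ a, X a) × (∀ a, X a) => s.piecewise x.1 x.2 := by
  refine measurable_pi_lambda _ fun a => ?_
  by_cases ha : a ∈ s
  · simp only [Set.piecewise_eq_of_mem _ _ _ ha]; fun_prop
  · simp only [Set.piecewise_eq_of_notMem _ _ _ ha]; fun_prop

open Classical in
theorem measurePreserving_piecewise_infinitePi :
    MeasurePreserving (fun x : (∀ a, X a) × (∀ a, X a) => s.piecewise x.1 x.2)
      ((Measure.infinitePi μ).prod (Measure.infinitePi μ)) (Measure.infinitePi μ) := by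
  refine ⟨measurable_piecewise_prod s, Measure.eq_infinitePi _ fun I t ht => ?_⟩
  rw [Measure.map_apply (measurable_piecewise_prod s)
    (MeasurableSet.pi I.countable_toSet fun a _ => ht a), preimage_piecewise_prod_pi,
    Measure.prod_prod, Measure.infinitePi_pi _ fun a _ => ht a,
    Measure.infinitePi_pi _ fun a _ => ht a, Finset.prod_filter_mul_prod_filter_not]

open Classical in
theorem integral_infinitePi_eq_integral_piecewise {E : Type*} [NormedAddCommGroup E]
    [NormedSpace ℝ E] {f : (∀ a, X a) → E} (hf : Integrable f (Measure.infinitePi μ)) :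
    ∫ x, f x ∂Measure.infinitePi μ =
      ∫ y, ∫ x, f (s.piecewise x y) ∂Measure.infinitePi μ ∂Measure.infinitePi μ := by
  have hmp := measurePreserving_piecewise_infinitePi s μ
  calc ∫ x, f x ∂Measure.infinitePi μ
      = ∫ x, f (s.piecewise x.1 x.2) ∂(Measure.infinitePi μ).prod (Measure.infinitePi μ) := by
        rw [← integral_map hmp.aemeasurable (hmp.map_eq.symm ▸ hf.aestronglyMeasurable),
          hmp.map_eq]
    _ = _ := (integral_prod_symm _
        ((hmp.integrable_comp hf.aestronglyMeasurable).mpr hf)).symm ▸ rfl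

end Piecewise

section NormalFamily

instance : IsProbabilityMeasure normalFamily := by
  unfold normalFamily; infer_instance

theorem hasLaw_normalFamily (a : ℕ × ℕ) :
    HasLaw (fun ξ : ℕ × ℕ → ℝ => ξ a) (gaussianReal 0 1) normalFamily :=
  ⟨(measurable_pi_apply a).aemeasurable, (measurePreserving_eval_infinitePi _ a).map_eq⟩

theorem iIndepFun_normalFamily : iIndepFun (fun (a : ℕ × ℕ) (ξ : ℕ × ℕ → ℝ) => ξ a) normalFamily :=
  iIndepFun_infinitePi (X := fun _ x => x) fun _ => measurable_id

theorem memLp_normalFamily {𝕜 : Type*} [RCLike 𝕜] (a : ℕ × ℕ) (k : ℕ) :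
    MemLp (fun ξ : ℕ × ℕ → ℝ => (ξ a : 𝕜)) k normalFamily :=
  memLp_ofReal_of_hasLaw_gaussianReal (hasLaw_normalFamily a) k

end NormalFamily

section GUEModel

open Matrix

variable {N n : ℕ}

/-- The column bordering `gueModel n` in `gueModel (n + 1)`. -/
noncomputable def gueColumn (n : ℕ) (ξ : ℕ × ℕ → ℝ) (j : ℕ) : ℂ :=
  √2⁻¹ * (ξ (n, 2 * j + 1) + ξ (n, 2 * j + 2) * Complex.I)

/-- A GUE matrix built from independent standard normal variables. -/
noncomputable def gueModel (N : ℕ) (ξ : ℕ × ℕ → ℝ) : Matrix (Fin N) (Fin N) ℂ :=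
  Matrix.of fun i j =>
    if i = j then (ξ (i + 1, 0) : ℂ)
    else if i < j then gueColumn j ξ i else star (gueColumn i ξ j)

theorem isHermitian_gueModel (N : ℕ) (ξ : ℕ × ℕ → ℝ) : (gueModel N ξ).IsHermitian := by
  ext i j
  rcases lt_trichotomy i j with h | rfl | h
  · simp [gueModel, h, h.ne, h.ne', h.not_gt]
  · simp [gueModel]
  · simp [gueModel, h, h.ne', h.ne, h.not_gt]

/-- The index of the variable which gives the coordinate `p` of `gueModel`. -/
def coordIndex (p : Fin N × Fin N) : ℕ × ℕ :=
  if p.1 = p.2 then (p.1 + 1, 0)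
  else if p.1 < p.2 then (p.2, 2 * p.1 + 1) else (p.1, 2 * p.2 + 2)

theorem coordIndex_injective : Function.Injective (coordIndex (N := N)) := by
  rintro ⟨i, j⟩ ⟨k, l⟩ h
  simp only [coordIndex] at h
  simp only [Prod.mk.injEq, Fin.ext_iff, Fin.lt_def] at h ⊢
  split_ifs at h <;> simp only [Prod.mk.injEq] at h <;> omega

theorem hermitianCoord_gueModel (ξ : ℕ × ℕ → ℝ) (p : Fin N × Fin N) :
    hermitianCoord (gueModel N ξ) p = √(coordVariance p) * ξ (coordIndex p) := by
  obtain ⟨i, j⟩ := p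
  rcases lt_trichotomy i j with h | rfl | h
  · simp [hermitianCoord, gueModel, gueColumn, coordVariance, coordIndex, h, h.ne, h.le,
      Real.sqrt_div_self]
  · simp [hermitianCoord, gueModel, coordVariance, coordIndex]
  · simp [hermitianCoord, gueModel, gueColumn, coordVariance, coordIndex, h, h.ne, h.ne', h.not_gt,
      h.not_ge, Real.sqrt_div_self]

theorem isStandardGUE_gueModel (N : ℕ) : IsStandardGUE (gueModel N) normalFamily where
  isHermitian := Filter.Eventually.of_forall (isHermitian_gueModel N)
  indep := by
    simp only [hermitianCoord_gueModel]
    exact (iIndepFun_normalFamily.precomp coordIndex_injective).comp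
      (fun p x => √(coordVariance p) * x) fun p => measurable_const_mul _
  hasLaw p := by
    simp only [hermitianCoord_gueModel]
    convert gaussianReal_const_mul (hasLaw_normalFamily (coordIndex p)) √(coordVariance p) using 1
    simp [coordVariance]

theorem leading_gueModel (n : ℕ) (ξ : ℕ × ℕ → ℝ) : leading (gueModel (n + 1) ξ) = gueModel n ξ := by
  ext i j
  simp only [leading, gueModel, submatrix_apply, of_apply, Fin.castSucc_inj,
    Fin.castSucc_lt_castSucc_iff, Fin.val_castSucc]

theorem lastCol_gueModel (n : ℕ) (ξ : ℕ × ℕ → ℝ) :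
    lastCol (gueModel (n + 1) ξ) = fun j : Fin n => gueColumn n ξ j := by
  funext j
  simp [lastCol, gueModel, Fin.castSucc_lt_last, (Fin.castSucc_lt_last j).ne]

theorem lastRow_gueModel (n : ℕ) (ξ : ℕ × ℕ → ℝ) :
    lastRow (gueModel (n + 1) ξ) = star fun j : Fin n => gueColumn n ξ j := by
  rw [← lastCol_gueModel]
  exact funext fun j => ((isHermitian_gueModel (n + 1) ξ).apply _ _).symm

theorem gueModel_last_last (n : ℕ) (ξ : ℕ × ℕ → ℝ) :
    gueModel (n + 1) ξ (Fin.last n) (Fin.last n) = ξ (n + 1, 0) := by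
  simp [gueModel]

theorem star_gueColumn_mul_self (n j : ℕ) (ξ : ℕ × ℕ → ℝ) :
    star (gueColumn n ξ j) * gueColumn n ξ j =
      ((ξ (n, 2 * j + 1) ^ 2 / 2 + ξ (n, 2 * j + 2) ^ 2 / 2 : ℝ) : ℂ) := by
  have hsqrt : √2⁻¹ * √2⁻¹ = 2⁻¹ := Real.mul_self_sqrt (by norm_num)
  rw [Complex.star_def, ← Complex.normSq_eq_conj_mul_self, gueColumn, Complex.normSq_mul,
    Complex.normSq_ofReal, Complex.normSq_add_mul_I, hsqrt]
  push_cast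
  ring

theorem sum_Icc_one_two_mul {M : Type*} [AddCommMonoid M] (f : ℕ → M) (n : ℕ) :
    ∑ l ∈ Finset.Icc 1 (2 * n), f l = ∑ j ∈ Finset.range n, (f (2 * j + 1) + f (2 * j + 2)) := by
  induction n with
  | zero => rfl
  | succ n ih =>
    rw [Finset.sum_range_succ, ← ih, mul_add_one, Finset.sum_Icc_succ_top (by omega),
      Finset.sum_Icc_succ_top (by omega), add_assoc]

theorem star_gueColumn_dotProduct (n : ℕ) (ξ : ℕ × ℕ → ℝ) :
    (star fun j : Fin n => gueColumn n ξ j) ⬝ᵥ (fun j : Fin n => gueColumn n ξ j) =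
      ((∑ l ∈ Finset.Icc 1 (2 * n), ξ (n, l) ^ 2 / 2 : ℝ) : ℂ) := by
  rw [sum_Icc_one_two_mul, Complex.ofReal_sum]
  calc _ = ∑ j : Fin n, star (gueColumn n ξ j) * gueColumn n ξ j := rfl
    _ = _ := by simp only [star_gueColumn_mul_self, Fin.sum_univ_eq_sum_range
        fun j => ((ξ (n, 2 * j + 1) ^ 2 / 2 + ξ (n, 2 * j + 2) ^ 2 / 2 : ℝ) : ℂ)]

end GUEModel

section TriModel

open Matrix MvPolynomial

/-- The tridiagonal matrix with diagonal entries `ξ_{k0}`, entries `∑_{j=1}^{2k} ξ_{kj}² / 2` above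
the diagonal, and entries `1` below. -/
noncomputable def triModel (N : ℕ) (ξ : ℕ × ℕ → ℝ) : Matrix (Fin N) (Fin N) ℝ :=
  Matrix.of fun i j =>
    if (j : ℕ) = i then ξ (i + 1, 0)
    else if (j : ℕ) = i + 1 then ∑ l ∈ Finset.Icc 1 (2 * ((i : ℕ) + 1)), ξ (i + 1, l) ^ 2 / 2
    else if (i : ℕ) = j + 1 then 1
    else 0

theorem exists_eval_eq_triModel {N : ℕ} (i j : Fin N) :
    ∃ q : MvPolynomial (ℕ × ℕ) ℝ, ∀ ξ, triModel N ξ i j = eval ξ q := by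
  refine ⟨if (j : ℕ) = i then X ((i : ℕ) + 1, 0)
    else if (j : ℕ) = i + 1 then
      ∑ l ∈ Finset.Icc 1 (2 * ((i : ℕ) + 1)), X ((i : ℕ) + 1, l) ^ 2 * C 2⁻¹
    else if (i : ℕ) = j + 1 then 1
    else 0, fun ξ => ?_⟩
  simp only [triModel, of_apply, div_eq_mul_inv]
  split_ifs <;> simp only [eval_X, map_sum, map_mul, map_pow, eval_C, map_one, map_zero]

theorem memLp_triModel {N : ℕ} (p : Fin N × Fin N) (k : ℕ) :
    MemLp (fun ξ => (triModel N ξ p.1 p.2 : ℂ)) k normalFamily := by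
  obtain ⟨q, hq⟩ := exists_eval_eq_triModel p.1 p.2
  simp only [hq]
  exact (memLp_eval (memLp_normalFamily (𝕜 := ℝ)) q k).ofReal

theorem leading_triModel (n : ℕ) (ξ : ℕ × ℕ → ℝ) : leading (triModel (n + 1) ξ) = triModel n ξ :=
  rfl

theorem triModel_last_last (n : ℕ) (ξ : ℕ × ℕ → ℝ) :
    triModel (n + 1) ξ (Fin.last n) (Fin.last n) = ξ (n + 1, 0) := by
  simp [triModel]

theorem lastRow_triModel (n : ℕ) (ξ : ℕ × ℕ → ℝ) :
    lastRow (triModel (n + 2) ξ) = Pi.single (Fin.last n) 1 := by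
  funext j
  simp only [lastRow, triModel, of_apply, Fin.val_castSucc, Fin.val_last, Pi.single_apply,
    Fin.ext_iff]
  split_ifs <;> first | rfl | omega

theorem lastCol_triModel (n : ℕ) (ξ : ℕ × ℕ → ℝ) :
    lastCol (triModel (n + 2) ξ) =
      (∑ l ∈ Finset.Icc 1 (2 * (n + 1)), ξ (n + 1, l) ^ 2 / 2) • Pi.single (Fin.last n) 1 := by
  funext j
  rcases eq_or_ne j (Fin.last n) with rfl | hj
  · simp [lastCol, triModel]
  · have hjn : (j : ℕ) ≠ n := fun h => hj (Fin.ext h)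
    simp only [lastCol, triModel, of_apply, Fin.val_castSucc, Fin.val_last, Pi.smul_apply,
      Pi.single_eq_of_ne hj, smul_zero]
    split_ifs <;> first | rfl | omega

end TriModel

section Congr

variable {n : ℕ} {ξ ξ' : ℕ × ℕ → ℝ}

/-- The variables which enter into the models of size `n`. -/
def modelVars (n : ℕ) : Set (ℕ × ℕ) := {a | (a.2 = 0 ∧ a.1 ≤ n) ∨ (a.2 ≠ 0 ∧ a.1 < n)}

theorem gueColumn_congr (h : ∀ l, ξ (n, l + 1) = ξ' (n, l + 1)) (j : ℕ) :
    gueColumn n ξ j = gueColumn n ξ' j := by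
  simp only [gueColumn, h]

theorem gueModel_congr (h : ∀ a ∈ modelVars n, ξ a = ξ' a) : gueModel n ξ = gueModel n ξ' := by
  have hcol (i : Fin n) (j : ℕ) : gueColumn i ξ j = gueColumn i ξ' j :=
    gueColumn_congr (fun l => h _ (Or.inr ⟨l.succ_ne_zero, i.2⟩)) j
  ext i j
  simp only [gueModel, Matrix.of_apply, hcol, h (i + 1, 0) (Or.inl ⟨rfl, i.2⟩)]

theorem triModel_congr (h : ∀ a ∈ modelVars n, ξ a = ξ' a) : triModel n ξ = triModel n ξ' := by
  ext i j
  simp only [triModel, Matrix.of_apply, h (i + 1, 0) (Or.inl ⟨rfl, i.2⟩)]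
  refine if_congr Iff.rfl rfl (ite_congr rfl (fun hij => ?_) fun _ => rfl)
  refine Finset.sum_congr rfl fun l hl => ?_
  rw [h (i + 1, l) (Or.inr ⟨Nat.one_le_iff_ne_zero.mp (Finset.mem_Icc.mp hl).1, hij ▸ j.2⟩)]

end Congr

section Tridiagonalization

open MvPolynomial Matrix

theorem integrable_eval_traceStats {Ω ι : Type*} {mΩ : MeasurableSpace Ω} {P : Measure Ω}
    [IsFiniteMeasure P] [Fintype ι] [DecidableEq ι] {M : Ω → Matrix ι ι ℂ}
    (hM : ∀ (p : ι × ι) (k : ℕ), MemLp (fun ω => M ω p.1 p.2) k P) (w v : ι → ℂ)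
    (p : MvPolynomial (ℕ ⊕ ℕ) ℂ) : Integrable (fun ω => eval (traceStats (M ω) w v) p) P := by
  obtain ⟨q, hq⟩ := exists_eval_traceStats w v p
  simp only [hq]
  exact integrable_eval hM q

open Classical in
theorem blocks_gueModel_piecewise (n : ℕ) (ξ ξ' : ℕ × ℕ → ℝ) :
    leading (gueModel (n + 1) ((modelVars n).piecewise ξ ξ')) = gueModel n ξ ∧
    lastRow (gueModel (n + 1) ((modelVars n).piecewise ξ ξ')) =
      star (fun j : Fin n => gueColumn n ξ' j) ∧
    lastCol (gueModel (n + 1) ((modelVars n).piecewise ξ ξ')) =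
      (fun j : Fin n => gueColumn n ξ' j) ∧
    gueModel (n + 1) ((modelVars n).piecewise ξ ξ') (Fin.last n) (Fin.last n) =
      ξ' (n + 1, 0) := by
  have hcol (j : ℕ) : gueColumn n ((modelVars n).piecewise ξ ξ') j = gueColumn n ξ' j :=
    gueColumn_congr (fun l => Set.piecewise_eq_of_notMem _ _ _ (by simp [modelVars])) j
  have hcorner : (modelVars n).piecewise ξ ξ' (n + 1, 0) = ξ' (n + 1, 0) :=
    Set.piecewise_eq_of_notMem _ _ _ (by simp [modelVars])
  simp only [leading_gueModel, lastRow_gueModel, lastCol_gueModel, gueModel_last_last, hcol,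
    hcorner, and_self, and_true]
  exact gueModel_congr fun a ha => Set.piecewise_eq_of_mem _ _ _ ha

open Classical in
theorem blocks_triModel_piecewise (n : ℕ) (ξ ξ' : ℕ × ℕ → ℝ) :
    leading (triModel (n + 2) ((modelVars (n + 1)).piecewise ξ ξ')) = triModel (n + 1) ξ ∧
    lastRow (triModel (n + 2) ((modelVars (n + 1)).piecewise ξ ξ')) = Pi.single (Fin.last n) 1 ∧
    lastCol (triModel (n + 2) ((modelVars (n + 1)).piecewise ξ ξ')) =
      (∑ l ∈ Finset.Icc 1 (2 * (n + 1)), ξ' (n + 1, l) ^ 2 / 2) • Pi.single (Fin.last n) 1 ∧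
    triModel (n + 2) ((modelVars (n + 1)).piecewise ξ ξ') (Fin.last (n + 1)) (Fin.last (n + 1)) =
      ξ' (n + 2, 0) := by
  have hcol : ∀ l ∈ Finset.Icc 1 (2 * (n + 1)),
      (modelVars (n + 1)).piecewise ξ ξ' (n + 1, l) ^ 2 / 2 = ξ' (n + 1, l) ^ 2 / 2 := by
    intro l hl
    have hl₀ : l ≠ 0 := Nat.one_le_iff_ne_zero.mp (Finset.mem_Icc.mp hl).1
    rw [Set.piecewise_eq_of_notMem _ _ _ (by simp [modelVars, hl₀])]
  have hcorner : (modelVars (n + 1)).piecewise ξ ξ' (n + 2, 0) = ξ' (n + 2, 0) :=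
    Set.piecewise_eq_of_notMem _ _ _ (by simp [modelVars])
  simp only [leading_triModel, lastRow_triModel, lastCol_triModel, triModel_last_last,
    Finset.sum_congr rfl hcol, hcorner, and_self, and_true]
  exact triModel_congr fun a ha => Set.piecewise_eq_of_mem _ _ _ ha

open Classical in
theorem blocks_map_triModel_piecewise (n : ℕ) (ξ ξ' : ℕ × ℕ → ℝ) :
    let T := (triModel (n + 2) ((modelVars (n + 1)).piecewise ξ ξ')).map ((↑) : ℝ → ℂ)
    leading T = (triModel (n + 1) ξ).map (↑) ∧
    lastRow T = Pi.single (Fin.last n) 1 ∧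
    lastCol T = ((∑ l ∈ Finset.Icc 1 (2 * (n + 1)), ξ' (n + 1, l) ^ 2 / 2 : ℝ) : ℂ) •
      Pi.single (Fin.last n) 1 ∧
    T (Fin.last (n + 1)) (Fin.last (n + 1)) = ξ' (n + 2, 0) := by
  intro T
  obtain ⟨hlead, hrow, hcol, hcorner⟩ := blocks_triModel_piecewise n ξ ξ'
  have hsingle : (fun j => ((Pi.single (Fin.last n) (1 : ℝ) : Fin (n + 1) → ℝ) j : ℂ)) =
      Pi.single (Fin.last n) 1 := by
    funext j
    simp only [Pi.single_apply]
    split_ifs <;> simp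
  refine ⟨congrArg (fun M => Matrix.map M ((↑) : ℝ → ℂ)) hlead, ?_, ?_,
    congrArg ((↑) : ℝ → ℂ) hcorner⟩
  · exact (congrArg (fun w j => ((w j : ℝ) : ℂ)) hrow).trans hsingle
  · refine (congrArg (fun w j => ((w j : ℝ) : ℂ)) hcol).trans ?_
    rw [← hsingle]
    exact funext fun j => Complex.ofReal_mul _ _

theorem gueModel_one (ξ : ℕ × ℕ → ℝ) : gueModel 1 ξ = (triModel 1 ξ).map (↑) := by
  ext i j
  obtain rfl : j = i := Subsingleton.elim _ _
  simp [gueModel, triModel]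

-- One step of tridiagonalization: given the last column `v` of `gueModel (n + 1)`, the remaining
-- matrix is a smaller GUE matrix, so by unitary invariance `v` may be rotated onto the last axis.
theorem integral_traceStats_gueModel (n : ℕ) (p : MvPolynomial (ℕ ⊕ ℕ) ℂ) :
    ∫ ξ, eval (traceStats (gueModel (n + 1) ξ) (Pi.single (Fin.last n) 1)
        (Pi.single (Fin.last n) 1)) p ∂normalFamily =
      ∫ ξ, eval (traceStats ((triModel (n + 1) ξ).map (↑)) (Pi.single (Fin.last n) 1)
        (Pi.single (Fin.last n) 1)) p ∂normalFamily := by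
  classical
  induction n generalizing p with
  | zero =>
    have hmodel (ξ) : gueModel (0 + 1) ξ = (triModel (0 + 1) ξ).map (↑) := gueModel_one ξ
    simp only [hmodel]
  | succ n ih =>
    have hG := integrable_eval_traceStats (isStandardGUE_gueModel (n + 2)).memLp
      (Pi.single (Fin.last (n + 1)) 1) (Pi.single (Fin.last (n + 1)) 1) p
    have hT := integrable_eval_traceStats (M := fun ξ => (triModel (n + 2) ξ).map ((↑) : ℝ → ℂ))
      memLp_triModel (Pi.single (Fin.last (n + 1)) 1) (Pi.single (Fin.last (n + 1)) 1) p
    refine (integral_infinitePi_eq_integral_piecewise (modelVars (n + 1)) _ hG).trans <|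
      (integral_congr_ae (Filter.Eventually.of_forall fun ξ' => ?_)).trans
      (integral_infinitePi_eq_integral_piecewise (modelVars (n + 1)) _ hT).symm
    obtain ⟨q, hq⟩ := exists_eval_traceStats_leading (n := n + 1) (ξ' (n + 2, 0) : ℂ) p
    let v : Fin (n + 1) → ℂ := fun j => gueColumn (n + 1) ξ' j
    let e : Fin (n + 1) → ℂ := Pi.single (Fin.last n) 1
    obtain ⟨q', hq'⟩ := exists_eval_traceStats_smul (ι := Fin (n + 1)) (star v ⬝ᵥ v) q
    calc _ = ∫ ξ, eval (traceStats (gueModel (n + 1) ξ) (star v) v) q ∂normalFamily := by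
          refine integral_congr_ae (Filter.Eventually.of_forall fun ξ => ?_)
          obtain ⟨hlead, hrow, hcol, hcorner⟩ := blocks_gueModel_piecewise (n + 1) ξ ξ'
          simp only [hq _ hcorner, hlead, hrow, hcol, v]
      _ = ∫ ξ, eval (traceStats (gueModel (n + 1) ξ) e ((star v ⬝ᵥ v) • e)) q ∂normalFamily :=
          (isStandardGUE_gueModel (n + 1)).integral_eval_traceStats (Fin.last n) v q
      _ = ∫ ξ, eval (traceStats ((triModel (n + 1) ξ).map (↑)) e ((star v ⬝ᵥ v) • e)) q
            ∂normalFamily := by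
          simp only [hq']
          exact ih q'
      _ = _ := by
          refine integral_congr_ae (Filter.Eventually.of_forall fun ξ => ?_)
          obtain ⟨hlead, hrow, hcol, hcorner⟩ := blocks_map_triModel_piecewise n ξ ξ'
          simp only [hq _ hcorner, hlead, hrow, hcol, v, e, star_gueColumn_dotProduct]

theorem ofReal_re_trace_of_isHermitian {ι : Type*} [Fintype ι] {A : Matrix ι ι ℂ}
    (hA : A.IsHermitian) : ((trace A).re : ℂ) = trace A :=
  Complex.conj_eq_iff_re.mp (by rw [starRingEnd_apply, ← trace_conjTranspose, hA.eq])

namespace IsStandardGUE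

variable {Ω : Type*} {mΩ : MeasurableSpace Ω} {P : Measure Ω} [IsProbabilityMeasure P]

theorem integral_eval_traceStats_last {n : ℕ}
    {Ξ : Ω → Matrix (Fin (n + 1)) (Fin (n + 1)) ℂ} (hΞ : IsStandardGUE Ξ P)
    (p : MvPolynomial (ℕ ⊕ ℕ) ℂ) :
    ∫ ω, eval (traceStats (Ξ ω) (Pi.single (Fin.last n) 1) (Pi.single (Fin.last n) 1)) p ∂P =
      ∫ ξ, eval (traceStats ((triModel (n + 1) ξ).map (↑)) (Pi.single (Fin.last n) 1)
        (Pi.single (Fin.last n) 1)) p ∂normalFamily := by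
  rw [← integral_traceStats_gueModel]
  obtain ⟨q, hq⟩ := exists_eval_traceStats (R := ℂ) (Pi.single (Fin.last n) 1)
    (Pi.single (Fin.last n) 1) p
  simp only [hq]
  exact hΞ.integral_eval_eq (isStandardGUE_gueModel (n + 1)) q

theorem integral_prod_trace {N : ℕ} (hN : 0 < N) {Ξ : Ω → Matrix (Fin N) (Fin N) ℂ}
    (hΞ : IsStandardGUE Ξ P) {ι : Type*} (s : Finset ι) (m : ι → ℕ) :
    ∫ ω, ∏ i ∈ s, (trace (Ξ ω ^ m i)).re ∂P =
      ∫ ξ, ∏ i ∈ s, trace (triModel N ξ ^ m i) ∂normalFamily := by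
  obtain ⟨n, rfl⟩ := Nat.exists_eq_succ_of_ne_zero hN.ne'
  let e : Fin (n + 1) → ℂ := Pi.single (Fin.last n) 1
  let p : MvPolynomial (ℕ ⊕ ℕ) ℂ := ∏ i ∈ s, X (Sum.inl (m i))
  have heval (M : Matrix (Fin (n + 1)) (Fin (n + 1)) ℂ) :
      eval (traceStats M e e) p = ∏ i ∈ s, trace (M ^ m i) := by
    simp only [p, map_prod, eval_X, traceStats, Sum.elim_inl]
  have htri (ξ : ℕ × ℕ → ℝ) (k : ℕ) : trace ((triModel (n + 1) ξ).map ((↑) : ℝ → ℂ) ^ k) =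
      ((trace (triModel (n + 1) ξ ^ k) : ℝ) : ℂ) :=
    (map_traceStats Complex.ofRealHom (triModel (n + 1) ξ) 0 0 (Sum.inl k)).symm
  apply Complex.ofReal_injective
  calc ((∫ ω, ∏ i ∈ s, (trace (Ξ ω ^ m i)).re ∂P : ℝ) : ℂ)
      = ∫ ω, eval (traceStats (Ξ ω) e e) p ∂P := by
        rw [← integral_complex_ofReal]
        refine integral_congr_ae ?_
        filter_upwards [hΞ.isHermitian] with ω hω
        rw [heval, Complex.ofReal_prod]
        exact Finset.prod_congr rfl fun i _ => ofReal_re_trace_of_isHermitian (hω.pow (m i))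
    _ = ∫ ξ, eval (traceStats ((triModel (n + 1) ξ).map (↑)) e e) p ∂normalFamily :=
        hΞ.integral_eval_traceStats_last p
    _ = _ := by
        rw [← integral_complex_ofReal]
        simp only [heval, htri, Complex.ofReal_prod]

end IsStandardGUE

end Tridiagonalization

/-! ### Set partitions -/

section Partitions

open Polynomial

variable {α : Type*}

instance finite_setoid [Finite α] : Finite (Setoid α) :=
  Finite.of_injective (fun r : Setoid α => (fun a b => r a b : α → α → Prop)) fun _ _ h =>
    Setoid.ext fun a b => iff_of_eq (congrFun (congrFun h a) b)

noncomputable instance fintype_setoid [Finite α] : Fintype (Setoid α) :=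
  Fintype.ofFinite _

/-- The number `|Ψ|` of blocks of a set partition `Ψ`. -/
noncomputable def blockCount (Ψ : Setoid α) : ℕ := Nat.card (Quotient Ψ)

/-- The Möbius function `(-1)^(|Ψ|-1) (|Ψ|-1)!` of the interval from `Ψ` to the one-block partition
in the lattice of set partitions. -/
noncomputable def moebiusWeight (Ψ : Setoid α) : ℝ :=
  (-1) ^ (blockCount Ψ - 1) * ((blockCount Ψ - 1)! : ℝ)

/-- The functions constant exactly on the blocks of `Ψ` as functions on the set of blocks. -/
def kerEqEquiv {β : Type*} (Ψ : Setoid α) :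
    {f : α → β // Setoid.ker f = Ψ} ≃ (Quotient Ψ ↪ β) where
  toFun f := ⟨Quotient.lift f.1 fun a b (h : Ψ a b) => by rwa [← f.2] at h, by
    rintro ⟨a⟩ ⟨b⟩ (h : Setoid.ker f.1 a b)
    exact Quotient.sound (f.2 ▸ h)⟩
  invFun g := ⟨fun a => g (Quotient.mk Ψ a), Setoid.ext fun a b => by
    rw [Setoid.ker_def, g.injective.eq_iff]
    exact Quotient.eq⟩
  left_inv _ := rfl
  right_inv g := by
    ext ⟨a⟩
    rfl

section Finite

variable [Finite α]

theorem blockCount_pos [Nonempty α] (Ψ : Setoid α) : 0 < blockCount Ψ :=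
  have : Nonempty (Quotient Ψ) := ⟨Quotient.mk Ψ (Classical.arbitrary α)⟩
  Nat.card_pos

theorem blockCount_le_one_iff {Ψ : Setoid α} : blockCount Ψ ≤ 1 ↔ Ψ = ⊤ :=
  Finite.card_le_one_iff_subsingleton.trans Quotient.subsingleton_iff

theorem card_ker_eq (Ψ : Setoid α) (x : ℕ) :
    Nat.card {f : α → Fin x // Setoid.ker f = Ψ} = x.descFactorial (blockCount Ψ) := by
  have : Fintype (Quotient Ψ) := Fintype.ofFinite _
  rw [Nat.card_congr (kerEqEquiv Ψ), Nat.card_eq_fintype_card, Fintype.card_embedding_eq,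
    Fintype.card_fin, blockCount, Nat.card_eq_fintype_card]

open Classical in
theorem pow_blockCount_eq_sum (Θ : Setoid α) (x : ℕ) :
    x ^ blockCount Θ = ∑ Ψ with Θ ≤ Ψ, x.descFactorial (blockCount Ψ) := by
  have : Fintype α := Fintype.ofFinite α
  have hlift : Nat.card {f : α → Fin x // Θ ≤ Setoid.ker f} = x ^ blockCount Θ := by
    rw [Nat.card_congr (Setoid.liftEquiv Θ), Nat.card_fun, Nat.card_fin, blockCount]
  rw [← hlift, Nat.card_eq_fintype_card, Fintype.card_subtype,
    Finset.card_eq_sum_card_fiberwise (f := fun f => Setoid.ker f)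
      (t := Finset.univ.filter fun Ψ => Θ ≤ Ψ) fun f hf => by simpa using hf]
  refine Finset.sum_congr rfl fun Ψ hΨ => ?_
  rw [← card_ker_eq, Nat.card_eq_fintype_card, Fintype.card_subtype, Finset.filter_filter]
  congr 1
  ext f
  simp only [Finset.mem_filter, Finset.mem_univ, true_and] at hΨ ⊢
  exact ⟨fun h => h.2, fun h => ⟨h ▸ hΨ, h⟩⟩

theorem coeff_one_descPochhammer (k : ℕ) :
    (descPochhammer ℝ (k + 1)).coeff 1 = (-1) ^ k * (k ! : ℝ) := by
  have h := ascPochhammer_eval_neg_eq_descPochhammer ℝ (-1) k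
  rw [neg_neg, ascPochhammer_eval_one] at h
  rw [descPochhammer_succ_left, coeff_X_mul, coeff_zero_eq_eval_zero, eval_comp, h, ← mul_assoc,
    ← mul_pow]
  simp

open Classical in
-- `X ^ |Θ|` is the sum of the falling factorials of length `|Ψ|`, whose linear coefficients are the
-- Möbius weights.
theorem sum_moebiusWeight {Θ : Setoid α} (hΘ : Θ ≠ ⊤) :
    ∑ Ψ with Θ ≤ Ψ, moebiusWeight Ψ = 0 := by
  have : Nonempty α := not_isEmpty_iff.mp fun _ => hΘ (Setoid.ext isEmptyElim)
  have hpoly : (X : ℝ[X]) ^ blockCount Θ = ∑ Ψ with Θ ≤ Ψ, descPochhammer ℝ (blockCount Ψ) := by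
    refine Polynomial.eq_of_infinite_eval_eq _ _ <|
      (Set.infinite_range_of_injective (Nat.cast_injective (R := ℝ))).mono ?_
    rintro _ ⟨x, rfl⟩
    simp only [Set.mem_ofPred_eq, eval_pow, eval_X, eval_finsetSum,
      descPochhammer_eval_eq_descFactorial]
    exact_mod_cast pow_blockCount_eq_sum Θ x
  have hweight (Ψ : Setoid α) : moebiusWeight Ψ = (descPochhammer ℝ (blockCount Ψ)).coeff 1 := by
    obtain ⟨k, hk⟩ := Nat.exists_eq_succ_of_ne_zero (blockCount_pos Ψ).ne'
    rw [moebiusWeight, hk, Nat.succ_eq_add_one, coeff_one_descPochhammer, Nat.add_sub_cancel]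
  have hcount : 1 ≠ blockCount Θ := fun h => hΘ (blockCount_le_one_iff.mp h.ge)
  simp only [hweight]
  rw [← finsetSum_coeff, ← hpoly, coeff_X_pow, if_neg hcount]

end Finite

/-- The bond `e` lies in a single block of `Ψ`. -/
def InBlock (Ψ : Setoid α) (e : Sym2 α) : Prop := ∀ i ∈ e, ∀ j ∈ e, Ψ i j

theorem inBlock_mk {Ψ : Setoid α} {i j : α} : InBlock Ψ s(i, j) ↔ Ψ i j := by
  refine ⟨fun h => h i (Sym2.mem_mk_left i j) j (Sym2.mem_mk_right i j), fun h => ?_⟩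
  simp only [InBlock, Sym2.mem_iff, forall_eq_or_imp, forall_eq]
  exact ⟨⟨Ψ.refl _, h⟩, Ψ.symm h, Ψ.refl _⟩

theorem InBlock.mono {Ψ Φ : Setoid α} (h : Ψ ≤ Φ) {e : Sym2 α} (he : InBlock Ψ e) :
    InBlock Φ e := fun i hi j hj => h (he i hi j hj)

theorem range_update_id [DecidableEq α] {a b : α} (hab : a ≠ b) :
    Set.range (Function.update id b a) = {b}ᶜ := by
  ext x
  simp only [Set.mem_range, Set.mem_compl_singleton_iff]
  constructor
  · rintro ⟨y, rfl⟩
    rcases eq_or_ne y b with rfl | hy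
    · rwa [Function.update_self]
    · rwa [Function.update_of_ne hy]
  · exact fun hx => ⟨x, Function.update_of_ne hx _ _⟩

section BondJoin

variable {n : ℕ} {Θ : Setoid (Fin n)}

theorem bondJoin_le_iff {Γ : Finset (Sym2 (Fin n))} {Ψ : Setoid (Fin n)} :
    bondJoin Γ Θ ≤ Ψ ↔ Θ ≤ Ψ ∧ ∀ e ∈ Γ, InBlock Ψ e := by
  refine ⟨fun h => ⟨(le_sInf fun Φ hΦ => hΦ.1).trans h, fun e he => InBlock.mono h ?_⟩,
    fun h => sInf_le h⟩
  exact fun i hi j hj Φ hΦ => hΦ.2 e he i hi j hj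

theorem le_bondJoin (Γ : Finset (Sym2 (Fin n))) (Θ : Setoid (Fin n)) : Θ ≤ bondJoin Γ Θ :=
  (bondJoin_le_iff.mp le_rfl).1

theorem bondJoin_empty (Θ : Setoid (Fin n)) : bondJoin ∅ Θ = Θ :=
  eq_of_forall_ge_iff fun Ψ => by simp [bondJoin_le_iff]

theorem bondJoin_insert (e : Sym2 (Fin n)) (Γ : Finset (Sym2 (Fin n))) (Θ : Setoid (Fin n)) :
    bondJoin (insert e Γ) Θ = bondJoin Γ (bondJoin {e} Θ) :=
  eq_of_forall_ge_iff fun Ψ => by simp [bondJoin_le_iff, and_assoc]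

theorem bondJoin_singleton_of_inBlock {e : Sym2 (Fin n)} (h : InBlock Θ e) :
    bondJoin {e} Θ = Θ :=
  le_antisymm (bondJoin_le_iff.mpr ⟨le_rfl, by simpa using h⟩) (le_bondJoin _ _)

open Classical in
theorem bondJoin_singleton_eq_ker (i j : Fin n) (Θ : Setoid (Fin n)) :
    bondJoin {s(i, j)} Θ =
      Setoid.ker (Function.update id (Quotient.mk Θ j) (Quotient.mk Θ i) ∘ Quotient.mk Θ) := by
  refine eq_of_forall_ge_iff fun Ψ => ?_
  simp only [bondJoin_le_iff, Finset.mem_singleton, forall_eq, inBlock_mk]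
  constructor
  · rintro ⟨hle, hij⟩ x y hxy
    let π : Quotient Θ → Quotient Ψ := Quotient.map' id fun _ _ h => hle h
    have hπ (q : Quotient Θ) :
        π (Function.update id (Quotient.mk Θ j) (Quotient.mk Θ i) q) = π q := by
      rcases eq_or_ne q (Quotient.mk Θ j) with rfl | hq
      · rw [Function.update_self]
        exact Quotient.sound hij
      · rw [Function.update_of_ne hq, id_eq]
    exact Quotient.exact (((hπ _).symm.trans (congrArg π hxy)).trans (hπ _))
  · refine fun hle => ⟨fun x y hxy => hle ?_, hle ?_⟩
    · exact congrArg (Function.update id _ _) (Quotient.sound hxy)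
    · simp [Setoid.ker_def, Function.update_apply]

theorem blockCount_bondJoin {e : Sym2 (Fin n)} (h : ¬ InBlock Θ e) :
    blockCount (bondJoin {e} Θ) + 1 = blockCount Θ := by
  classical
  induction e using Sym2.ind with
  | _ i j =>
    have hij : Quotient.mk Θ i ≠ Quotient.mk Θ j := fun hij =>
      h (inBlock_mk.mpr (Quotient.exact hij))
    rw [bondJoin_singleton_eq_ker, blockCount, Nat.card_congr (Setoid.quotientKerEquivRange _),
      Quotient.mk_surjective.range_comp, range_update_id hij, Nat.card_coe_set_eq, add_comm,
      ← Set.ncard_singleton (Quotient.mk Θ j), Set.ncard_add_ncard_compl, blockCount]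

theorem blockCount_le_add_card (Γ : Finset (Sym2 (Fin n))) (Θ : Setoid (Fin n)) :
    blockCount Θ ≤ blockCount (bondJoin Γ Θ) + Γ.card := by
  classical
  induction Γ using Finset.induction_on generalizing Θ with
  | empty => rw [bondJoin_empty, Finset.card_empty, add_zero]
  | insert e Γ he ih =>
    rw [bondJoin_insert, Finset.card_insert_of_notMem he]
    have hΓ := ih (bondJoin {e} Θ)
    by_cases h : InBlock Θ e
    · rw [bondJoin_singleton_of_inBlock h] at hΓ ⊢
      omega
    · have := blockCount_bondJoin h
      omega

end BondJoin

end Partitions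

/-! ### The tree expansion -/

section Fibers

variable {X Y E : Type*} [MeasurableSpace X] [MeasurableSpace Y] [NormedAddCommGroup E]
  [NormedSpace ℝ E] {μ : Measure X} {ν : Measure Y} {s : Set X} {T : X → Set Y} {f : X × Y → E}

theorem integral_indicator_fibers (hS : MeasurableSet {z : X × Y | z.1 ∈ s ∧ z.2 ∈ T z.1}) (x : X) :
    ∫ y, {z : X × Y | z.1 ∈ s ∧ z.2 ∈ T z.1}.indicator f (x, y) ∂ν =
      s.indicator (fun x => ∫ y in T x, f (x, y) ∂ν) x := by
  classical
  by_cases hx : x ∈ s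
  · have hT : MeasurableSet (T x) := by
      simpa only [Set.preimage_ofPred_eq, hx, true_and] using! measurable_prodMk_left (x := x) hS
    rw [Set.indicator_of_mem hx, ← integral_indicator hT]
    simp only [Set.indicator_apply, Set.mem_ofPred_eq, hx, true_and]
  · simp only [Set.indicator_apply, Set.mem_ofPred_eq, hx, false_and, if_false, integral_zero]

variable [SFinite ν]

theorem integrableOn_integral_fibers (hs : MeasurableSet s)
    (hS : MeasurableSet {z : X × Y | z.1 ∈ s ∧ z.2 ∈ T z.1})
    (hf : IntegrableOn f {z : X × Y | z.1 ∈ s ∧ z.2 ∈ T z.1} (μ.prod ν)) :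
    IntegrableOn (fun x => ∫ y in T x, f (x, y) ∂ν) s μ := by
  rw [← integrable_indicator_iff hs, ← funext (integral_indicator_fibers hS)]
  exact ((integrable_indicator_iff hS).mpr hf).integral_prod_left

theorem setIntegral_fibers [SFinite μ] (hs : MeasurableSet s)
    (hS : MeasurableSet {z : X × Y | z.1 ∈ s ∧ z.2 ∈ T z.1})
    (hf : IntegrableOn f {z : X × Y | z.1 ∈ s ∧ z.2 ∈ T z.1} (μ.prod ν)) :
    ∫ z in {z : X × Y | z.1 ∈ s ∧ z.2 ∈ T z.1}, f z ∂μ.prod ν =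
      ∫ x in s, ∫ y in T x, f (x, y) ∂ν ∂μ := by
  rw [← integral_indicator hS, integral_prod _ ((integrable_indicator_iff hS).mpr hf),
    ← integral_indicator hs]
  simp only [integral_indicator_fibers hS]

end Fibers

section ScaledSimplex

variable {m : ℕ} {τ : ℝ}

/-- The simplex `τ > t_1 > ⋯ > t_m > 0`, on which the tree expansion is proved by induction. -/
def scaledSimplex (m : ℕ) (τ : ℝ) : Set (Fin m → ℝ) :=
  {t | StrictAnti t ∧ ∀ α, 0 < t α ∧ t α < τ}

theorem measurableSet_scaledSimplex (m : ℕ) (τ : ℝ) : MeasurableSet (scaledSimplex m τ) := by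
  simp only [scaledSimplex, StrictAnti, Set.ofPred_and, Set.ofPred_forall]
  refine .inter (.iInter fun i => .iInter fun j => .iInter fun _ => ?_)
    (.iInter fun α => .inter ?_ ?_)
  all_goals exact measurableSet_lt (by fun_prop) (by fun_prop)

theorem scaledSimplex_zero (τ : ℝ) : scaledSimplex 0 τ = Set.univ :=
  Set.eq_univ_of_forall fun t => ⟨Subsingleton.strictAnti t, fun α => α.elim0⟩

theorem mem_scaledSimplex_succ (t : Fin (m + 1) → ℝ) :
    t ∈ scaledSimplex (m + 1) τ ↔ t 0 ∈ Set.Ioo 0 τ ∧ Fin.tail t ∈ scaledSimplex m (t 0) := by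
  constructor
  · rintro ⟨hanti, hmem⟩
    exact ⟨hmem 0, fun i j hij => hanti (Fin.succ_lt_succ_iff.mpr hij),
      fun α => ⟨(hmem α.succ).1, hanti (Fin.succ_pos α)⟩⟩
  · rintro ⟨hzero, hanti, hmem⟩
    refine ⟨fun i j hij => ?_, Fin.cases hzero fun α => ⟨(hmem α).1, (hmem α).2.trans hzero.2⟩⟩
    obtain ⟨j, rfl⟩ := Fin.exists_succ_eq.mpr (Fin.ne_zero_of_lt hij)
    induction i using Fin.cases with
    | zero => exact (hmem j).2
    | succ i => exact hanti (Fin.succ_lt_succ_iff.mp hij)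

variable {E : Type*} [NormedAddCommGroup E]

theorem integrableOn_scaledSimplex {F : (Fin m → ℝ) → E} (hF : Continuous F) :
    IntegrableOn F (scaledSimplex m τ) :=
  (hF.continuousOn.integrableOn_compact isCompact_Icc).mono_set
    fun _ ht => ⟨fun α => (ht.2 α).1.le, fun α => (ht.2 α).2.le⟩

theorem preimage_piFinSuccAbove_fibers (m : ℕ) (τ : ℝ) :
    MeasurableEquiv.piFinSuccAbove (fun _ : Fin (m + 1) => ℝ) 0 ⁻¹'
      {z | z.1 ∈ Set.Ioo 0 τ ∧ z.2 ∈ scaledSimplex m z.1} = scaledSimplex (m + 1) τ :=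
  Set.ext fun t => (mem_scaledSimplex_succ t).symm

theorem measurableSet_scaledSimplex_fibers (m : ℕ) (τ : ℝ) :
    MeasurableSet {z : ℝ × (Fin m → ℝ) | z.1 ∈ Set.Ioo 0 τ ∧ z.2 ∈ scaledSimplex m z.1} := by
  rw [← MeasurableEquiv.measurableSet_preimage
    (MeasurableEquiv.piFinSuccAbove (fun _ : Fin (m + 1) => ℝ) 0), preimage_piFinSuccAbove_fibers]
  exact measurableSet_scaledSimplex (m + 1) τ

variable {F : ℝ → (Fin m → ℝ) → E}

theorem integrableOn_scaledSimplex_fibers (hF : Continuous (Function.uncurry F)) :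
    IntegrableOn (Function.uncurry F)
      {z | z.1 ∈ Set.Ioo 0 τ ∧ z.2 ∈ scaledSimplex m z.1} (volume.prod volume) := by
  refine (hF.continuousOn.integrableOn_compact
    (isCompact_Icc (a := ((0 : ℝ), fun _ => (0 : ℝ))) (b := (τ, fun _ => τ)))).mono_set ?_
  rintro ⟨t₀, s⟩ ⟨ht₀, hs⟩
  exact ⟨⟨ht₀.1.le, fun α => (hs.2 α).1.le⟩, ht₀.2.le, fun α => ((hs.2 α).2.trans ht₀.2).le⟩

variable [NormedSpace ℝ E]

theorem integrableOn_integral_scaledSimplex (hF : Continuous (Function.uncurry F)) :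
    IntegrableOn (fun t₀ => ∫ s in scaledSimplex m t₀, F t₀ s) (Set.Ioo 0 τ) :=
  integrableOn_integral_fibers measurableSet_Ioo (measurableSet_scaledSimplex_fibers m τ)
    (integrableOn_scaledSimplex_fibers hF)

theorem integral_scaledSimplex_succ (hF : Continuous (Function.uncurry F)) :
    ∫ t in scaledSimplex (m + 1) τ, F (t 0) (Fin.tail t) =
      ∫ t₀ in Set.Ioo 0 τ, ∫ s in scaledSimplex m t₀, F t₀ s := by
  rw [← preimage_piFinSuccAbove_fibers]
  exact ((volume_preserving_piFinSuccAbove (fun _ : Fin (m + 1) => ℝ) 0).setIntegral_preimage_emb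
    (MeasurableEquiv.measurableEmbedding _) (Function.uncurry F) _).trans
    (setIntegral_fibers (T := scaledSimplex m) measurableSet_Ioo
      (measurableSet_scaledSimplex_fibers m τ)
      (integrableOn_scaledSimplex_fibers hF))

end ScaledSimplex

section TreeSeq

variable {n : ℕ}

/-- The matrix `(τ - t_1) [Θ] + (t_1 - t_2) [{e_1} ∨ Θ] + ⋯ + t_m [{e_1, …, e_m} ∨ Θ]`. -/
noncomputable def seqMatrix : (m : ℕ) → Setoid (Fin n) → ℝ → (Fin m → Sym2 (Fin n)) →
    (Fin m → ℝ) → (Fin n → Fin n → ℝ)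
  | 0, Θ, τ, _, _ => τ • partitionMatrix Θ
  | m + 1, Θ, τ, e, t => (τ - t 0) • partitionMatrix Θ +
      seqMatrix m (bondJoin {e 0} Θ) (t 0) (Fin.tail e) (Fin.tail t)

/-- Each bond of the sequence joins two different blocks of the partition generated by `Θ` and the
previous bonds. -/
def IsTreeSeq : (m : ℕ) → Setoid (Fin n) → (Fin m → Sym2 (Fin n)) → Prop
  | 0, _, _ => True
  | m + 1, Θ, e => ¬ InBlock Θ (e 0) ∧ IsTreeSeq m (bondJoin {e 0} Θ) (Fin.tail e)

/-- The product `D e_m ⋯ D e_1`. -/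
def seqProd {B A : Type*} [Monoid A] (D : B → A) : (m : ℕ) → (Fin m → B) → A
  | 0, _ => 1
  | m + 1, e => seqProd D m (Fin.tail e) * D (e 0)

theorem continuous_seqMatrix (m : ℕ) (Θ : Setoid (Fin n)) (e : Fin m → Sym2 (Fin n)) :
    Continuous fun x : ℝ × (Fin m → ℝ) => seqMatrix m Θ x.1 e x.2 := by
  induction m generalizing Θ with
  | zero =>
    simp only [seqMatrix]
    fun_prop
  | succ m ih =>
    simp only [seqMatrix]
    refine Continuous.add (by fun_prop) ?_
    exact (ih (bondJoin {e 0} Θ) (Fin.tail e)).comp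
      (f := fun x : ℝ × (Fin (m + 1) → ℝ) => (x.2 0, Fin.tail x.2)) (by unfold Fin.tail; fun_prop)

open Classical in
theorem sum_isTreeSeq_succ {M : Type*} [AddCommMonoid M] (m : ℕ) (Θ : Setoid (Fin n))
    (g : (Fin (m + 1) → Sym2 (Fin n)) → M) :
    ∑ e with IsTreeSeq (m + 1) Θ e, g e =
      ∑ e₀ with ¬ InBlock Θ e₀, ∑ e with IsTreeSeq m (bondJoin {e₀} Θ) e,
        g (Fin.cons (α := fun _ => Sym2 (Fin n)) e₀ e) := by
  rw [Finset.sum_filter, ← (Fin.consEquiv fun _ => Sym2 (Fin n)).sum_comp,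
    Fintype.sum_prod_type, Finset.sum_filter]
  refine Finset.sum_congr rfl fun e₀ _ => ?_
  have hcons (e : Fin m → Sym2 (Fin n)) :
      Fin.consEquiv (fun _ => Sym2 (Fin n)) (e₀, e) = Fin.cons e₀ e := rfl
  simp only [hcons, IsTreeSeq, Fin.cons_zero, Fin.tail_cons, ite_and,
    Finset.sum_ite_irrel, Finset.sum_const_zero, Finset.sum_filter]

/-- Functions `W · p` of a matrix whose derivatives along the segments from `[Θ]` to `[Ψ]` are given
by the operators `D e` attached to the bonds `e` within a block of `Ψ` but not within a block
of `Θ`. -/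
structure HasBondDerivatives {A V E : Type*} [Monoid A] [MulAction A V] [NormedAddCommGroup E]
    [NormedSpace ℝ E] (D : Sym2 (Fin n) → A) (W : (Fin n → Fin n → ℝ) → V → E) : Prop where
  continuous (p : V) : Continuous fun Q => W Q p
  hasDerivAt (p : V) (Q : Fin n → Fin n → ℝ) {Θ Ψ : Setoid (Fin n)} (hΘΨ : Θ ≤ Ψ) (t : ℝ) :
    open Classical in
    HasDerivAt (fun t : ℝ => W (Q + t • (partitionMatrix Ψ - partitionMatrix Θ)) p)
      (∑ e with InBlock Ψ e ∧ ¬ InBlock Θ e,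
        W (Q + t • (partitionMatrix Ψ - partitionMatrix Θ)) (D e • p)) t

namespace HasBondDerivatives

variable {A V E : Type*} [Monoid A] [MulAction A V] [NormedAddCommGroup E] [NormedSpace ℝ E]
  {D : Sym2 (Fin n) → A} {W : (Fin n → Fin n → ℝ) → V → E}

open Classical in
theorem sum_integral_segment [CompleteSpace E] (hW : HasBondDerivatives D W)
    {Θ Ψ : Setoid (Fin n)} (hΘΨ : Θ ≤ Ψ) (Q : Fin n → Fin n → ℝ) (τ : ℝ) (p : V) :
    ∑ e with InBlock Ψ e ∧ ¬ InBlock Θ e, ∫ t in (0 : ℝ)..τ,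
        W (Q + (τ - t) • partitionMatrix Θ + t • partitionMatrix Ψ) (D e • p) =
      W (Q + τ • partitionMatrix Ψ) p - W (Q + τ • partitionMatrix Θ) p := by
  have hsegment (t : ℝ) : Q + (τ - t) • partitionMatrix Θ + t • partitionMatrix Ψ =
      Q + τ • partitionMatrix Θ + t • (partitionMatrix Ψ - partitionMatrix Θ) := by module
  have hcont (q : V) : Continuous fun t : ℝ =>
      W (Q + τ • partitionMatrix Θ + t • (partitionMatrix Ψ - partitionMatrix Θ)) q :=
    (hW.continuous q).comp (by fun_prop)
  simp only [hsegment]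
  rw [← intervalIntegral.integral_finsetSum fun e _ => (hcont _).intervalIntegrable _ _,
    intervalIntegral.integral_eq_sub_of_hasDerivAt (fun t _ => hW.hasDerivAt p _ hΘΨ t)
      ((continuous_finsetSum _ fun e _ => hcont _).intervalIntegrable _ _),
    ← hsegment, ← hsegment, sub_self, sub_zero, zero_smul, zero_smul, add_zero, add_zero]

open Classical in
theorem sum_integral_scaledSimplex_succ (hW : HasBondDerivatives D W) {m : ℕ}
    (Θ : Setoid (Fin n)) (e₀ : Sym2 (Fin n)) (Q : Fin n → Fin n → ℝ) (τ : ℝ) (p : V) :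
    ∑ e with IsTreeSeq m (bondJoin {e₀} Θ) e, ∫ t in scaledSimplex (m + 1) τ,
        W (Q + seqMatrix (m + 1) Θ τ (Fin.cons e₀ e) t) (seqProd D (m + 1) (Fin.cons e₀ e) • p) =
      ∫ t₀ in Set.Ioo 0 τ, ∑ e with IsTreeSeq m (bondJoin {e₀} Θ) e, ∫ t in scaledSimplex m t₀,
        W (Q + (τ - t₀) • partitionMatrix Θ + seqMatrix m (bondJoin {e₀} Θ) t₀ e t)
          (seqProd D m e • D e₀ • p) := by
  have hcont (e : Fin m → Sym2 (Fin n)) (q : V) :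
      Continuous (Function.uncurry fun (t₀ : ℝ) (t : Fin m → ℝ) =>
        W (Q + (τ - t₀) • partitionMatrix Θ + seqMatrix m (bondJoin {e₀} Θ) t₀ e t) q) :=
    (hW.continuous q).comp (Continuous.add (by fun_prop) (continuous_seqMatrix m _ e))
  rw [integral_finsetSum _ fun e _ => integrableOn_integral_scaledSimplex (hcont e _)]
  refine Finset.sum_congr rfl fun e _ => ?_
  rw [← integral_scaledSimplex_succ (hcont e _)]
  simp only [seqMatrix, seqProd, Fin.cons_zero, Fin.tail_cons, mul_smul, add_assoc]

open Classical in
-- For each `Ψ` the bonds contribute the difference of the values at `τ [Ψ]` and `τ [Θ]`, and the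
-- latter cancel in the sum over `Ψ` because the Möbius weights sum to zero.
theorem sum_integral_sum_moebiusWeight_smul [CompleteSpace E] (hW : HasBondDerivatives D W)
    {Θ : Setoid (Fin n)} (hΘ : Θ ≠ ⊤) (Q : Fin n → Fin n → ℝ) {τ : ℝ} (hτ : 0 ≤ τ) (p : V) :
    ∑ e with ¬ InBlock Θ e, ∫ t in Set.Ioo 0 τ, ∑ Ψ with Θ ≤ Ψ ∧ InBlock Ψ e,
        moebiusWeight Ψ • W (Q + (τ - t) • partitionMatrix Θ + t • partitionMatrix Ψ) (D e • p) =
      ∑ Ψ with Θ ≤ Ψ, moebiusWeight Ψ • W (Q + τ • partitionMatrix Ψ) p := by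
  have hcont (e : Sym2 (Fin n)) (Ψ : Setoid (Fin n)) : Continuous fun t : ℝ =>
      moebiusWeight Ψ • W (Q + (τ - t) • partitionMatrix Θ + t • partitionMatrix Ψ) (D e • p) :=
    ((hW.continuous _).comp (by fun_prop)).const_smul _
  calc _ = ∑ e with ¬ InBlock Θ e, ∑ Ψ with Θ ≤ Ψ ∧ InBlock Ψ e, moebiusWeight Ψ •
          ∫ t in (0 : ℝ)..τ, W (Q + (τ - t) • partitionMatrix Θ + t • partitionMatrix Ψ)
            (D e • p) := by
        refine Finset.sum_congr rfl fun e _ => ?_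
        rw [← integral_Ioc_eq_integral_Ioo, ← intervalIntegral.integral_of_le hτ,
          intervalIntegral.integral_finsetSum fun Ψ _ => (hcont e Ψ).intervalIntegrable _ _]
        simp only [intervalIntegral.integral_smul]
    _ = ∑ Ψ with Θ ≤ Ψ, moebiusWeight Ψ • ∑ e with InBlock Ψ e ∧ ¬ InBlock Θ e,
          ∫ t in (0 : ℝ)..τ, W (Q + (τ - t) • partitionMatrix Θ + t • partitionMatrix Ψ)
            (D e • p) := by
        simp only [Finset.smul_sum]
        exact Finset.sum_comm' fun e Ψ => by
          simp only [Finset.mem_filter, Finset.mem_univ, true_and]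
          tauto
    _ = ∑ Ψ with Θ ≤ Ψ, (moebiusWeight Ψ • W (Q + τ • partitionMatrix Ψ) p -
          moebiusWeight Ψ • W (Q + τ • partitionMatrix Θ) p) := by
        refine Finset.sum_congr rfl fun Ψ hΨ => ?_
        rw [hW.sum_integral_segment (Finset.mem_filter.mp hΨ).2, smul_sub]
    _ = _ := by
        rw [Finset.sum_sub_distrib, ← Finset.sum_smul, sum_moebiusWeight hΘ, zero_smul, sub_zero]

open Classical in
theorem sum_isTreeSeq_integral [CompleteSpace E] (hW : HasBondDerivatives D W) {m : ℕ}
    {Θ : Setoid (Fin n)} (hΘ : blockCount Θ = m + 1) (Q : Fin n → Fin n → ℝ) {τ : ℝ} (hτ : 0 ≤ τ)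
    (p : V) :
    ∑ e with IsTreeSeq m Θ e, ∫ t in scaledSimplex m τ,
        W (Q + seqMatrix m Θ τ e t) (seqProd D m e • p) =
      ∑ Ψ with Θ ≤ Ψ, moebiusWeight Ψ • W (Q + τ • partitionMatrix Ψ) p := by
  induction m generalizing Θ Q τ p with
  | zero =>
    obtain rfl := blockCount_le_one_iff.mp hΘ.le
    have htop : (Finset.univ.filter fun Ψ : Setoid (Fin n) => ⊤ ≤ Ψ) = {⊤} := by
      ext Ψ
      simp
    rw [htop, Finset.sum_singleton, scaledSimplex_zero]
    simp [IsTreeSeq, seqMatrix, seqProd, moebiusWeight, hΘ, Measure.real, volume_pi]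
  | succ m ih =>
    have hne : Θ ≠ ⊤ := fun h => by have := blockCount_le_one_iff.mpr h; omega
    rw [sum_isTreeSeq_succ, ← hW.sum_integral_sum_moebiusWeight_smul hne Q hτ p]
    refine Finset.sum_congr rfl fun e₀ he₀ => ?_
    have hcount : blockCount (bondJoin {e₀} Θ) = m + 1 := by
      have := blockCount_bondJoin (Finset.mem_filter.mp he₀).2
      omega
    rw [hW.sum_integral_scaledSimplex_succ Θ e₀ Q τ p]
    refine setIntegral_congr_fun measurableSet_Ioo fun t₀ ht₀ => ?_
    simp only [ih hcount _ ht₀.1.le, bondJoin_le_iff, Finset.mem_singleton, forall_eq]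

end HasBondDerivatives

end TreeSeq

/-! ### Trees and their enumerations -/

section Enumerations

section Image

variable {m : ℕ} {β : Type*} [DecidableEq β]

theorem image_univ_succ (e : Fin (m + 1) → β) :
    Finset.univ.image e = insert (e 0) (Finset.univ.image (Fin.tail e)) := by
  ext b
  simp [Fin.tail, Fin.exists_fin_succ, eq_comm]

theorem image_Iic_succ (e : Fin (m + 1) → β) (α : Fin m) :
    (Finset.Iic α.succ).image e = insert (e 0) ((Finset.Iic α).image (Fin.tail e)) := by
  ext b
  simp [Fin.tail, Fin.exists_fin_succ, eq_comm]

theorem image_Iio_succ (e : Fin (m + 1) → β) (α : Fin m) :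
    (Finset.Iio α.succ).image e = insert (e 0) ((Finset.Iio α).image (Fin.tail e)) := by
  ext b
  simp [Fin.tail, Fin.exists_fin_succ, eq_comm]

theorem image_univ_equiv_coe {ι : Type*} [Fintype ι] {Γ : Finset β} (e : ι ≃ Γ) :
    Finset.univ.image (fun i => (e i : β)) = Γ := by
  ext b
  simp only [Finset.mem_image, Finset.mem_univ, true_and]
  exact ⟨fun ⟨i, hi⟩ => hi ▸ (e i).2, fun hb => ⟨e.symm ⟨b, hb⟩, by simp⟩⟩

open Classical in
theorem sum_equiv_coe [Fintype β] {M : Type*} [AddCommMonoid M] (Γ : Finset β)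
    (G : (Fin Γ.card → β) → M) :
    ∑ e : Fin Γ.card ≃ Γ, G (fun α => e α) = ∑ e with Finset.univ.image e = Γ, G e := by
  refine Finset.sum_bij (fun e _ α => (e α : β)) (fun e _ => ?_)
    (fun e _ e' _ h => Equiv.ext fun α => Subtype.ext (congrFun h α)) (fun e he => ?_)
    fun e _ => rfl
  · exact (Finset.mem_filter_univ _).mpr (image_univ_equiv_coe e)
  · have himage : Finset.univ.image e = Γ := (Finset.mem_filter.mp he).2
    have hmem (α : Fin Γ.card) : e α ∈ Γ := himage ▸ Finset.mem_image_of_mem e (Finset.mem_univ α)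
    have hinj : Function.Injective e := by
      rw [← Set.injOn_univ, ← Finset.coe_univ, ← Finset.card_image_iff, himage, Finset.card_univ,
        Fintype.card_fin]
    have hbij : Function.Bijective fun α => (⟨e α, hmem α⟩ : Γ) :=
      (Fintype.bijective_iff_injective_and_card _).mpr
        ⟨fun a b hab => hinj (congrArg Subtype.val hab), by simp⟩
    exact ⟨Equiv.ofBijective _ hbij, Finset.mem_univ _, rfl⟩

end Image

variable {n m : ℕ} {Θ : Setoid (Fin n)}

open Classical in
theorem seqMatrix_eq (Θ : Setoid (Fin n)) (τ : ℝ) (e : Fin m → Sym2 (Fin n)) (t : Fin m → ℝ) :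
    seqMatrix m Θ τ e t = τ • partitionMatrix Θ + ∑ α, t α •
      (partitionMatrix (bondJoin ((Finset.Iic α).image e) Θ) -
        partitionMatrix (bondJoin ((Finset.Iio α).image e) Θ)) := by
  induction m generalizing Θ τ with
  | zero => simp [seqMatrix]
  | succ m ih =>
    have hIic : (Finset.Iic (0 : Fin (m + 1))).image e = {e 0} := by
      ext b
      simp [eq_comm]
    have hIio : (Finset.Iio (0 : Fin (m + 1))).image e = ∅ := by
      ext b
      simp
    simp only [seqMatrix, ih, Fin.sum_univ_succ, image_Iic_succ, image_Iio_succ, bondJoin_insert,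
      hIic, hIio, bondJoin_empty, Fin.tail]
    module

theorem blockCount_le_card_add_one {Γ : Finset (Sym2 (Fin n))} (htop : bondJoin Γ Θ = ⊤) :
    blockCount Θ ≤ Γ.card + 1 := by
  have hle := blockCount_le_add_card Γ Θ
  have hone : blockCount (bondJoin Γ Θ) ≤ 1 := blockCount_le_one_iff.mpr htop
  omega

theorem not_inBlock_of_mem {Γ : Finset (Sym2 (Fin n))} (htop : bondJoin Γ Θ = ⊤)
    (hcard : Γ.card + 1 = blockCount Θ) {e : Sym2 (Fin n)} (he : e ∈ Γ) : ¬ InBlock Θ e := by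
  classical
  intro h
  rw [← Finset.insert_erase he, bondJoin_insert, bondJoin_singleton_of_inBlock h] at htop
  have hle := blockCount_le_card_add_one htop
  have := Finset.card_erase_add_one he
  omega

theorem mem_trees_iff {Γ : Finset (Sym2 (Fin n))} :
    Γ ∈ trees Θ ↔ bondJoin Γ Θ = ⊤ ∧ Γ.card + 1 = blockCount Θ := by
  classical
  simp only [trees, Finset.mem_filter, Finset.mem_univ, true_and]
  refine ⟨fun h => h.2, fun h => ⟨fun e he hd => not_inBlock_of_mem h.1 h.2 he ?_, h⟩⟩
  induction e using Sym2.ind with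
  | _ i j =>
    rw [Sym2.mk_isDiag_iff] at hd
    rw [inBlock_mk, hd]

open Classical in
theorem isTreeSeq_iff (hΘ : blockCount Θ = m + 1) (e : Fin m → Sym2 (Fin n)) :
    IsTreeSeq m Θ e ↔ bondJoin (Finset.univ.image e) Θ = ⊤ := by
  induction m generalizing Θ with
  | zero => simp [IsTreeSeq, bondJoin_empty, blockCount_le_one_iff.mp hΘ.le]
  | succ m ih =>
    rw [image_univ_succ, bondJoin_insert, IsTreeSeq]
    by_cases h : InBlock Θ (e 0)
    · simp only [h, not_true_eq_false, false_and, false_iff, bondJoin_singleton_of_inBlock h]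
      intro htop
      have hle := blockCount_le_card_add_one htop
      have hcard := Finset.card_image_le (s := Finset.univ) (f := Fin.tail e)
      rw [Finset.card_univ, Fintype.card_fin] at hcard
      omega
    · have := blockCount_bondJoin h
      rw [ih (by omega)]
      simp [h]

open Classical in
theorem IsTreeSeq.card_image (hΘ : blockCount Θ = m + 1) {e : Fin m → Sym2 (Fin n)}
    (he : IsTreeSeq m Θ e) : (Finset.univ.image e).card = m := by
  have hle := blockCount_le_card_add_one ((isTreeSeq_iff hΘ e).mp he)
  have hcard := Finset.card_image_le (s := Finset.univ) (f := e)
  rw [Finset.card_univ, Fintype.card_fin] at hcard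
  omega

open Classical in
open Classical in
theorem sum_trees_sum_equiv {M : Type*} [AddCommMonoid M] (hΘ : blockCount Θ = m + 1)
    (G : (m : ℕ) → (Fin m → Sym2 (Fin n)) → M) :
    ∑ Γ ∈ trees Θ, ∑ e : Fin Γ.card ≃ Γ, G Γ.card (fun α => e α) =
      ∑ e with IsTreeSeq m Θ e, G m e := by
  have hmem (e : Fin m → Sym2 (Fin n)) (he : IsTreeSeq m Θ e) : Finset.univ.image e ∈ trees Θ := by
    rw [mem_trees_iff, he.card_image hΘ]
    exact ⟨(isTreeSeq_iff hΘ e).mp he, hΘ.symm⟩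
  rw [← Finset.sum_fiberwise_of_maps_to (t := trees Θ) (g := fun e => Finset.univ.image e)
    fun e he => hmem e (Finset.mem_filter.mp he).2]
  refine Finset.sum_congr rfl fun Γ hΓ => ?_
  obtain ⟨htop, hcard⟩ := mem_trees_iff.mp hΓ
  obtain rfl : m = Γ.card := by omega
  rw [sum_equiv_coe Γ (G Γ.card), Finset.filter_filter]
  congr 1
  ext e
  simp only [Finset.mem_filter, Finset.mem_univ, true_and, isTreeSeq_iff hΘ, iff_and_self]
  intro himage
  rwa [himage]

theorem seqProd_smul {R A B : Type*} [CommSemiring R] [Semiring A] [Algebra R A] (D : B → A)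
    (c : B → R) (e : Fin m → B) :
    seqProd (fun e => c e • D e) m e = (∏ α, c (e α)) • seqProd D m e := by
  induction m with
  | zero => simp only [seqProd, Finset.univ_eq_empty, Finset.prod_empty, one_smul]
  | succ m ih =>
    rw [seqProd, seqProd, ih, Fin.prod_univ_succ, smul_mul_smul_comm, mul_comm (c (e 0))]
    rfl

theorem treeOperator_insert (N : ℕ) [DecidableEq (Sym2 (Fin n))] {Γ : Finset (Sym2 (Fin n))}
    {e : Sym2 (Fin n)} (he : e ∉ Γ) :
    treeOperator N (insert e Γ) = treeOperator N Γ * bondOperator N e :=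
  Finset.noncommProd_insert_of_notMem' Γ e (bondOperator N)
    (fun e _ e' _ _ => bondOperator_commute N e e') he

open Classical in
theorem seqProd_bondOperator (N : ℕ) {e : Fin m → Sym2 (Fin n)} (he : Function.Injective e) :
    seqProd (bondOperator N) m e = treeOperator N (Finset.univ.image e) := by
  induction m with
  | zero => simp [seqProd, treeOperator]
  | succ m ih =>
    have hnotMem : e 0 ∉ Finset.univ.image (Fin.tail e) := by
      simp only [Finset.mem_image, Finset.mem_univ, true_and, not_exists]
      exact fun α hα => Fin.succ_ne_zero α (he hα)
    rw [seqProd, ih (e := Fin.tail e) (he.comp (Fin.succ_injective m)), image_univ_succ,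
      treeOperator_insert N hnotMem]

end Enumerations

/-! ### The tree expansion for recoupled Gaussian families -/

section Recoupling

theorem integral_mul_normalFamily (a b : ℕ × ℕ) :
    ∫ ξ, ξ a * ξ b ∂normalFamily = if a = b then 1 else 0 := by
  have hmoment (a : ℕ × ℕ) (k : ℕ) :
      ∫ ξ, ξ a ^ k ∂normalFamily = ∫ x, x ^ k ∂gaussianReal 0 1 :=
    (hasLaw_normalFamily a).integral_comp (f := fun x : ℝ => x ^ k) (by fun_prop)
  split_ifs with hab
  · have := hmoment a (1 + 1)
    rw [integral_pow_succ_gaussianReal] at this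
    simpa [← sq, hab] using this
  · have hmean := hmoment a 1
    simp only [pow_one, integral_id_gaussianReal] at hmean
    rw [(iIndepFun_normalFamily.indepFun hab).integral_fun_mul_eq_mul_integral
      (measurable_pi_apply a).aestronglyMeasurable (measurable_pi_apply b).aestronglyMeasurable,
      hmean, zero_mul]

variable {n : ℕ} (N : ℕ) (h : Fin n → ℕ)

/-- The covariances of the Gaussian family `ζ^h ⋆ Q`. -/
noncomputable def pathCov (Q : Fin n → Fin n → ℝ) : Var n N → Var n N → ℝ :=
  fun p q => Q p.1 q.1 * if h p.1 = h q.1 ∧ p.2 = q.2 then 1 else 0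

theorem recoupledLaw_pathGaussian (Q : Fin n → Fin n → ℝ) :
    recoupledLaw normalFamily (pathGaussian N h) Q =
      multivariateGaussian 0 (Matrix.of (pathCov N h Q)) := by
  rw [recoupledLaw]
  congr 1
  ext p q
  simp [pathCov, pathGaussian, integral_mul_normalFamily, Fin.ext_iff]

theorem pathCov_add (A B : Fin n → Fin n → ℝ) :
    pathCov N h (A + B) = pathCov N h A + pathCov N h B :=
  funext₂ fun _ _ => add_mul _ _ _

theorem pathCov_smul (t : ℝ) (A : Fin n → Fin n → ℝ) :
    pathCov N h (t • A) = t • pathCov N h A :=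
  funext₂ fun _ _ => mul_assoc _ _ _

theorem continuous_pathCov : Continuous (pathCov N h) := by
  unfold pathCov
  fun_prop

theorem posSemidef_pathCov_partitionMatrix (Ψ : Setoid (Fin n)) :
    (Matrix.of (pathCov N h (partitionMatrix Ψ))).PosSemidef := by
  classical
  convert (Matrix.PosSemidef.one (R := ℝ)).submatrix
    fun p : Var n N => (Quotient.mk Ψ p.1, h p.1, p.2) using 1
  · ext p q
    simp [Matrix.one_apply, pathCov, partitionMatrix, Quotient.eq, ← ite_and, and_comm, and_assoc]

theorem posSemidef_pathCov_seqMatrix {m : ℕ} (Θ : Setoid (Fin n)) {τ : ℝ} (hτ : 0 ≤ τ)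
    (e : Fin m → Sym2 (Fin n)) {t : Fin m → ℝ} (ht : t ∈ scaledSimplex m τ) :
    (Matrix.of (pathCov N h (seqMatrix m Θ τ e t))).PosSemidef := by
  induction m generalizing Θ τ with
  | zero =>
    rw [seqMatrix, pathCov_smul]
    exact (posSemidef_pathCov_partitionMatrix N h Θ).smul hτ
  | succ m ih =>
    rw [mem_scaledSimplex_succ] at ht
    rw [seqMatrix, pathCov_add, pathCov_smul]
    exact ((posSemidef_pathCov_partitionMatrix N h Θ).smul (sub_nonneg.mpr ht.1.2.le)).add
      (ih (bondJoin {e 0} Θ) ht.1.1.le (Fin.tail e) ht.2)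

theorem isClosed_posSemidef {α : Type*} : IsClosed {A : Matrix α α ℝ | A.PosSemidef} := by
  simp only [Matrix.PosSemidef, Set.ofPred_and, Set.ofPred_forall, Finsupp.sum]
  exact (isClosed_eq (by fun_prop) continuous_id).inter
    (isClosed_iInter fun x => isClosed_le continuous_const (by fun_prop))

theorem sum_sum_sym2 {α M : Type*} [Fintype α] [AddCommMonoid M] (g : Sym2 α → M)
    (hg : ∀ e, e.IsDiag → g e = 0) : ∑ i, ∑ j, g s(i, j) = ∑ e, 2 • g e := by
  classical
  rw [← Fintype.sum_prod_type' (f := fun i j => g s(i, j)),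
    ← Finset.sum_fiberwise Finset.univ fun x : α × α => s(x.1, x.2)]
  refine Finset.sum_congr rfl fun e _ => ?_
  by_cases he : e.IsDiag
  · rw [hg e he, smul_zero]
    refine Finset.sum_eq_zero fun x hx => ?_
    rw [(Finset.mem_filter.mp hx).2, hg e he]
  · induction e using Sym2.ind with
    | _ i j =>
      rw [Sym2.mk_isDiag_iff] at he
      have hfiber : (Finset.univ.filter fun x : α × α => s(x.1, x.2) = s(i, j)) =
          {(i, j), (j, i)} := by
        ext x
        simp [Prod.ext_iff]
      rw [hfiber, Finset.sum_pair (by simp [he]), Sym2.eq_swap, two_smul]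

open Classical in
/-- The Kronecker factor of a bond. -/
noncomputable def bondDelta (e : Sym2 (Fin n)) : ℝ :=
  if ∀ i ∈ e, ∀ i' ∈ e, h i = h i' then 1 else 0

theorem bondDelta_mk (i j : Fin n) : bondDelta h s(i, j) = if h i = h j then 1 else 0 := by
  simp only [bondDelta, Sym2.mem_iff, forall_eq_or_imp, forall_eq, true_and, and_true,
    eq_comm (a := h j), and_self]

theorem laplacian_pathCov (Q : Fin n → Fin n → ℝ) (p : MvPolynomial (Var n N) ℝ) :
    laplacian (pathCov N h Q) p =
      ∑ i, ∑ i', (Q i i' / 2) • (bondDelta h s(i, i') • bondOperator N s(i, i')) p := by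
  rw [laplacian_apply, Fintype.sum_prod_type]
  refine Finset.sum_congr rfl fun i _ => ?_
  rw [Finset.sum_comm, Fintype.sum_prod_type]
  refine Finset.sum_congr rfl fun i' _ => ?_
  rw [Finset.sum_comm, bondDelta_mk]
  by_cases hh : h i = h i'
  · simp [pathCov, hh, bondOperator, secondDeriv, Finset.smul_sum, ite_div, ite_smul]
  · simp [pathCov, hh]

open Classical in
theorem partitionMatrix_sub_apply {Θ Ψ : Setoid (Fin n)} (hΘΨ : Θ ≤ Ψ) (i j : Fin n) :
    (partitionMatrix Ψ - partitionMatrix Θ) i j =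
      if InBlock Ψ s(i, j) ∧ ¬ InBlock Θ s(i, j) then 1 else 0 := by
  simp only [Pi.sub_apply, partitionMatrix, inBlock_mk]
  by_cases hij : Θ i j
  · simp [hij, hΘΨ hij]
  · simp [hij]

open Classical in
theorem laplacian_pathCov_partitionMatrix_sub {Θ Ψ : Setoid (Fin n)} (hΘΨ : Θ ≤ Ψ)
    (p : MvPolynomial (Var n N) ℝ) :
    laplacian (pathCov N h (partitionMatrix Ψ - partitionMatrix Θ)) p =
      ∑ e with InBlock Ψ e ∧ ¬ InBlock Θ e, (bondDelta h e • bondOperator N e) p := by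
  simp only [laplacian_pathCov, partitionMatrix_sub_apply hΘΨ]
  rw [sum_sum_sym2 fun e => ((if InBlock Ψ e ∧ ¬ InBlock Θ e then 1 else 0) / 2 : ℝ) •
    (bondDelta h e • bondOperator N e) p, Finset.sum_filter]
  · refine Finset.sum_congr rfl fun e _ => ?_
    split_ifs
    · module
    · simp
  · intro e he
    induction e using Sym2.ind with
    | _ i j =>
      rw [Sym2.mk_isDiag_iff] at he
      simp [inBlock_mk, he]

theorem hasBondDerivatives_wick :
    HasBondDerivatives (fun e => bondDelta h e • bondOperator N e)
      (fun Q p => wick (pathCov N h Q) p) where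
  continuous p := (continuous_wick p).comp (continuous_pathCov N h)
  hasDerivAt p A Θ Ψ hΘΨ t := by
    simp only [pathCov_add, pathCov_smul, Module.End.smul_def, ← map_sum,
      ← laplacian_pathCov_partitionMatrix_sub N h hΘΨ]
    exact hasDerivAt_wick p _ _ t

section TreeMeasure

variable (Θ : Setoid (Fin n)) (Γ : Finset (Sym2 (Fin n)))

theorem interpolationMatrix_eq_seqMatrix (e : Fin Γ.card ≃ Γ) :
    interpolationMatrix Θ Γ e = seqMatrix Γ.card Θ 1 fun α => e α := by
  funext t
  rw [seqMatrix_eq, interpolationMatrix, one_smul]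

theorem continuous_interpolationMatrix (e : Fin Γ.card ≃ Γ) :
    Continuous (interpolationMatrix Θ Γ e) := by
  rw [interpolationMatrix_eq_seqMatrix]
  exact (continuous_seqMatrix Γ.card Θ _).comp (by fun_prop : Continuous fun t => ((1 : ℝ), t))

theorem ae_posSemidef_pathCov_treeMeasure :
    ∀ᵐ Q ∂treeMeasure Θ Γ, (Matrix.of (pathCov N h Q)).PosSemidef := by
  refine ae_finsetSum_measure_iff.mpr fun e _ => ?_
  refine (ae_map_iff (continuous_interpolationMatrix Θ Γ e).measurable.aemeasurable
    (isClosed_posSemidef.preimage (continuous_pathCov N h)).measurableSet).mpr ?_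
  refine (ae_restrict_iff' (measurableSet_scaledSimplex _ _)).mpr (ae_of_all _ fun t ht => ?_)
  rw [interpolationMatrix_eq_seqMatrix]
  exact posSemidef_pathCov_seqMatrix N h Θ zero_le_one _ ht

theorem integral_treeMeasure {E : Type*} [NormedAddCommGroup E] [NormedSpace ℝ E]
    {F : (Fin n → Fin n → ℝ) → E} (hF : Continuous F) :
    ∫ Q, F Q ∂treeMeasure Θ Γ =
      ∑ e : Fin Γ.card ≃ Γ, ∫ t in scaledSimplex Γ.card 1,
        F (seqMatrix Γ.card Θ 1 (fun α => e α) t) := by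
  have hcont := continuous_interpolationMatrix Θ Γ
  have hint (e : Fin Γ.card ≃ Γ) :
      Integrable F ((volume.restrict (orderedSimplex Γ.card)).map (interpolationMatrix Θ Γ e)) :=
    (integrable_map_measure hF.aestronglyMeasurable (hcont e).measurable.aemeasurable).mpr
      (integrableOn_scaledSimplex (hF.comp (hcont e)))
  rw [treeMeasure, integral_finsetSum_measure fun e _ => hint e]
  refine Finset.sum_congr rfl fun e _ => ?_
  rw [integral_map (hcont e).measurable.aemeasurable hF.aestronglyMeasurable,
    interpolationMatrix_eq_seqMatrix]
  rfl

theorem integral_eval_treeMeasure (p : MvPolynomial (Var n N) ℝ) :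
    ∫ Q, (∫ x, MvPolynomial.eval (fun a => x a) p
        ∂(recoupledLaw normalFamily (pathGaussian N h) Q)) ∂(treeMeasure Θ Γ) =
      ∑ e : Fin Γ.card ≃ Γ, ∫ t in scaledSimplex Γ.card 1,
        wick (pathCov N h (seqMatrix Γ.card Θ 1 (fun α => e α) t)) p := by
  rw [← integral_treeMeasure Θ Γ ((hasBondDerivatives_wick N h).continuous p)]
  refine integral_congr_ae ?_
  filter_upwards [ae_posSemidef_pathCov_treeMeasure N h Θ Γ] with Q hQ
  rw [recoupledLaw_pathGaussian]
  exact integral_eval_multivariateGaussian hQ p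

end TreeMeasure

theorem seqProd_bondDelta_smul_bondOperator (Γ : Finset (Sym2 (Fin n))) (e : Fin Γ.card ≃ Γ) :
    seqProd (fun e => bondDelta h e • bondOperator N e) Γ.card (fun α => (e α : Sym2 (Fin n))) =
      (∏ b ∈ Γ, bondDelta h b) • treeOperator N Γ := by
  classical
  have hinj : Function.Injective fun α => (e α : Sym2 (Fin n)) :=
    Subtype.val_injective.comp e.injective
  rw [seqProd_smul, seqProd_bondOperator N hinj, image_univ_equiv_coe,
    ← Finset.prod_coe_sort Γ, ← e.prod_comp fun b : Γ => bondDelta h b]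

theorem expansionTerm_eq (θ : Equiv.Perm (Fin n)) (Γ : Finset (Sym2 (Fin n))) :
    expansionTerm N θ Γ h = ∑ e : Fin Γ.card ≃ Γ, ∫ t in scaledSimplex Γ.card 1,
      wick (pathCov N h (seqMatrix Γ.card (orbitPartition θ) 1 (fun α => e α) t))
        (seqProd (fun e => bondDelta h e • bondOperator N e) Γ.card
            (fun α => (e α : Sym2 (Fin n))) • pathPolynomial N θ h) := by
  rw [expansionTerm, integral_eval_treeMeasure, Finset.mul_sum]
  refine Finset.sum_congr rfl fun e _ => ?_
  rw [← integral_const_mul, seqProd_bondDelta_smul_bondOperator]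
  simp only [smul_assoc, map_smul, smul_eq_mul, Module.End.smul_def]
  rfl

open Classical in
theorem sum_trees_expansionTerm (hn : 0 < n) (θ : Equiv.Perm (Fin n)) :
    ∑ Γ ∈ trees (orbitPartition θ), expansionTerm N θ Γ h =
      ∑ Ψ with orbitPartition θ ≤ Ψ,
        moebiusWeight Ψ * wick (pathCov N h (partitionMatrix Ψ)) (pathPolynomial N θ h) := by
  have : Nonempty (Fin n) := ⟨⟨0, hn⟩⟩
  obtain ⟨m, hm⟩ := Nat.exists_eq_add_of_le' (blockCount_pos (orbitPartition θ))
  have htree := (hasBondDerivatives_wick N h).sum_isTreeSeq_integral hm 0 zero_le_one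
    (pathPolynomial N θ h)
  simp only [zero_add, one_smul, smul_eq_mul] at htree
  rw [← htree, ← sum_trees_sum_equiv hm fun m e => ∫ t in scaledSimplex m 1,
    wick (pathCov N h (seqMatrix m (orbitPartition θ) 1 e t))
      (seqProd (fun e => bondDelta h e • bondOperator N e) m e • pathPolynomial N θ h)]
  simp only [expansionTerm_eq]

end Recoupling

/-! ### Vanishing of the terms of the expansion -/

section Vanishing

open MvPolynomial

variable {n N : ℕ} {θ : Equiv.Perm (Fin n)} {h : Fin n → ℕ} {i : Fin n} {e : Sym2 (Fin n)}
  {Γ : Finset (Sym2 (Fin n))} {p : MvPolynomial (Var n N) ℝ} {d : ℕ}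

theorem disjoint_stepSet (θ : Equiv.Perm (Fin n)) (h : Fin n → ℕ) {ε ε' : ℤ} (hε : ε ≠ ε') :
    Disjoint (stepSet θ h ε) (stepSet θ h ε') := by
  rw [Finset.disjoint_left]
  intro i hi hi'
  simp only [stepSet, Finset.mem_filter_univ] at hi hi'
  omega

theorem pathPolynomial_mem_lowWeight {w : Var n N → ℕ} {b₀ b₁ : Fin n → ℕ}
    (h₀ : ∀ i ∈ stepSet θ h 0, w (i, 0) ≤ b₀ i)
    (h₁ : ∀ i ∈ stepSet θ h 1, ∀ j : Fin (2 * N + 1), 1 ≤ j.val → w (i, j) ≤ b₁ i) :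
    pathPolynomial N θ h ∈
      lowWeight w (∑ i ∈ stepSet θ h 0, b₀ i + ∑ i ∈ stepSet θ h 1, 2 * b₁ i + 1) := by
  refine mul_mem_lowWeight (prod_mem_lowWeight fun i hi => ?_) (prod_mem_lowWeight fun i hi => ?_)
  · exact lowWeight_mono (Nat.succ_le_succ (h₀ i hi)) (X_mem_lowWeight _)
  · refine Submodule.sum_mem _ fun j hj => ?_
    rw [← smul_eq_C_mul, sq]
    refine Submodule.smul_mem _ _
      (lowWeight_mono ?_ (mul_mem_lowWeight (X_mem_lowWeight _) (X_mem_lowWeight _)))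
    have := h₁ i hi j (Finset.mem_filter.mp hj).2.1
    omega

theorem mem_stepSet_of_pderiv_pathPolynomial_ne_zero {j : Fin (2 * N + 1)}
    (hp : pderiv (i, j) (pathPolynomial N θ h) ≠ 0) :
    i ∈ stepSet θ h 0 ∧ j = 0 ∨ i ∈ stepSet θ h 1 ∧ j ≠ 0 := by
  by_contra! hij
  have hlow := pathPolynomial_mem_lowWeight (N := N) (θ := θ) (h := h)
    (w := Pi.single (i, j) 1) (b₀ := 0) (b₁ := 0)
    (fun k hk => by
      refine (Pi.single_eq_of_ne ?_ 1).le
      rintro ⟨⟩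
      exact hij.1 hk rfl)
    (fun k hk l hl => by
      refine (Pi.single_eq_of_ne ?_ 1).le
      rintro ⟨⟩
      simp [hij.2 hk] at hl)
  refine hp (eq_zero_of_mem_lowWeight_zero (lowWeight_mono ?_ (pderiv_mem_lowWeight hlow (i, j))))
  simp

theorem subset_stepSet_of_bondOperator_pathPolynomial_ne_zero
    (he : bondOperator N e (pathPolynomial N θ h) ≠ 0) :
    (∀ i ∈ e, i ∈ stepSet θ h 0) ∨ ∀ i ∈ e, i ∈ stepSet θ h 1 := by
  induction e using Sym2.ind with
  | _ i i' =>
    rw [bondOperator, Sym2.lift_mk, LinearMap.sum_apply] at he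
    obtain ⟨j, -, hj⟩ := Finset.exists_ne_zero_of_sum_ne_zero he
    have hi' : pderiv (i', j) (pathPolynomial N θ h) ≠ 0 := fun hzero =>
      hj (show pderiv (i, j) (pderiv (i', j) _) = 0 by rw [hzero, map_zero])
    have hi : pderiv (i, j) (pathPolynomial N θ h) ≠ 0 := fun hzero =>
      hj (show pderiv (i, j) (pderiv (i', j) _) = 0 by
        rw [pderiv_pderiv_comm, hzero, map_zero])
    simp only [Sym2.mem_iff, forall_eq_or_imp, forall_eq]
    rcases mem_stepSet_of_pderiv_pathPolynomial_ne_zero hi with ⟨hi₀, hj₀⟩ | ⟨hi₁, hj₁⟩ <;>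
      rcases mem_stepSet_of_pderiv_pathPolynomial_ne_zero hi' with ⟨hi'₀, hj₀'⟩ | ⟨hi'₁, hj₁'⟩
    · exact Or.inl ⟨hi₀, hi'₀⟩
    · exact absurd hj₀ hj₁'
    · exact absurd hj₀' hj₁
    · exact Or.inr ⟨hi₁, hi'₁⟩

theorem bondOperator_ne_zero_of_treeOperator_ne_zero (hp : treeOperator N Γ p ≠ 0) (he : e ∈ Γ) :
    bondOperator N e p ≠ 0 := by
  classical
  rw [← Finset.insert_erase he, treeOperator_insert N (Finset.notMem_erase e Γ)] at hp
  exact fun hzero => hp (by rw [Module.End.mul_apply, hzero, map_zero])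

/-- The weight counting the variables of the row `i`. -/
def rowWeight (i : Fin n) (a : Var n N) : ℕ := if a.1 = i then 1 else 0

theorem bondOperator_mem_lowWeight (hp : p ∈ lowWeight (rowWeight i) d) :
    bondOperator N e p ∈ lowWeight (rowWeight i) (d - if i ∈ e then 1 else 0) := by
  induction e using Sym2.ind with
  | _ k l =>
    rw [bondOperator, Sym2.lift_mk, LinearMap.sum_apply]
    refine Submodule.sum_mem _ fun j _ => lowWeight_mono ?_
      (pderiv_mem_lowWeight (pderiv_mem_lowWeight hp (l, j)) (k, j))
    simp only [rowWeight, Sym2.mem_iff]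
    grind

theorem treeOperator_mem_lowWeight (Γ : Finset (Sym2 (Fin n)))
    (hp : p ∈ lowWeight (rowWeight i) d) :
    treeOperator N Γ p ∈ lowWeight (rowWeight i) (d - (Γ.filter fun e => i ∈ e).card) := by
  classical
  induction Γ using Finset.induction_on generalizing d p with
  | empty => exact hp
  | insert e Γ he ih =>
    rw [treeOperator_insert N he, Module.End.mul_apply]
    refine lowWeight_mono (le_of_eq ?_) (ih (bondOperator_mem_lowWeight hp))
    rw [Finset.filter_insert]
    split_ifs
    · rw [Finset.card_insert_of_notMem fun h => he (Finset.mem_filter.mp h).1]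
      omega
    · rfl

theorem card_filter_mem_le_of_treeOperator_ne_zero (hp : p ∈ lowWeight (rowWeight i) (d + 1))
    (hΓ : treeOperator N Γ p ≠ 0) : (Γ.filter fun e => i ∈ e).card ≤ d := by
  by_contra! hcard
  exact hΓ (eq_zero_of_mem_lowWeight_zero
    (lowWeight_mono (Nat.sub_eq_zero_of_le hcard).le (treeOperator_mem_lowWeight Γ hp)))

theorem pathPolynomial_mem_lowWeight_rowWeight (i : Fin n) :
    pathPolynomial N θ h ∈ lowWeight (rowWeight i)
      ((if i ∈ stepSet θ h 0 then 1 else 0) + (if i ∈ stepSet θ h 1 then 2 else 0) + 1) := by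
  convert pathPolynomial_mem_lowWeight (N := N) (θ := θ) (h := h) (w := rowWeight i)
    (b₀ := fun a => if a = i then 1 else 0) (b₁ := fun a => if a = i then 1 else 0)
    (fun a _ => le_rfl) (fun a _ j _ => le_rfl) using 3
  simp

theorem treeOperator_ne_zero_of_expansionTerm_ne_zero (hne : expansionTerm N θ Γ h ≠ 0) :
    treeOperator N Γ (pathPolynomial N θ h) ≠ 0 :=
  fun hzero => hne (by simp [expansionTerm, hzero])

theorem eq_of_expansionTerm_ne_zero (hne : expansionTerm N θ Γ h ≠ 0) (he : e ∈ Γ) :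
    ∀ i ∈ e, ∀ i' ∈ e, h i = h i' := by
  by_contra hconst
  exact hne (by rw [expansionTerm, Finset.prod_eq_zero he (if_neg hconst), zero_mul])

theorem card_filter_mem_le_of_expansionTerm_ne_zero (hne : expansionTerm N θ Γ h ≠ 0)
    (i : Fin n) : (Γ.filter fun e => i ∈ e).card ≤
      (if i ∈ stepSet θ h 0 then 1 else 0) + if i ∈ stepSet θ h 1 then 2 else 0 :=
  card_filter_mem_le_of_treeOperator_ne_zero (pathPolynomial_mem_lowWeight_rowWeight i)
    (treeOperator_ne_zero_of_expansionTerm_ne_zero hne)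

theorem conditions_of_expansionTerm_ne_zero (hne : expansionTerm N θ Γ h ≠ 0) :
    (∀ e ∈ Γ, ∀ i ∈ e, ∀ i' ∈ e, h i = h i') ∧
      (∀ e ∈ Γ, (∀ i ∈ e, i ∈ stepSet θ h 0) ∨ ∀ i ∈ e, i ∈ stepSet θ h 1) ∧
      (∀ i ∈ stepSet θ h 0, (Γ.filter fun e => i ∈ e).card ≤ 1) ∧
      ∀ i : Fin n, (Γ.filter fun e => i ∈ e).card ≤ 2 := by
  have htree := treeOperator_ne_zero_of_expansionTerm_ne_zero hne
  have hcard := card_filter_mem_le_of_expansionTerm_ne_zero hne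
  have hdisj {i : Fin n} (hi : i ∈ stepSet θ h 0) : i ∉ stepSet θ h 1 :=
    Finset.disjoint_left.mp (disjoint_stepSet θ h zero_ne_one) hi
  refine ⟨fun e he => eq_of_expansionTerm_ne_zero hne he, fun e he =>
    subset_stepSet_of_bondOperator_pathPolynomial_ne_zero
      (bondOperator_ne_zero_of_treeOperator_ne_zero htree he), fun i hi => ?_, fun i => ?_⟩
  · simpa [hi, hdisj hi] using hcard i
  · exact (hcard i).trans (by grind)

end Vanishing

/-! ### Traces of powers and orbits -/

section Walks

open Matrix

variable {R ν : Type*} [CommSemiring R] [Fintype ν] [DecidableEq ν]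

theorem sum_prod_walk (M : Matrix ν ν R) (k : ℕ) (F : ν → ν → R) :
    ∑ g : Fin (k + 1) → ν, (∏ s : Fin k, M (g s.castSucc) (g s.succ)) * F (g 0) (g (Fin.last k)) =
      ∑ a, ∑ b, (M ^ k) a b * F a b := by
  induction k generalizing F with
  | zero =>
    rw [← (Equiv.funUnique (Fin 1) ν).symm.sum_comp]
    simp [Matrix.one_apply]
  | succ k ih =>
    rw [← (Fin.snocEquiv fun _ : Fin (k + 2) => ν).sum_comp, Fintype.sum_prod_type,
      Finset.sum_comm]
    refine Eq.trans ?_ ((ih fun a c => ∑ b, M c b * F a b).trans ?_)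
    · refine Finset.sum_congr rfl fun g _ => ?_
      rw [Finset.mul_sum]
      refine Finset.sum_congr rfl fun b _ => ?_
      rw [Fin.prod_univ_castSucc, mul_assoc]
      simp only [Fin.snocEquiv_apply, Fin.snoc_castSucc, Fin.succ_last, Fin.snoc_last,
        ← Fin.castSucc_succ, Fin.snoc_apply_zero]
    · refine Finset.sum_congr rfl fun a _ => ?_
      simp only [pow_succ, Matrix.mul_apply, Finset.mul_sum, Finset.sum_mul]
      rw [Finset.sum_comm]
      simp only [mul_assoc]

theorem trace_pow_succ_eq_sum (M : Matrix ν ν R) (k : ℕ) :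
    trace (M ^ (k + 1)) = ∑ g : Fin (k + 1) → ν, ∏ s, M (g s) (g (s + 1)) :=
  calc trace (M ^ (k + 1))
      = ∑ a, ∑ b, (M ^ k) a b * M b a := by simp [trace, pow_succ, Matrix.mul_apply]
    _ = ∑ g : Fin (k + 1) → ν,
          (∏ s : Fin k, M (g s.castSucc) (g s.succ)) * M (g (Fin.last k)) (g 0) :=
      (sum_prod_walk M k fun a b => M b a).symm
    _ = ∑ g : Fin (k + 1) → ν, ∏ s, M (g s) (g (s + 1)) :=
      Finset.sum_congr rfl fun g _ => by simp [Fin.prod_univ_castSucc, Fin.coeSucc_eq_succ]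

theorem exists_equiv_fin_of_isCycleOn {β : Type*} [Fintype β] {σ : Equiv.Perm β}
    (hσ : σ.IsCycleOn (Finset.univ : Finset β)) {k : ℕ} (hk : Fintype.card β = k + 1) :
    ∃ e : Fin (k + 1) ≃ β, ∀ s, σ (e s) = e (s + 1) := by
  obtain ⟨x⟩ : Nonempty β := Fintype.card_pos_iff.mp (by omega)
  let f : Fin (k + 1) → β := fun r => (σ ^ (r : ℕ)) x
  have hf : Function.Bijective f := by
    refine (Fintype.bijective_iff_surjective_and_card f).mpr ⟨fun y => ?_, by simp [hk]⟩
    obtain ⟨m, hm, hmy⟩ := hσ.exists_pow_eq (Finset.mem_univ x) (Finset.mem_univ y)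
    exact ⟨⟨m, by rwa [Finset.card_univ, hk] at hm⟩, hmy⟩
  refine ⟨Equiv.ofBijective f hf, fun r => ?_⟩
  simp only [Equiv.ofBijective_apply, f]
  rw [← Equiv.Perm.mul_apply, ← pow_succ']
  induction r using Fin.lastCases with
  | last =>
    have hperiod := hσ.pow_card_apply (Finset.mem_univ x)
    rw [Finset.card_univ, hk] at hperiod
    simpa using hperiod
  | cast r => simp

theorem trace_pow_card_of_isCycleOn (M : Matrix ν ν R) {β : Type*} [Fintype β] [DecidableEq β]
    [Nonempty β] {σ : Equiv.Perm β} (hσ : σ.IsCycleOn (Finset.univ : Finset β)) :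
    trace (M ^ Fintype.card β) = ∑ g : β → ν, ∏ i, M (g i) (g (σ i)) := by
  obtain ⟨k, hk⟩ := Nat.exists_eq_add_of_le' (Fintype.card_pos (α := β))
  obtain ⟨e, he⟩ := exists_equiv_fin_of_isCycleOn hσ hk
  rw [hk, trace_pow_succ_eq_sum, ← (e.arrowCongr (Equiv.refl ν)).sum_comp]
  refine Finset.sum_congr rfl fun g _ => ?_
  rw [← e.prod_comp]
  simp [he]

end Walks

section Orbits

open Equiv.Perm (SameCycle)

variable {α : Type*}

/-- The points of an orbit `O` of `θ`, as a type. -/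
abbrev Orbit (θ : Equiv.Perm α) (O : Quotient (SameCycle.setoid θ)) : Type _ :=
  {i : α // Quotient.mk _ i = O}

variable {θ : Equiv.Perm α} {O : Quotient (SameCycle.setoid θ)}

theorem mk_apply_eq (θ : Equiv.Perm α) (i : α) :
    Quotient.mk (SameCycle.setoid θ) (θ i) = Quotient.mk (SameCycle.setoid θ) i :=
  Quotient.sound (Equiv.Perm.sameCycle_apply_left.mpr (SameCycle.refl θ i))

/-- The restriction of `θ` to one of its orbits. -/
def orbitPerm (θ : Equiv.Perm α) (O : Quotient (SameCycle.setoid θ)) : Equiv.Perm (Orbit θ O) :=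
  θ.subtypePerm fun i => by rw [mk_apply_eq]

instance nonempty_orbit : Nonempty (Orbit θ O) := ⟨O.out, Quotient.out_eq O⟩

theorem isCycleOn_orbitPerm [Fintype (Orbit θ O)] :
    (orbitPerm θ O).IsCycleOn (Finset.univ : Finset (Orbit θ O)) := by
  rw [Finset.coe_univ]
  refine ⟨Set.bijOn_univ.mpr (orbitPerm θ O).bijective, fun i _ j _ => ?_⟩
  exact Equiv.Perm.sameCycle_subtypePerm.mpr (Quotient.exact (i.2.trans j.2.symm))

theorem card_orbit_mk_of_ne [Fintype α] [DecidableEq α] {x : α} (hx : θ x ≠ x) :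
    Nat.card (Orbit θ (Quotient.mk _ x)) = (θ.cycleOf x).support.card :=
  Nat.subtype_card _ fun y => by
    rw [Equiv.Perm.mem_support_cycleOf_iff' hx, Quotient.eq]
    exact Equiv.Perm.sameCycle_comm

theorem card_orbit_mk_of_eq {x : α} (hx : θ x = x) : Nat.card (Orbit θ (Quotient.mk _ x)) = 1 :=
  Nat.card_eq_one_iff_unique.mpr
    ⟨⟨fun a b => Subtype.ext <| ((Quotient.exact a.2).symm.eq_of_left hx).symm.trans
      ((Quotient.exact b.2).symm.eq_of_left hx)⟩, inferInstance⟩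

theorem sum_card_orbit [Fintype α] [Fintype (Quotient (SameCycle.setoid θ))] :
    ∑ O : Quotient (SameCycle.setoid θ), Nat.card (Orbit θ O) = Fintype.card α := by
  classical
  rw [← Fintype.card_congr (Equiv.sigmaFiberEquiv (Quotient.mk (SameCycle.setoid θ))),
    Fintype.card_sigma]
  simp only [Nat.card_eq_fintype_card]

section Moved

variable [DecidableEq α]

/-- The orbits of `θ` with more than one point. -/
noncomputable def movedOrbits (θ : Equiv.Perm α) [Fintype (Quotient (SameCycle.setoid θ))] :
    Finset (Quotient (SameCycle.setoid θ)) :=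
  {O | θ O.out ≠ O.out}

variable [Fintype (Quotient (SameCycle.setoid θ))]

theorem mem_movedOrbits : O ∈ movedOrbits θ ↔ θ O.out ≠ O.out := by simp [movedOrbits]

theorem map_card_compl_movedOrbits [DecidableEq (Quotient (SameCycle.setoid θ))] :
    (movedOrbits θ)ᶜ.val.map (fun O => Nat.card (Orbit θ O)) =
      Multiset.replicate (movedOrbits θ)ᶜ.card 1 := by
  refine Multiset.eq_replicate.mpr ⟨Multiset.card_map _ _, fun c hc => ?_⟩
  obtain ⟨O, hO, rfl⟩ := Multiset.mem_map.mp hc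
  rw [Finset.mem_val, Finset.mem_compl, mem_movedOrbits, not_not] at hO
  simpa using card_orbit_mk_of_eq hO

variable [Fintype α]

theorem image_cycleOf_out_movedOrbits :
    (movedOrbits θ).image (fun O => θ.cycleOf O.out) = θ.cycleFactorsFinset := by
  ext c
  simp only [Finset.mem_image, mem_movedOrbits]
  constructor
  · rintro ⟨O, hO, rfl⟩
    exact Equiv.Perm.cycleOf_mem_cycleFactorsFinset_iff.mpr (Equiv.Perm.mem_support.mpr hO)
  · intro hc
    obtain ⟨x, hx⟩ := (Equiv.Perm.mem_cycleFactorsFinset_iff.mp hc).1.nonempty_support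
    have hxθ : θ x ≠ x :=
      Equiv.Perm.mem_support.mp (Equiv.Perm.mem_cycleFactorsFinset_support_le hc hx)
    have hsame : θ.SameCycle (Quotient.mk (SameCycle.setoid θ) x).out x :=
      Quotient.exact (Quotient.out_eq (Quotient.mk (SameCycle.setoid θ) x))
    exact ⟨Quotient.mk _ x, fun h => hxθ (hsame.apply_eq_self_iff.mp h),
      by rw [Equiv.Perm.cycle_is_cycleOf hx hc, hsame.cycleOf_eq]⟩

theorem injOn_cycleOf_out_movedOrbits :
    Set.InjOn (fun O : Quotient (SameCycle.setoid θ) => θ.cycleOf O.out) (movedOrbits θ) := by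
  intro O hO O' hO' h
  rw [Finset.mem_coe, mem_movedOrbits, ← Equiv.Perm.mem_support] at hO hO'
  rw [← Quotient.out_eq O, ← Quotient.out_eq O']
  exact Quotient.sound ((Equiv.Perm.sameCycle_iff_cycleOf_eq_of_mem_support hO hO').mpr h)

theorem map_card_movedOrbits :
    (movedOrbits θ).val.map (fun O => Nat.card (Orbit θ O)) = θ.cycleType := by
  rw [Equiv.Perm.cycleType_def, ← image_cycleOf_out_movedOrbits,
    Finset.image_val_of_injOn injOn_cycleOf_out_movedOrbits, Multiset.map_map]
  refine Multiset.map_congr rfl fun O hO => ?_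
  simpa using card_orbit_mk_of_ne (mem_movedOrbits.mp (Finset.mem_val.mp hO))

theorem map_card_orbit (θ : Equiv.Perm α) [Fintype (Quotient (SameCycle.setoid θ))] :
    (Finset.univ : Finset (Quotient (SameCycle.setoid θ))).val.map
      (fun O => Nat.card (Orbit θ O)) = θ.partition.parts := by
  classical
  have hsplit : (Finset.univ : Finset (Quotient (SameCycle.setoid θ))).val.map
      (fun O => Nat.card (Orbit θ O)) =
        θ.cycleType + Multiset.replicate (movedOrbits θ)ᶜ.card 1 := by
    rw [← map_card_movedOrbits, ← map_card_compl_movedOrbits, ← Multiset.map_add,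
      ← Finset.disjUnion_val _ _ disjoint_compl_right, Finset.disjUnion_eq_union,
      Finset.union_compl]
  have hsum : θ.support.card + (movedOrbits θ)ᶜ.card = Fintype.card α := by
    have := congrArg Multiset.sum hsplit
    rwa [← Finset.sum_eq_multiset_sum, sum_card_orbit, Multiset.sum_add, Multiset.sum_replicate,
      Equiv.Perm.sum_cycleType, smul_eq_mul, mul_one, eq_comm] at this
  rw [hsplit, Equiv.Perm.parts_partition, ← hsum, Nat.add_sub_cancel_left]

end Moved

theorem exists_equiv_of_map_univ_eq {α β γ : Type*} [Fintype α] [Fintype β] {f : α → γ} {g : β → γ}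
    (h : (Finset.univ : Finset α).val.map f = (Finset.univ : Finset β).val.map g) :
    ∃ e : α ≃ β, ∀ a, g (e a) = f a := by
  classical
  have hc (c : γ) : Fintype.card {a // f a = c} = Fintype.card {b // g b = c} := by
    have := congrArg (Multiset.count c) h
    rw [Multiset.count_map, Multiset.count_map] at this
    rw [Fintype.card_subtype, Fintype.card_subtype]
    simpa [eq_comm, Finset.card, Finset.filter] using this
  exact ⟨Equiv.ofFiberEquiv fun c => Fintype.equivOfCardEq (hc c), Equiv.ofFiberEquiv_map _⟩

theorem exists_equiv_orbits [Fintype α] [DecidableEq α] {l : List ℕ}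
    (hl : θ.partition.parts = l) :
    ∃ b : Fin l.length ≃ Quotient (SameCycle.setoid θ),
      ∀ i, Nat.card (Orbit θ (b i)) = l.get i := by
  have : Fintype (Quotient (SameCycle.setoid θ)) := Fintype.ofFinite _
  refine exists_equiv_of_map_univ_eq (g := fun O => Nat.card (Orbit θ O)) ?_
  rw [map_card_orbit, hl]
  exact (Fin.univ_val_map _).trans (congrArg _ (List.ofFn_get _))

end Orbits

/-! ### Cumulants as sums over coarsenings of a partition -/

section Coarsenings

variable {ι α : Type*}

section Finpartition

variable [Fintype ι] [DecidableEq ι]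

theorem parts_eq_image_part (π : Finpartition (Finset.univ : Finset ι)) :
    π.parts = Finset.univ.image π.part := by
  ext A
  rw [Finset.mem_image]
  constructor
  · intro hA
    obtain ⟨a, _, h⟩ := π.part_surjOn hA
    exact ⟨a, Finset.mem_univ a, h⟩
  · rintro ⟨a, ha, rfl⟩
    exact π.part_mem.mpr ha

open Classical in
/-- The correspondence between the two encodings of set partitions of a finite type, as families of
blocks and as equivalence relations. -/
noncomputable def setoidEquivFinpartition : Setoid ι ≃ Finpartition (Finset.univ : Finset ι) where
  toFun Φ := Finpartition.ofSetoid Φ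
  invFun π := Setoid.ker π.part
  left_inv Φ := by
    ext x y
    rw [Setoid.ker_def, eq_comm, ← Finpartition.mem_part_iff_part_eq_part _ (Finset.mem_univ _)
      (Finset.mem_univ _), Finpartition.mem_part_ofSetoid_iff_rel]
  right_inv π := by
    refine Finpartition.ext ?_
    rw [parts_eq_image_part, parts_eq_image_part π]
    refine Finset.image_congr fun a _ => ?_
    ext c
    rw [Finpartition.mem_part_ofSetoid_iff_rel, Setoid.ker_def, eq_comm,
      π.mem_part_iff_part_eq_part (Finset.mem_univ _) (Finset.mem_univ _)]

end Finpartition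

/-- The block `B` of a set partition as a finite set. -/
noncomputable def blockFinset [Fintype ι] {Φ : Setoid ι} (B : Quotient Φ) : Finset ι :=
  open Classical in {i | Quotient.mk Φ i = B}

theorem mem_blockFinset [Fintype ι] {Φ : Setoid ι} {B : Quotient Φ} {i : ι} :
    i ∈ blockFinset B ↔ Quotient.mk Φ i = B := by simp [blockFinset]

theorem injective_blockFinset [Fintype ι] (Φ : Setoid ι) :
    Function.Injective (blockFinset : Quotient Φ → Finset ι) := by
  intro B B' h
  induction B using Quotient.inductionOn with
  | _ a => exact mem_blockFinset.mp (h ▸ mem_blockFinset.mpr rfl)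

theorem parts_setoidEquivFinpartition [Fintype ι] [DecidableEq ι] (Φ : Setoid ι)
    [Fintype (Quotient Φ)] :
    (setoidEquivFinpartition Φ).parts =
      Finset.univ.image (blockFinset : Quotient Φ → Finset ι) := by
  classical
  have hpart (a : ι) :
      (setoidEquivFinpartition Φ).part a = blockFinset (Quotient.mk Φ a) := by
    ext c
    rw [mem_blockFinset, Quotient.eq, Setoid.comm']
    exact Finpartition.mem_part_ofSetoid_iff_rel
  ext A
  simp only [parts_eq_image_part, hpart, Finset.mem_image, Finset.mem_univ, true_and,
    Quotient.exists]

open Classical in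
theorem jointCumulant_eq_sum_setoid {Ω : Type*} [MeasurableSpace Ω] (P : Measure Ω) [Fintype ι]
    [DecidableEq ι] (X : ι → Ω → ℝ) :
    jointCumulant P X = ∑ Φ : Setoid ι, moebiusWeight Φ *
      ∏ B : Quotient Φ, ∫ ω, ∏ i with Quotient.mk Φ i = B, X i ω ∂P := by
  rw [jointCumulant, ← setoidEquivFinpartition.sum_comp]
  refine Finset.sum_congr rfl fun Φ _ => ?_
  rw [parts_setoidEquivFinpartition, Finset.card_image_of_injective _ (injective_blockFinset Φ),
    Finset.prod_image (injective_blockFinset Φ).injOn, moebiusWeight, blockCount,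
    Nat.card_eq_fintype_card, Finset.card_univ]
  simp only [blockFinset]

theorem mk_out_eq {Θ Ψ : Setoid α} (h : Θ ≤ Ψ) (x : α) :
    Quotient.mk Ψ (Quotient.mk Θ x).out = Quotient.mk Ψ x :=
  Quotient.sound (h (Quotient.mk_out x))

/-- The coarsenings of `Θ` are the set partitions of its set of blocks, here labelled by `b`. -/
noncomputable def coarseningEquiv {Θ : Setoid α} (b : ι ≃ Quotient Θ) :
    {Ψ // Θ ≤ Ψ} ≃ Setoid ι where
  toFun Ψ := Setoid.comap (fun i => (b i).out) Ψ.1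
  invFun Φ := ⟨Setoid.comap (fun x => b.symm (Quotient.mk Θ x)) Φ, fun x y hxy => by
    rw [Setoid.comap_rel, Quotient.sound hxy]⟩
  left_inv Ψ := Subtype.ext <| Setoid.ext fun x y => by
    simp only [Setoid.comap_rel, Equiv.apply_symm_apply, ← Quotient.eq, mk_out_eq Ψ.2]
  right_inv Φ := Setoid.ext fun i j => by
    simp only [Setoid.comap_rel, Quotient.out_eq, Equiv.symm_apply_apply]

/-- The blocks of a coarsening `Ψ` of `Θ` correspond to those of `coarseningEquiv b Ψ`. -/
noncomputable def quotientCoarseningEquiv {Θ : Setoid α} (b : ι ≃ Quotient Θ) (Ψ : {Ψ // Θ ≤ Ψ}) :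
    Quotient (coarseningEquiv b Ψ) ≃ Quotient Ψ.1 :=
  Equiv.ofBijective (Quotient.map' (fun i => (b i).out) fun _ _ => id) <| by
    constructor
    · rintro ⟨i⟩ ⟨j⟩ h
      exact Quotient.sound (Quotient.exact (s := Ψ.1) h)
    · rintro ⟨x⟩
      refine ⟨Quotient.mk _ (b.symm (Quotient.mk Θ x)), Quotient.sound (s := Ψ.1) ?_⟩
      change Ψ.1 (b (b.symm (Quotient.mk Θ x))).out x
      rw [b.apply_symm_apply]
      exact Ψ.2 (Quotient.mk_out x)

theorem moebiusWeight_coarseningEquiv {Θ : Setoid α} (b : ι ≃ Quotient Θ) (Ψ : {Ψ // Θ ≤ Ψ}) :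
    moebiusWeight (coarseningEquiv b Ψ) = moebiusWeight Ψ.1 := by
  simp only [moebiusWeight, blockCount, Nat.card_congr (quotientCoarseningEquiv b Ψ)]

open Classical in
theorem jointCumulant_eq_sum_coarsenings {Ω : Type*} [MeasurableSpace Ω] (P : Measure Ω)
    [Fintype ι] [DecidableEq ι] (X : ι → Ω → ℝ) [Fintype α] (Θ : Setoid α) (b : ι ≃ Quotient Θ) :
    jointCumulant P X = ∑ Ψ with Θ ≤ Ψ, moebiusWeight Ψ *
      ∏ B : Quotient Ψ, ∫ ω, ∏ i with Quotient.mk Ψ (b i).out = B, X i ω ∂P := by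
  rw [jointCumulant_eq_sum_setoid, ← (coarseningEquiv b).sum_comp, Finset.sum_subtype _
    (p := fun Ψ => Θ ≤ Ψ) (by simp)]
  refine Finset.sum_congr rfl fun Ψ _ => ?_
  rw [moebiusWeight_coarseningEquiv, ← (quotientCoarseningEquiv b Ψ).prod_comp]
  refine congrArg _ (Finset.prod_congr rfl fun B _ => ?_)
  have hblock (i : ι) : Quotient.mk Ψ.1 (b i).out = quotientCoarseningEquiv b Ψ B ↔
      Quotient.mk (coarseningEquiv b Ψ) i = B :=
    (quotientCoarseningEquiv b Ψ).apply_eq_iff_eq (x := Quotient.mk (coarseningEquiv b Ψ) i)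
  simp only [hblock]

end Coarsenings

/-! ### Expansion of the cumulant over Motzkin paths -/

section PathExpansion

open MvPolynomial
open Equiv.Perm (SameCycle)

variable {n N : ℕ}

/-- The indices `(i, k, j)` of copies, one for each `i`, of the variables `ξ_{k+1, j}` in the
entries of the tridiagonal model. -/
abbrev LevelVar (n N : ℕ) : Type := Fin n × Fin N × Fin (2 * N + 1)

/-- The entries of the tridiagonal model as polynomials in the variables of the `i`-th copy. -/
noncomputable def entryPoly (i : Fin n) (k k' : Fin N) : MvPolynomial (LevelVar n N) ℝ :=
  if (k' : ℕ) = k then X (i, k, 0)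
  else if (k' : ℕ) = k + 1 then
    ∑ j : Fin (2 * N + 1) with 1 ≤ j.val ∧ j.val ≤ 2 * ((k : ℕ) + 1),
      C (1 / 2 : ℝ) * X (i, k, j) ^ 2
  else if (k : ℕ) = k' + 1 then 1
  else 0

/-- The Gaussian family in which all copies take the same values. -/
def levelGaussian (a : LevelVar n N) (ξ : ℕ × ℕ → ℝ) : ℝ := ξ ((a.2.1 : ℕ) + 1, a.2.2)

theorem eval_entryPoly (i : Fin n) (k k' : Fin N) (ξ : ℕ × ℕ → ℝ) :
    eval (fun a => levelGaussian a ξ) (entryPoly i k k') = triModel N ξ k k' := by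
  simp only [entryPoly, triModel, Matrix.of_apply]
  split_ifs with hdiag hup
  · simp [levelGaussian]
  · simp only [map_sum, map_mul, eval_C, map_pow, eval_X, levelGaussian]
    refine Finset.sum_bij (fun j _ => j.val) (fun j hj => by simpa using hj)
      (fun j _ j' _ h => Fin.ext h) (fun l hl => ?_) fun j _ => by ring
    rw [Finset.mem_Icc] at hl
    exact ⟨⟨l, by omega⟩, by simpa using hl, rfl⟩
  · exact map_one _
  · exact map_zero _

theorem fst_eq_of_mem_vars_entryPoly {i : Fin n} {k k' : Fin N} {a : LevelVar n N}
    (ha : a ∈ (entryPoly i k k').vars) : a.1 = i := by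
  classical
  unfold entryPoly at ha
  split_ifs at ha
  · rw [vars_X, Finset.mem_singleton] at ha
    rw [ha]
  · obtain ⟨j, _, hj⟩ := Finset.mem_biUnion.mp (vars_sum_subset _ _ ha)
    have hj := vars_mul _ _ hj
    rw [vars_C, Finset.empty_union] at hj
    have hj := vars_pow _ _ hj
    rw [vars_X, Finset.mem_singleton] at hj
    rw [hj]
  · simp at ha
  · simp at ha

open Classical in
/-- The trace of the power of the tridiagonal model given by the length of the orbit `O`, as a sum
over closed paths parametrized by `O`; each step uses the copy of its starting point. -/
noncomputable def orbitPoly (N : ℕ) (θ : Equiv.Perm (Fin n))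
    (O : Quotient (SameCycle.setoid θ)) : MvPolynomial (LevelVar n N) ℝ :=
  ∑ g : Orbit θ O → Fin N, ∏ i : Orbit θ O, entryPoly i (g i) (g (orbitPerm θ O i))

theorem eval_orbitPoly (θ : Equiv.Perm (Fin n)) (O : Quotient (SameCycle.setoid θ))
    (ξ : ℕ × ℕ → ℝ) :
    eval (fun a => levelGaussian a ξ) (orbitPoly N θ O) =
      Matrix.trace (triModel N ξ ^ Nat.card (Orbit θ O)) := by
  classical
  rw [Nat.card_eq_fintype_card, trace_pow_card_of_isCycleOn _ isCycleOn_orbitPerm]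
  simp only [orbitPoly, map_sum, map_prod, eval_entryPoly]

theorem mk_fst_eq_of_mem_vars_orbitPoly {θ : Equiv.Perm (Fin n)}
    {O : Quotient (SameCycle.setoid θ)} {a : LevelVar n N} (ha : a ∈ (orbitPoly N θ O).vars) :
    Quotient.mk (SameCycle.setoid θ) a.1 = O := by
  classical
  obtain ⟨g, _, hg⟩ := Finset.mem_biUnion.mp (vars_sum_subset _ _ ha)
  obtain ⟨i, _, hi⟩ := Finset.mem_biUnion.mp (vars_prod _ hg)
  rw [fst_eq_of_mem_vars_entryPoly hi]
  exact i.2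

open Classical in
theorem prod_orbitPoly (N : ℕ) (θ : Equiv.Perm (Fin n)) :
    ∏ O, orbitPoly N θ O = ∑ h : Fin n → Fin N, ∏ i, entryPoly i (h i) (h (θ i)) := by
  simp only [orbitPoly]
  rw [Fintype.prod_sum, eq_comm]
  refine Finset.sum_nbij' (fun h O i => h i) (fun g i => g (Quotient.mk _ i) ⟨i, rfl⟩)
    (fun _ _ => Finset.mem_univ _) (fun _ _ => Finset.mem_univ _) (fun _ _ => rfl)
    (fun g _ => ?_) fun h _ => ?_
  · funext O ⟨i, hi⟩
    subst hi
    rfl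
  · have hstep (O : Quotient (SameCycle.setoid θ)) (i : Orbit θ O) :
        ((orbitPerm θ O i : Orbit θ O) : Fin n) = θ i := rfl
    simp only [hstep]
    rw [← Fintype.prod_fiberwise (Quotient.mk (SameCycle.setoid θ))
      fun i => entryPoly i (h i) (h (θ i))]

theorem memLp_levelGaussian (a : LevelVar n N) (k : ℕ) :
    MemLp (levelGaussian a) k normalFamily :=
  memLp_normalFamily (𝕜 := ℝ) ((a.2.1 : ℕ) + 1, (a.2.2 : ℕ)) k

theorem isWick_levelGaussian (n N : ℕ) :
    IsWick (fun a b : LevelVar n N => if a.2 = b.2 then (1 : ℝ) else 0)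
      (expectation (P := normalFamily) memLp_levelGaussian) := by
  let idx : Fin N × Fin (2 * N + 1) → ℕ × ℕ := fun s => ((s.1 : ℕ) + 1, s.2)
  have hidx : Function.Injective idx := by
    rintro ⟨a, b⟩ ⟨c, d⟩ h
    simp only [idx, Prod.mk.injEq, Nat.add_right_cancel_iff] at h
    exact Prod.ext (Fin.ext h.1) (Fin.ext h.2)
  have hwick := isWick_expectation_of_iIndepFun (𝕜 := ℝ) (iIndepFun_normalFamily.precomp hidx)
    (v := fun _ => 1) (fun s => hasLaw_normalFamily (idx s)) fun s => memLp_normalFamily (idx s)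
  let A : LevelVar n N → Fin N × Fin (2 * N + 1) → ℝ := fun b s => if b.2 = s then 1 else 0
  have hA (b : LevelVar n N) : levelGaussian b =ᵐ[normalFamily] fun ξ => ∑ s, A b s * ξ (idx s) :=
    ae_of_all _ fun ξ => by simp [A, levelGaussian, idx]
  have hcov : (fun a b => ∑ s, ∑ t, A a s * (if s = t then 1 else 0) * A b t) =
      fun a b : LevelVar n N => if a.2 = b.2 then (1 : ℝ) else 0 := by
    funext a b
    simp [A, eq_comm]
  exact hcov ▸ hwick.expectation_linear A memLp_levelGaussian hA

/-- The covariances of the Gaussian family whose copies `i` and `i'` agree if `Ψ` relates `i` to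
`i'`, and are independent otherwise. -/
noncomputable def levelCov (N : ℕ) (Ψ : Setoid (Fin n)) (a b : LevelVar n N) : ℝ :=
  partitionMatrix Ψ a.1 b.1 * if a.2 = b.2 then 1 else 0

theorem partitionMatrix_comm (Ψ : Setoid (Fin n)) (i j : Fin n) :
    partitionMatrix Ψ i j = partitionMatrix Ψ j i :=
  open Classical in if_congr Ψ.comm' rfl rfl

theorem isWick_levelCov (N : ℕ) (Ψ : Setoid (Fin n)) :
    IsWick (levelCov N Ψ) (wick (levelCov N Ψ)) :=
  isWick_wick fun a b => by simp only [levelCov, partitionMatrix_comm Ψ a.1 b.1, eq_comm]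

theorem isWick_pathCov_partitionMatrix (N : ℕ) (h : Fin n → ℕ) (Ψ : Setoid (Fin n)) :
    IsWick (pathCov N h (partitionMatrix Ψ)) (wick (pathCov N h (partitionMatrix Ψ))) :=
  isWick_wick fun a b => by simp only [pathCov, partitionMatrix_comm Ψ a.1 b.1, eq_comm]

open Classical in
-- The copies in distinct blocks of `Ψ` are independent, so the product of the expectations attached
-- to the blocks is the Wick functional of the product over all orbits.
theorem prod_integral_trace_eq_wick (N : ℕ) {θ : Equiv.Perm (Fin n)} {Ψ : Setoid (Fin n)}
    (hΨ : SameCycle.setoid θ ≤ Ψ) :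
    ∏ B : Quotient Ψ, ∫ ξ, ∏ O : Quotient (SameCycle.setoid θ) with Quotient.mk Ψ O.out = B,
        Matrix.trace (triModel N ξ ^ Nat.card (Orbit θ O)) ∂normalFamily =
      ∑ h : Fin n → Fin N, wick (levelCov N Ψ) (∏ i, entryPoly i (h i) (h (θ i))) := by
  let p (B : Quotient Ψ) : MvPolynomial (LevelVar n N) ℝ :=
    ∏ O : Quotient (SameCycle.setoid θ) with Quotient.mk Ψ O.out = B, orbitPoly N θ O
  have hcov (a b : LevelVar n N) : levelCov N Ψ a b =
      if Quotient.mk Ψ a.1 = Quotient.mk Ψ b.1 then if a.2 = b.2 then 1 else 0 else 0 := by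
    simp only [levelCov, partitionMatrix, Quotient.eq, ite_mul, one_mul, zero_mul]
  have hvars (B : Quotient Ψ) (a : LevelVar n N) (ha : a ∈ (p B).vars) :
      Quotient.mk Ψ a.1 = B := by
    obtain ⟨O, hO, haO⟩ := Finset.mem_biUnion.mp (vars_prod _ ha)
    rw [← (Finset.mem_filter.mp hO).2, ← mk_fst_eq_of_mem_vars_orbitPoly haO, mk_out_eq hΨ]
  have hblocks := (isWick_levelCov N Ψ).map_prod_of_blocks (isWick_levelGaussian n N) hcov
    (S := Finset.univ) fun B _ => hvars B
  rw [Finset.prod_fiberwise, prod_orbitPoly, map_sum] at hblocks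
  rw [hblocks]
  refine Finset.prod_congr rfl fun B _ => ?_
  simp only [p, expectation_apply, map_prod, eval_orbitPoly]

theorem succ_mem_motzkin_iff {θ : Equiv.Perm (Fin n)} {h : Fin n → Fin N} :
    (fun i => (h i : ℕ) + 1) ∈ motzkin N θ ↔
      ∀ i, (h (θ i) : ℕ) = h i ∨ (h (θ i) : ℕ) = h i + 1 ∨ (h i : ℕ) = h (θ i) + 1 := by
  simp only [motzkin, Finset.mem_filter, Fintype.mem_piFinset, Finset.mem_Icc, abs_le]
  push_cast
  exact ⟨fun hh i => by have := hh.2 i; omega,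
    fun hh => ⟨fun i => ⟨trivial, (h i).isLt⟩, fun i => by have := hh i; omega⟩⟩

theorem prod_entryPoly_eq_zero {θ : Equiv.Perm (Fin n)} {h : Fin n → Fin N}
    (hh : (fun i => (h i : ℕ) + 1) ∉ motzkin N θ) :
    ∏ i, entryPoly i (h i) (h (θ i)) = 0 := by
  simp only [succ_mem_motzkin_iff, not_forall, not_or] at hh
  obtain ⟨i, hdiag, hup, hdown⟩ := hh
  refine Finset.prod_eq_zero (Finset.mem_univ i) ?_
  rw [entryPoly, if_neg hdiag, if_neg hup, if_neg hdown]

/-- The matrix of the linear substitution `z_{ij} ↦ ξ_{h(i)+1, j}`, the right hand side taken in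
the `i`-th copy. -/
def pathSubst (h : Fin n → Fin N) (a : Var n N) (s : LevelVar n N) : ℝ :=
  if (a.1, h a.1, a.2) = s then 1 else 0

theorem linearSubst_pathPolynomial {θ : Equiv.Perm (Fin n)} {h : Fin n → Fin N}
    (hh : (fun i => (h i : ℕ) + 1) ∈ motzkin N θ) :
    linearSubst (pathSubst h) (pathPolynomial N θ fun i => (h i : ℕ) + 1) =
      ∏ i, entryPoly i (h i) (h (θ i)) := by
  have hX (a : Var n N) : linearSubst (pathSubst h) (X a) = X (a.1, h a.1, a.2) := by
    simp [linearSubst_X, pathSubst]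
  have hC (r : ℝ) : linearSubst (pathSubst h) (C r) = C r := (linearSubst _).commutes r
  simp only [pathPolynomial, map_mul, map_prod, map_sum, map_pow, hX, hC, stepSet]
  rw [Finset.prod_filter, Finset.prod_filter, ← Finset.prod_mul_distrib]
  refine Finset.prod_congr rfl fun i _ => ?_
  rw [entryPoly]
  push_cast
  rcases succ_mem_motzkin_iff.mp hh i with hi | hi | hi
  · rw [if_pos (by omega), if_neg (by omega), if_pos hi, mul_one]
  · rw [if_neg (by omega), if_pos (by omega), if_neg (by omega), if_pos hi, one_mul]
  · rw [if_neg (by omega), if_neg (by omega), if_neg (by omega), if_neg (by omega), if_pos hi,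
      one_mul]

theorem wick_levelCov_linearSubst (h : Fin n → Fin N) (Ψ : Setoid (Fin n))
    (p : MvPolynomial (Var n N) ℝ) :
    wick (levelCov N Ψ) (linearSubst (pathSubst h) p) =
      wick (pathCov N (fun i => (h i : ℕ) + 1) (partitionMatrix Ψ)) p := by
  have hcov : (fun a b => ∑ s, ∑ t, pathSubst h a s * levelCov N Ψ s t * pathSubst h b t) =
      pathCov N (fun i => (h i : ℕ) + 1) (partitionMatrix Ψ) := by
    funext a b
    simp only [pathSubst, ite_mul, one_mul, zero_mul, mul_ite, mul_one, mul_zero,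
      Finset.sum_ite_eq, Finset.mem_univ, if_true]
    simp [levelCov, pathCov, Fin.ext_iff]
  have hsubst := (isWick_levelCov N Ψ).comp_linearSubst (pathSubst h)
  rw [hcov] at hsubst
  exact LinearMap.congr_fun (hsubst.unique (isWick_pathCov_partitionMatrix N _ Ψ)) p

theorem sum_wick_levelCov (N : ℕ) (θ : Equiv.Perm (Fin n)) (Ψ : Setoid (Fin n)) :
    ∑ h : Fin n → Fin N, wick (levelCov N Ψ) (∏ i, entryPoly i (h i) (h (θ i))) =
      ∑ h ∈ motzkin N θ,
        wick (pathCov N h (partitionMatrix Ψ)) (pathPolynomial N θ h) := by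
  classical
  rw [← Finset.sum_filter_of_ne (p := fun h : Fin n → Fin N =>
    (fun i => (h i : ℕ) + 1) ∈ motzkin N θ) fun h _ hne => by_contra fun hh => hne (by
      rw [prod_entryPoly_eq_zero hh, map_zero])]
  refine Finset.sum_bij (fun h _ i => (h i : ℕ) + 1) (fun h hh => (Finset.mem_filter.mp hh).2)
    (fun h _ h' _ heq => funext fun i => Fin.ext (Nat.succ_injective (congrFun heq i)))
    (fun h hh => ?_) fun h hh => ?_
  · have hrange (i : Fin n) : 1 ≤ h i ∧ h i ≤ N :=
      Finset.mem_Icc.mp (Fintype.mem_piFinset.mp (Finset.mem_filter.mp hh).1 i)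
    have heq : (fun i => h i - 1 + 1) = h := funext fun i => Nat.sub_add_cancel (hrange i).1
    refine ⟨fun i => ⟨h i - 1, by have := hrange i; omega⟩, ?_, heq⟩
    simp only [Finset.mem_filter, Finset.mem_univ, true_and, heq, hh]
  · rw [← linearSubst_pathPolynomial (Finset.mem_filter.mp hh).2, wick_levelCov_linearSubst]

end PathExpansion

open Classical in
theorem traceCumulant_eq_sum_coarsenings {n N : ℕ} (hN : 0 < N) {Ω : Type*} [MeasurableSpace Ω]
    {P : Measure Ω} [IsProbabilityMeasure P] {Ξ : Ω → Matrix (Fin N) (Fin N) ℂ}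
    (hΞ : IsStandardGUE Ξ P) {lam : n.Partition} {θ : Equiv.Perm (Fin n)}
    (hθ : θ.partition.parts = lam.parts) :
    traceCumulant P Ξ lam = ∑ Ψ with orbitPartition θ ≤ Ψ, moebiusWeight Ψ *
      ∑ h ∈ motzkin N θ, wick (pathCov N h (partitionMatrix Ψ)) (pathPolynomial N θ h) := by
  obtain ⟨b, hb⟩ := exists_equiv_orbits
    (hθ.trans (Multiset.sort_eq lam.parts (· ≥ ·)).symm)
  rw [traceCumulant, jointCumulant_eq_sum_coarsenings P _ (orbitPartition θ) b]
  refine Finset.sum_congr rfl fun Ψ hΨ => ?_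
  rw [← sum_wick_levelCov, ← prod_integral_trace_eq_wick N (Finset.mem_filter.mp hΨ).2]
  refine congrArg _ (Finset.prod_congr rfl fun B _ => ?_)
  rw [hΞ.integral_prod_trace hN]
  refine integral_congr_ae (ae_of_all _ fun ξ => ?_)
  refine Finset.prod_equiv b (fun i => ?_) fun i _ => by rw [hb]
  simp only [Finset.mem_filter, Finset.mem_univ, true_and]
  rfl

end GUECumulant

theorem mainTheorem4 {n N : ℕ} (hn : 0 < n) (hN : 0 < N)
    {Ω : Type*} [MeasurableSpace Ω] (P : Measure Ω) [IsProbabilityMeasure P]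
    (Ξ : Ω → Matrix (Fin N) (Fin N) ℂ) (hΞ : IsStandardGUE Ξ P)
    (lam : n.Partition) (θ : Equiv.Perm (Fin n)) (hθ : θ.partition.parts = lam.parts) :
    traceCumulant P Ξ lam =
        ∑ x ∈ trees (orbitPartition θ) ×ˢ motzkin N θ, expansionTerm N θ x.1 x.2 ∧
      ∀ Γ ∈ trees (orbitPartition θ), ∀ h ∈ motzkin N θ,
        ¬ ((∀ e ∈ Γ, ∀ i ∈ e, ∀ i' ∈ e, h i = h i') ∧
            (∀ e ∈ Γ, (∀ i ∈ e, i ∈ stepSet θ h 0) ∨ (∀ i ∈ e, i ∈ stepSet θ h 1)) ∧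
            (∀ i ∈ stepSet θ h 0, (Γ.filter fun e => i ∈ e).card ≤ 1) ∧
            (∀ i : Fin n, (Γ.filter fun e => i ∈ e).card ≤ 2)) →
          expansionTerm N θ Γ h = 0 := by
  refine ⟨?_, fun Γ _ h _ hcond =>
    by_contra fun hne => hcond (conditions_of_expansionTerm_ne_zero hne)⟩
  rw [traceCumulant_eq_sum_coarsenings hN hΞ hθ, Finset.sum_product, Finset.sum_comm]
  simp only [sum_trees_expansionTerm N _ hn, Finset.mul_sum]
  exact Finset.sum_comm
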